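/- Let $\mathbb{W}=W(\mathbb{F}_4)$ be the Witt vectors of $\mathbb{F}_4$, let $\mathcal{C}: y^2+y=x^3$ be the supersingular curve over $\mathbb{F}_4$, and let $G_{24}=\mathrm{Aut}(\mathcal{C})$ be its automorphism group, of order $24$. Let $C_6=C_2\times C_3\subset G_{24}$, where $C_2$ is generated by the inversion $(x,y)\mapsto(x,y+1)$ and $C_3$ consists of the automorphisms $(x,y)\mapsto(\zeta x,y)$ with $\zeta^3=1$. Let $(E_{\mathcal{C}})_*=\mathbb{W}[[u_1]][u^{\pm1}]$, with $|u_1|=0$ and $|u|=-2$, carry the formal group law of the curve $\mathcal{C}_U: y^2+3u_1xy+(u_1^3-1)y=x^3$ over $\mathbb{W}[[u_1]]$, a universal deformation of the formal group law $F_{\mathcal{C}}$ of $\mathcal{C}$. Then $\mathrm{Aut}(F_{\mathcal{C}})$, and hence $G_{24}$ through the automorphisms it induces on $F_{\mathcal{C}}$, acts on $(E_{\mathcal{C}})_*$ by $\mathbb{W}$-algebra automorphisms: $g$ acts on $\mathbb{W}[[u_1]]$ by the unique automorphism $\varphi$ for which there is a (then unique) isomorphism of formal group laws $f:\varphi_*F_{\mathcal{C}_U}\to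 F_{\mathcal{C}_U}$ lifting the automorphism of $F_{\mathcal{C}}$ induced by $g$, and $g(u)=f'(0)u$. Put $(E_{\mathcal{C}})_*V(0)=(E_{\mathcal{C}})_*/2$ and $$v_1=u_1u^{-1},\quad v_2=u^{-3},\quad j_0=u_1^3,\quad \Delta=27v_2(v_1^3-v_2)^3,\quad c_4=9v_1^4+72v_1v_2,\quad j=c_4^3\Delta^{-1},$$ so that $\Delta$ is the discriminant and $j$ the $j$-invariant of $\mathcal{C}_U$. Then $v_1,\Delta$ and all power series in $j$ are invariant modulo $2$ under $G_{24}$, and $v_1,v_2$ and all power series in $j_0$ are invariant modulo $2$ under $C_6$. Let $h_1$ be (the reduction modulo $2$ of) $\delta(v_1)$, where $\delta$ is the Bockstein associated to $(E_{\mathcal{C}})_*\xrightarrow{2}(E_{\mathcal{C}})_*\to(E_{\mathcal{C}})_*V(0)$. There are isomorphisms of bigraded rings, for the cup product on group cohomology, which send the elements $v_1,\Delta,v_2,h_1$ and the power series in $j$, $j_0$ to the generators of the same names: $$v_1^{-1}H^*(G_{24},(E_{\mathcal{C}})_*V(0))\cong\mathbb{F}_4[[j]][v_1^{\pm1},\Delta^{\pm1},h_1]/(\Delta^{-1}v_1^{12}=j)$$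 and $$v_1^{-1}H^*(C_6,(E_{\mathcal{C}})_*V(0))\cong\mathbb{F}_4[[j_0]][v_1^{\pm1},v_2^{\pm1},h_1]/(v_1^3=v_2j_0).$$ The bidegrees $(s,t)$, with $s$ the cohomological and $t$ the internal degree, are $|h_1|=(1,2)$, $|v_1|=(0,2)$, $|v_2|=(0,6)$, $|\Delta|=(0,24)$, $|j|=|j_0|=(0,0)$. -/

import Mathlib

open CategoryTheory
open scoped DirectSum

namespace MoravaE

noncomputable section

/-! ### Formal group laws of Weierstrass curves -/

section FormalGroupLaw

variable {R : Type*} [CommRing R]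

/-- Approximations to the expansion of `w = -1/y` in the parameter `z = -x/y` at the origin of
the curve, obtained by iterating the Weierstrass equation
`w = z³ + a₁zw + a₂z²w + a₃w² + a₄zw² + a₆w³`. -/
def wApprox (W : WeierstrassCurve R) : ℕ → PowerSeries R
  | 0 => 0
  | n + 1 =>
    PowerSeries.X ^ 3
      + PowerSeries.C W.a₁ * PowerSeries.X * wApprox W n
      + PowerSeries.C W.a₂ * PowerSeries.X ^ 2 * wApprox W n
      + PowerSeries.C W.a₃ * wApprox W n ^ 2
      + PowerSeries.C W.a₄ * PowerSeries.X * wApprox W n ^ 2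
      + PowerSeries.C W.a₆ * wApprox W n ^ 3

/-- The expansion `w(z) = z³ + ⋯` of `w = -1/y` in the parameter `z = -x/y`
(the `n`th approximation is correct modulo `z ^ (n + 3)`). -/
def wSeries (W : WeierstrassCurve R) : PowerSeries R :=
  PowerSeries.mk fun n => PowerSeries.coeff n (wApprox W n)

/-- The slope `λ = (w(z₂) - w(z₁)) / (z₂ - z₁)` of the chord through two points of the curve:
the coefficient of `z₁ ^ i * z₂ ^ j` is the coefficient of `z ^ (i + j + 1)` in `w`. -/
def chordSlope (W : WeierstrassCurve R) : MvPowerSeries (Fin 2) R :=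
  fun e => PowerSeries.coeff (e 0 + e 1 + 1) (wSeries W)

/-- The intercept `ν = w(z₁) - λ z₁` of the chord `w = λ z + ν`. -/
def chordIntercept (W : WeierstrassCurve R) : MvPowerSeries (Fin 2) R :=
  PowerSeries.subst (MvPowerSeries.X (0 : Fin 2) : MvPowerSeries (Fin 2) R) (wSeries W)
    - chordSlope W * MvPowerSeries.X 0

/-- The parameter `z₃` of the third point of the curve on the chord. -/
def thirdPoint (W : WeierstrassCurve R) : MvPowerSeries (Fin 2) R :=
  let l := chordSlope W;
  let ν := chordIntercept W;
  - MvPowerSeries.X 0 - MvPowerSeries.X 1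
    - (MvPowerSeries.C W.a₁ * l + MvPowerSeries.C W.a₂ * ν + MvPowerSeries.C W.a₃ * l ^ 2
        + MvPowerSeries.C (2 * W.a₄) * l * ν + MvPowerSeries.C (3 * W.a₆) * l ^ 2 * ν)
      * MvPowerSeries.invOfUnit (1 + MvPowerSeries.C W.a₂ * l + MvPowerSeries.C W.a₄ * l ^ 2
        + MvPowerSeries.C W.a₆ * l ^ 3) 1

/-- The formal group law `F(z₁, z₂)` of a Weierstrass curve in the parameter `z = -x/y`:
the parameter of the negative of the third point on the chord, where the negative of the point
`(z, w)` has parameter `-z / (1 - a₁z - a₃w)`. -/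
def formalGroupLaw (W : WeierstrassCurve R) : MvPowerSeries (Fin 2) R :=
  - thirdPoint W * MvPowerSeries.invOfUnit
    (1 - MvPowerSeries.C W.a₁ * thirdPoint W
      - MvPowerSeries.C W.a₃ * (chordSlope W * thirdPoint W + chordIntercept W)) 1

/-- The isomorphism of formal group laws, from that of `c • W` to that of `W`, induced by the
change of variables `(x, y) ↦ (u²x + r, u³y + u²sx + t)`. In the coordinates `x = z/w`,
`y = -1/w` it sends `z` to `(u²z + rw) / (u³ - u²sz - tw)`. -/
def formalIso (c : WeierstrassCurve.VariableChange R) (W : WeierstrassCurve R) : PowerSeries R :=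
  (PowerSeries.C ((c.u : R) ^ 2) * PowerSeries.X + PowerSeries.C c.r * wSeries (c • W))
    * PowerSeries.invOfUnit
      (PowerSeries.C ((c.u : R) ^ 3) - PowerSeries.C ((c.u : R) ^ 2 * c.s) * PowerSeries.X
        - PowerSeries.C c.t * wSeries (c • W)) (c.u ^ 3)

end FormalGroupLaw

/-! ### The curves, the ring `E_*` and the action of the automorphism group of the curve -/

/-- The field with four elements. -/
abbrev F4 : Type := GaloisField 2 2

/-- The Witt vectors of `F4`. -/
abbrev W4 : Type := WittVector 2 F4

/-- The degree zero part `E_0 = W(F₄)[[u₁]]`. -/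
abbrev E0 : Type := PowerSeries W4

/-- The parameter `u₁`. -/
abbrev u₁ : E0 := PowerSeries.X

/-- The graded ring `E_* = W(F₄)[[u₁]][u^{±1}]`; the variable `LaurentPolynomial.T 1` is `u`,
of degree `-2`. -/
abbrev E : Type := LaurentPolynomial E0

/-- The supersingular curve `y² + y = x³` over `F4`. -/
def curveC : WeierstrassCurve F4 := ⟨0, 0, 1, 0, 0⟩

/-- The curve `y² + 3u₁xy + (u₁³ - 1)y = x³` over `E_0`. -/
def curveU : WeierstrassCurve E0 := ⟨3 * u₁, 0, u₁ ^ 3 - 1, 0, 0⟩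

/-- The reduction map `E_0 → F4` modulo the maximal ideal `(2, u₁)`. -/
def residue : E0 →+* F4 :=
  (WittVector.constantCoeff : W4 →+* F4).comp (PowerSeries.constantCoeff (R := W4))

/-- The group `G₂₄ = Aut(C)` of automorphisms of the curve `C` over `F4`. -/
abbrev G24 : Type := MulAction.stabilizer (WeierstrassCurve.VariableChange F4) curveC

/-- The subgroup `C₆ = C₂ × C₃` of `G₂₄` of the automorphisms `(x, y) ↦ (ζ²x, y + t)` with
`ζ³ = 1` and `t ∈ {0, 1}`: the factor `C₂` is generated by the inversion `(x, y) ↦ (x, y + 1)` of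
the curve, and `C₃` consists of the automorphisms with `t = 0`. -/
def C6 : Subgroup G24 where
  carrier := {g | g.1.r = 0 ∧ g.1.s = 0}
  one_mem' := ⟨rfl, rfl⟩
  mul_mem' := by
    rintro a b ⟨ha, ha'⟩ ⟨hb, hb'⟩
    simp [WeierstrassCurve.VariableChange.mul_def, ha, ha', hb, hb']
  inv_mem' := by
    rintro a ⟨ha, ha'⟩
    simp [WeierstrassCurve.VariableChange.inv_def, ha, ha']

/-- The automorphism of the formal group law of `C` induced by an automorphism `g` of `C`.
A change of variables is a substitution, so that `g⁻¹` makes this a homomorphism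
from `G24` to power series under composition. -/
def formalAut (g : G24) : PowerSeries F4 :=
  formalIso (g⁻¹ : G24).1 curveC

/-- `ψ` is the automorphism by which `g ∈ Aut(C)` acts on `E_*`, as prescribed by the deformation
theory of Lubin and Tate: there are a `W(F₄)`-algebra automorphism `φ` of `E_0` and an isomorphism
of formal group laws `f : φ_* F → F`, where `F` is the formal group law of the curve `curveU`, such
that `f` lifts the automorphism of the special fibre of `F` induced by `g`; and `ψ` restricts to
`φ` on `E_0` and sends `u` to `f'(0) u`. -/
def IsLubinTateLift (g : G24) (ψ : (E ≃ₐ[W4] E)) : Prop :=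
  ∃ (φ : E0 ≃ₐ[W4] E0) (f : PowerSeries E0),
    PowerSeries.constantCoeff f = 0 ∧
    PowerSeries.subst
        (MvPowerSeries.map (φ : E0 →+* E0) (formalGroupLaw curveU)) f =
      MvPowerSeries.subst
        (fun i : Fin 2 => PowerSeries.subst (MvPowerSeries.X i : MvPowerSeries (Fin 2) E0) f)
        (formalGroupLaw curveU) ∧
    PowerSeries.map residue f = formalAut g ∧
    (∀ a : E0, ψ (LaurentPolynomial.C a) = LaurentPolynomial.C (φ a)) ∧
    ψ (LaurentPolynomial.T 1) =
      LaurentPolynomial.C (PowerSeries.coeff 1 f) * LaurentPolynomial.T 1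

/-- `ρ` is the action of `G₂₄` on `E_*` through its image in the automorphism group of the
formal group law of `C`. -/
def IsLubinTateAction (ρ : G24 →* (E ≃ₐ[W4] E)) : Prop :=
  ∀ g, IsLubinTateLift g (ρ g)

/-- `v₁ = u₁ u⁻¹`. -/
def v₁ : E := LaurentPolynomial.C u₁ * LaurentPolynomial.T (-1)

/-- `v₂ = u⁻³`. -/
def v₂ : E := LaurentPolynomial.T (-3)

/-- `j₀ = u₁³`. -/
def j₀ : E0 := u₁ ^ 3

/-- The discriminant `Δ`, made homogeneous of degree 24 by the factor `u⁻¹²`. -/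
def Δ : E := LaurentPolynomial.C curveU.Δ * LaurentPolynomial.T (-12)

theorem curveU_Δ : curveU.Δ = 27 * (u₁ ^ 3 - 1) ^ 3 := by
  simp only [curveU, WeierstrassCurve.Δ, WeierstrassCurve.b₂, WeierstrassCurve.b₄,
    WeierstrassCurve.b₆, WeierstrassCurve.b₈]
  ring

instance curveU_isElliptic : curveU.IsElliptic where
  isUnit := by
    rw [curveU_Δ, PowerSeries.isUnit_iff_constantCoeff]
    apply WittVector.isUnit_of_coeff_zero_ne_zero
    have h : (2 : F4) = 0 := CharTwo.two_eq_zero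
    have h27 : (27 : F4) = 1 := by
      linear_combination (13 : F4) * h
    have hu : residue u₁ = 0 := by simp [residue]
    have h1 : residue (27 * (u₁ ^ 3 - 1) ^ 3) ≠ 0 := by
      rw [map_mul, map_pow, map_sub, map_ofNat, map_one, map_pow, hu, h27]
      norm_num
    exact h1

/-- The `j`-invariant `j = c₄³ Δ⁻¹` of `curveU`, an element of `E_0`. -/
def jInv : E0 := curveU.j

/-! ### Group cohomology with coefficients in a ring, and cup products -/

section Cohomology

variable {k : Type} [CommRing k] {G : Type} [Group G] {A : Type} [CommRing A] [Algebra k A]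

/-- A commutative `k`-algebra with an action of `G` by automorphisms, as a representation
over `k`. -/
abbrev coeffRep (α : G →* (A ≃ₐ[k] A)) : Rep.{0} k G :=
  Rep.of (X := A)
    { toFun := fun g => (α g).toLinearMap
      map_one' := by ext x; simp
      map_mul' := fun g h => by ext x; simp }

/-- The cup product of inhomogeneous cochains, `(f ∪ h)(x₁, …, x_{p+q}) =
f(x₁, …, x_p) · (x₁ ⋯ x_p) h(x_{p+1}, …, x_{p+q})`. -/
def cup (α : G →* (A ≃ₐ[k] A)) {p q : ℕ} (f : (Fin p → G) → A) (h : (Fin q → G) → A) :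
    (Fin (p + q) → G) → A :=
  fun x => f (fun i => x (Fin.castAdd q i)) *
    α (List.ofFn fun i => x (Fin.castAdd q i)).prod (h fun i => x (Fin.natAdd p i))

/-- Contraction of a sequence at two consecutive places. -/
def contr (y : ℕ → G) (j : ℕ) : ℕ → G :=
  fun k => if k < j then y k else if k = j then y k * y (k + 1) else y (k + 1)

/-- The product of the first `n` terms of a sequence. -/
def pprod (y : ℕ → G) (n : ℕ) : G := (List.ofFn fun i : Fin n => y i).prod

theorem pprod_succ (y : ℕ → G) (n : ℕ) : pprod y (n + 1) = pprod y n * y n := by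
  rw [pprod, List.ofFn_succ']
  simp [pprod]

theorem pprod_contr (y : ℕ → G) (j n : ℕ) :
    pprod (contr y j) n = if j < n then pprod y (n + 1) else pprod y n := by
  induction n with
  | zero => simp [pprod]
  | succ n ih =>
    rw [pprod_succ, ih]
    rcases lt_trichotomy n j with h | h | h
    · rw [if_neg (by omega), if_neg (by omega), pprod_succ, contr, if_pos h]
    · subst h
      simp [contr, pprod_succ, mul_assoc]
    · rw [if_pos h, if_pos (by omega), pprod_succ y (n + 1), contr, if_neg (by omega),
        if_neg (by omega)]

theorem d_seq (α : G →* (A ≃ₐ[k] A)) {n : ℕ} (f : (Fin n → G) → A) (y : ℕ → G) :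
    (inhomogeneousCochains.d (coeffRep α) n).hom f (fun i => y i) = α (y 0) (f fun i => y (i + 1)) +
      ∑ j ∈ Finset.range (n + 1), (-1 : A) ^ (j + 1) * f (fun i => contr y j i) := by
  rw [Finset.sum_range]
  refine (inhomogeneousCochains.d_hom_apply (coeffRep α) n f _).trans ?_
  refine congrArg₂ (· + ·) rfl (Finset.sum_congr rfl fun j _ => ?_)
  have : Fin.contractNth j (· * ·) (fun i : Fin (n + 1) => y i) = fun i : Fin n => contr y j i := by
    funext k
    simp [Fin.contractNth, contr]
  rw [this]
  change ((-1 : k) ^ ((j : ℕ) + 1)) • (f _ : A) = _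
  rw [Algebra.smul_def, map_pow, map_neg, map_one]

theorem cup_seq (α : G →* (A ≃ₐ[k] A)) {p q : ℕ} (f : (Fin p → G) → A) (h : (Fin q → G) → A)
    (y : ℕ → G) : cup α f h (fun i => y i) =
      f (fun i => y i) * α (pprod y p) (h fun i => y (p + i)) := rfl

/-- The cup product of two cocycles is a cocycle. -/
theorem d_cup (α : G →* (A ≃ₐ[k] A)) {p q : ℕ} (f : (Fin p → G) → A) (h : (Fin q → G) → A)
    (hf : (inhomogeneousCochains.d (coeffRep α) p).hom f = 0)
    (hh : (inhomogeneousCochains.d (coeffRep α) q).hom h = 0) :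
    (inhomogeneousCochains.d (coeffRep α) (p + q)).hom (cup α f h) = 0 := by
  funext x
  obtain ⟨y, rfl⟩ : ∃ y : ℕ → G, x = fun i : Fin (p + q + 1) => y i :=
    ⟨fun n => if hn : n < p + q + 1 then x ⟨n, hn⟩ else 1, by
      funext i; simp only [i.2, dif_pos, Fin.eta]⟩
  have hf' := d_seq α f y
  have hh' := d_seq α h (fun k => y (p + k))
  rw [hf] at hf'
  rw [hh] at hh'
  replace hf' : (0 : A) = _ := hf'
  replace hh' : (0 : A) = _ := hh'
  rw [Finset.sum_range_succ] at hf'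
  have e1 : (fun i : Fin p => contr y p i) = fun i : Fin p => y i := by
    funext i; simp [contr]
  rw [e1] at hf'
  refine (d_seq α (cup α f h) y).trans ?_
  change _ = (0 : A)
  rw [show p + q + 1 = p + (q + 1) by ring, Finset.sum_range_add]
  have hP : y 0 * pprod (fun k => y (k + 1)) p = pprod y (p + 1) := by
    simp [pprod, List.ofFn_succ]
  have t0 : α (y 0) (cup α f h fun i => y (i + 1)) =
      α (y 0) (f fun i => y (i + 1)) * α (pprod y (p + 1)) (h fun i => y (p + 1 + i)) := by
    rw [cup_seq α f h (fun k => y (k + 1)), map_mul, ← hP, map_mul α, AlgEquiv.mul_apply]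
    congr 6
    funext i
    congr 1; ring
  have t1 : ∀ j ∈ Finset.range p, (-1 : A) ^ (j + 1) * cup α f h (fun i => contr y j i) =
      ((-1 : A) ^ (j + 1) * f (fun i => contr y j i)) *
        α (pprod y (p + 1)) (h fun i => y (p + 1 + i)) := by
    intro j hj
    have hj := Finset.mem_range.1 hj
    rw [cup_seq, pprod_contr, if_pos hj, mul_assoc]
    congr 4
    funext i
    rw [contr, if_neg (by omega), if_neg (by omega)]
    congr 1; ring
  have t2 : ∀ j ∈ Finset.range (q + 1),
      (-1 : A) ^ (p + j + 1) * cup α f h (fun i => contr y (p + j) i) =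
      ((-1 : A) ^ p * f (fun i => y i)) * α (pprod y p)
        ((-1 : A) ^ (j + 1) * h (fun i => contr (fun k => y (p + k)) j i)) := by
    intro j _
    have e2 : (fun i : Fin p => contr y (p + j) i) = fun i : Fin p => y i := by
      funext i; rw [contr, if_pos (by omega)]
    have e3 : (fun i : Fin q => contr y (p + j) (p + i)) =
        fun i : Fin q => contr (fun k => y (p + k)) j i := by
      funext i; simp [contr, add_assoc]
    rw [cup_seq, pprod_contr, if_neg (by omega), e2, e3, map_mul, map_pow, map_neg, map_one]
    ring
  rw [t0, Finset.sum_congr rfl t1, Finset.sum_congr rfl t2, ← Finset.sum_mul, ← Finset.mul_sum,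
    ← map_sum]
  have hh'' : ∑ j ∈ Finset.range (q + 1),
      ((-1 : A) ^ (j + 1) * h (fun i => contr (fun k => y (p + k)) j i)) =
      - α (y p) (h fun i => y (p + 1 + i)) := by
    rw [eq_neg_iff_add_eq_zero, add_comm]
    simp only [add_zero] at hh'
    rw [hh']
    congr 4
    funext i
    congr 1; ring
  rw [hh'', map_neg, ← AlgEquiv.mul_apply, ← map_mul α, ← pprod_succ]
  linear_combination (- α (pprod y (p + 1)) (h fun i => y (p + 1 + i))) * hf'


/-- The cup product of cocycles, which represents the product in cohomology. -/
def cupCocycle (α : G →* (A ≃ₐ[k] A)) {p q : ℕ} (z : groupCohomology.cocycles (coeffRep α) p)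
    (w : groupCohomology.cocycles (coeffRep α) q) :
    groupCohomology.cocycles (coeffRep α) (p + q) :=
  groupCohomology.cocyclesMk
    (cup α (groupCohomology.iCocycles (coeffRep α) p z)
      (groupCohomology.iCocycles (coeffRep α) q w))
    (d_cup α _ _
      (by
        rw [← groupCohomology.inhomogeneousCochains.d_def]
        exact congr($((groupCohomology.inhomogeneousCochains (coeffRep α)).iCycles_d p (p + 1)) z))
      (by
        rw [← groupCohomology.inhomogeneousCochains.d_def]
        exact congr($((groupCohomology.inhomogeneousCochains (coeffRep α)).iCycles_d q (q + 1)) w)))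

/-- The class in `H⁰(G, A)` of an invariant element of `A`. -/
def invariantClass (α : G →* (A ≃ₐ[k] A)) (a : A) (ha : ∀ g, α g a = a) :
    groupCohomology (coeffRep α) 0 :=
  (groupCohomology.H0Iso (coeffRep α)).inv ⟨a, ha⟩

/-- A linear map that commutes with the actions of `G`, as a map of representations. -/
def coeffHom {B : Type} [CommRing B] [Algebra k B] (α : G →* (A ≃ₐ[k] A)) (β : G →* (B ≃ₐ[k] B)) (f : A →ₗ[k] B)
    (hf : ∀ g a, f (α g a) = β g (f a)) : coeffRep α ⟶ coeffRep β :=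
  Rep.ofHom ⟨f, fun g => by ext a; exact hf g a⟩

/-- Multiplication by an invariant element, as an endomorphism of the representation `A`. -/
def mulHom (α : G →* (A ≃ₐ[k] A)) (a : A) (ha : ∀ g, α g a = a) : coeffRep α ⟶ coeffRep α :=
  coeffHom α α (LinearMap.mulLeft k a) (fun g b => by simp [ha])

/-- Multiplication by an invariant element on group cohomology. -/
def mulInvariant (α : G →* (A ≃ₐ[k] A)) (a : A) (ha : ∀ g, α g a = a) (s : ℕ) :
    groupCohomology (coeffRep α) s → groupCohomology (coeffRep α) s :=
  groupCohomology.map (MonoidHom.id G) (mulHom α a ha) s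

/-- The additive maps `θ s` on `H^s(G, A)` exhibit the commutative ring `S` as the localization
`v⁻¹H^*(G, A)` of the cohomology ring `H^*(G, A) = ⨁ H^s(G, A)` (with the cup product) at the
class of an invariant element `v` of `A`: together they form a ring homomorphism
`θ : H^*(G, A) → S`, the image of `v` is a unit, every element of `S` becomes an element of the
image after multiplication by a power of `v`, and the kernel is the `v`-power torsion. -/
structure IsCohomologyLocalization (α : G →* (A ≃ₐ[k] A)) (v : A) (hv : ∀ g, α g v = v)
    {S : Type} [CommRing S] (θ : ∀ s, groupCohomology (coeffRep α) s →+ S) : Prop where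
  map_one : θ 0 (invariantClass α 1 fun g => map_one (α g)) = 1
  map_cup : ∀ (p q : ℕ) (z : groupCohomology.cocycles (coeffRep α) p)
    (w : groupCohomology.cocycles (coeffRep α) q),
    θ (p + q) (groupCohomology.π (coeffRep α) (p + q) (cupCocycle α z w)) =
      θ p (groupCohomology.π (coeffRep α) p z) * θ q (groupCohomology.π (coeffRep α) q w)
  isUnit : IsUnit (θ 0 (invariantClass α v hv))
  surj : ∀ x : S, ∃ (n : ℕ) (y : ⨁ s, groupCohomology (coeffRep α) s),
    θ 0 (invariantClass α v hv) ^ n * x = DirectSum.toAddMonoid θ y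
  torsion_of_eq_zero : ∀ y : ⨁ s, groupCohomology (coeffRep α) s,
    DirectSum.toAddMonoid θ y = 0 → ∃ n : ℕ, ∀ s, (mulInvariant α v hv s)^[n] (y s) = 0

end Cohomology

/-! ### The coefficients `(E_C)_* V(0) = E_* / 2` and the Bockstein -/

section ModTwo

variable {G : Type} [Group G]

/-- The coefficient ring `E_* V(0) = E_* / 2`. -/
def EV0 : Type := E ⧸ Ideal.span {(2 : E)}

instance : CommRing EV0 := inferInstanceAs (CommRing (E ⧸ Ideal.span {(2 : E)}))

instance : Algebra W4 EV0 := inferInstanceAs (Algebra W4 (E ⧸ Ideal.span {(2 : E)}))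

/-- The reduction `E_* → E_* V(0)`. -/
def red : E →ₐ[W4] EV0 := Ideal.Quotient.mkₐ W4 (Ideal.span {(2 : E)})

theorem red_surjective : Function.Surjective red := Ideal.Quotient.mk_surjective

theorem red_eq_zero_iff (x : E) : red x = 0 ↔ ∃ y, x = 2 * y :=
  (Ideal.Quotient.eq_zero_iff_mem).trans Ideal.mem_span_singleton

theorem span_two_map (ψ : (E ≃ₐ[W4] E)) :
    Ideal.span {(2 : E)} = (Ideal.span {(2 : E)}).map (ψ : E →+* E) := by
  rw [Ideal.map_span, Set.image_singleton, map_ofNat]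

/-- The automorphism of `E_* V(0)` induced by an automorphism of `E_*`. -/
def autModTwo (ψ : (E ≃ₐ[W4] E)) : (EV0 ≃ₐ[W4] EV0) :=
  Ideal.quotientEquivAlg (Ideal.span {(2 : E)}) (Ideal.span {(2 : E)}) ψ (span_two_map ψ)

theorem autModTwo_red (ψ : (E ≃ₐ[W4] E)) (x : E) : autModTwo ψ (red x) = red (ψ x) := rfl

/-- The action on `E_* V(0)` induced by an action on `E_*`. -/
def modTwo (σ : G →* (E ≃ₐ[W4] E)) : G →* (EV0 ≃ₐ[W4] EV0) where
  toFun g := autModTwo (σ g)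
  map_one' := by
    refine AlgEquiv.ext fun x => ?_
    obtain ⟨x, rfl⟩ := red_surjective x
    rw [autModTwo_red, map_one]
    rfl
  map_mul' g h := by
    refine AlgEquiv.ext fun x => ?_
    obtain ⟨x, rfl⟩ := red_surjective x
    rw [autModTwo_red, map_mul]
    rfl

/-- The sequence of representations `E_* → E_* → E_* V(0)`, where the first map is
multiplication by 2. -/
abbrev bocksteinSequence (σ : G →* (E ≃ₐ[W4] E)) : ShortComplex (Rep.{0} W4 G) where
  X₁ := coeffRep σ
  X₂ := coeffRep σ
  X₃ := coeffRep (modTwo σ)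
  f := mulHom σ 2 (fun g => map_ofNat (σ g) 2)
  g := coeffHom σ (modTwo σ) red.toLinearMap (fun _ _ => rfl)
  zero := by
    refine Rep.hom_ext (DFunLike.ext _ _ fun x => ?_)
    exact (red_eq_zero_iff _).2 ⟨x, rfl⟩

theorem bocksteinSequence_shortExact (σ : G →* (E ≃ₐ[W4] E)) :
    (bocksteinSequence σ).ShortExact where
  exact := by
    refine (ShortComplex.exact_map_iff_of_faithful _
      (forget₂ (Rep.{0} W4 G) (ModuleCat.{0} W4))).1 ?_
    rw [ShortComplex.moduleCat_exact_iff]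
    intro x hx
    obtain ⟨y, hy⟩ := (red_eq_zero_iff x).1 hx
    exact ⟨y, hy.symm⟩
  mono_f := by
    rw [Rep.mono_iff_injective]
    intro (x : E) (y : E) hxy
    replace hxy : (2 : E) * x = 2 * y := hxy
    have h2 : (2 : E) ≠ 0 := by
      have h0 : (2 : W4) ≠ 0 := WittVector.p_nonzero 2 F4
      intro h
      have h1 : (2 : E0) = 0 := by
        have h2 := congrArg (fun p : E => p.coeff 0) (h : (2 : E) = 0)
        have h3 : (2 : E) = LaurentPolynomial.C (2 : E0) := (map_ofNat _ 2).symm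
        rw [h3] at h2
        simpa using h2
      refine h0 (PowerSeries.C_injective ?_)
      rw [map_ofNat, map_zero, h1]
    exact mul_left_cancel₀ h2 hxy
  epi_g := by
    rw [Rep.epi_iff_surjective]
    exact red_surjective

/-- The Bockstein `H⁰(G, E_* V(0)) → H¹(G, E_*)`, followed by the reduction
to `H¹(G, E_* V(0))`. -/
def bockstein (σ : G →* (E ≃ₐ[W4] E)) (x : groupCohomology (coeffRep (modTwo σ)) 0) :
    groupCohomology (coeffRep (modTwo σ)) 1 :=
  groupCohomology.map (MonoidHom.id G) (bocksteinSequence σ).g 1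
    (groupCohomology.δ (bocksteinSequence_shortExact σ) 0 1 rfl x)

end ModTwo

/-! ### The rings in the presentations -/

/-- The ring `F₄[[e]][v^{±1}, y^{±1}, h]`; the monomial `v ^ a * y ^ b * h ^ c` has exponent
`(a, b, c)`. -/
abbrev LaurentRing : Type := AddMonoidAlgebra (PowerSeries F4) (ℤ × ℤ × ℕ)

/-- The quotient of `F₄[[e]][v^{±1}, y^{±1}, h]` by one relation. -/
def Presented (r : LaurentRing) : Type := LaurentRing ⧸ Ideal.span {r}

instance (r : LaurentRing) : CommRing (Presented r) :=
  inferInstanceAs (CommRing (LaurentRing ⧸ Ideal.span {r}))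

instance (r : LaurentRing) : Algebra (PowerSeries F4) (Presented r) :=
  inferInstanceAs (Algebra (PowerSeries F4) (LaurentRing ⧸ Ideal.span {r}))

/-- The class of the monomial `v ^ a * y ^ b * h ^ c`. -/
def mon (r : LaurentRing) (a b : ℤ) (c : ℕ) : Presented r :=
  Ideal.Quotient.mk (Ideal.span {r}) (AddMonoidAlgebra.single (a, b, c) 1)

/-- The relation `y⁻¹ v ^ 12 = e`. -/
def relG24 : LaurentRing :=
  AddMonoidAlgebra.single (12, -1, 0) 1 - AddMonoidAlgebra.single (0, 0, 0) PowerSeries.X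

/-- The relation `v ^ 3 = y e`. -/
def relC6 : LaurentRing :=
  AddMonoidAlgebra.single (3, 0, 0) 1 - AddMonoidAlgebra.single (0, 1, 0) PowerSeries.X

/-- The elements of bidegree `(s, t)`, where `e`, `v`, `y`, `h` have bidegrees `(0, 0)`, `(0, 2)`,
`(0, d)` and `(1, 2)`. -/
def bidegree (r : LaurentRing) (d : ℤ) (s : ℕ) (t : ℤ) :
    Submodule (PowerSeries F4) (Presented r) :=
  Submodule.span _ {x | ∃ a b : ℤ, 2 * a + d * b + 2 * s = t ∧ x = mon r a b s}

/-- The elements of `E_* V(0)` of internal degree `2n` (the odd degrees vanish). -/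
def internalDegree (n : ℤ) : Set EV0 :=
  {x | ∃ a : E0, x = red (LaurentPolynomial.C a * LaurentPolynomial.T (-n))}

/-- The power series `p(e)` as an element of `E_0 V(0)`. -/
def evalSeries (e : E0) (p : PowerSeries W4) : EV0 :=
  red (LaurentPolynomial.C (PowerSeries.subst e p))

/-- The localization `v₁⁻¹H^*(G, E_* V(0))` is isomorphic, as a bigraded ring, to
`F₄[[e]][v₁^{±1}, y^{±1}, h₁]/(r)`, where `v₁`, `y`, `e` are classes in `H⁰` of the elements with
the same names, `y` has bidegree `(0, d)`, and `h₁` is the Bockstein of `v₁`. -/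
def LocalizedCohomologyIso {G : Type} [Group G] (σ : G →* (E ≃ₐ[W4] E)) (y : E) (d : ℤ) (e : E0)
    (r : LaurentRing) : Prop :=
  ∃ (hv : ∀ g, modTwo σ g (red v₁) = red v₁) (hy : ∀ g, modTwo σ g (red y) = red y)
    (he : ∀ p g, modTwo σ g (evalSeries e p) = evalSeries e p)
    (θ : ∀ s, groupCohomology (coeffRep (modTwo σ)) s →+ Presented r),
    IsCohomologyLocalization (modTwo σ) (red v₁) hv θ ∧
    (∀ (s : ℕ) (n : ℤ) (z : groupCohomology.cocycles (coeffRep (modTwo σ)) s),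
      (∀ x, groupCohomology.iCocycles (coeffRep (modTwo σ)) s z x ∈ internalDegree n) →
        θ s (groupCohomology.π (coeffRep (modTwo σ)) s z) ∈ bidegree r d s (2 * n)) ∧
    θ 0 (invariantClass (modTwo σ) (red v₁) hv) = mon r 1 0 0 ∧
    θ 0 (invariantClass (modTwo σ) (red y) hy) = mon r 0 1 0 ∧
    (∀ p, θ 0 (invariantClass (modTwo σ) (evalSeries e p) (he p)) =
      algebraMap (PowerSeries F4) (Presented r)
        (PowerSeries.map (WittVector.constantCoeff : W4 →+* F4) p)) ∧
    θ 1 (bockstein σ (invariantClass (modTwo σ) (red v₁) hv)) = mon r 0 0 1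

end

end MoravaE

/-! Everything rests on the inversion `τ` of the curve. It is central of order two and acts on `E`
by `u ↦ -u`, hence trivially on `A = E_* / 2`. For a group of order two acting trivially on a ring
of characteristic two, every cohomology group is a copy of the ring, and a cocycle of degree `s` is
detected by the sum of its values over all `s`-tuples of group elements (`totalSum_inhomD`,
`exists_inhomD_eq`). Restriction to the subgroup generated by `τ` thus becomes a map `evalClass`
from `H^s(G, A)` to `A`. It turns cup products into products (`evalSum_cup`), and its values are
`G`-invariant (`evalSum_invariant`).

Its kernel is `v₁`-power torsion. A class of positive degree that restricts to zero is killed by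
every trace from `τ` to `G` of an element of `A` (`exists_d_eq_of_evalSum_eq_zero`). Since `G`
modulo `τ` acts faithfully on `F₄[[u₁]]`, independence of characters gives a nonzero trace, and a
suitable multiple of it is the trace of an element and equal to a power of `v₁` (`exists_trace`). In
degree zero `evalClass` is injective.

So after inversion of `v₁` the cohomology is one copy of the localized invariants in each degree.
The order `D` of `G` modulo `τ` equals the order of vanishing of `e` modulo 2 (`e = j`, `D = 12` for
`G24`; `e = j₀`, `D = 3` for `C6`), which forces the invariant power series to be the power series
in `e` (`exists_evalSeries`). The Bockstein cocycle of `v₁` takes the value `-v₁` at `τ`, so `h₁`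
restricts to `v₁`, a unit after localization (`evalClass_bockstein`). Recording a class of degree
`s` as its value times `X ^ s` compares the cohomology with the presented ring inside
`F₄((u₁))[u^{±1}][X]`, where `h₁` is `v₁ X`: the presented ring embeds (`compare_injective`), its
image contains the invariants (`mem_range_of_invariant`), and conversely each of its elements comes
from cohomology after multiplication by a power of `v₁` (`exists_pow_mul_mem`).
`localizedCohomologyIso` does this for every `IsGoodAction`, so both groups are treated at once.

What remains is the action itself. For existence, every automorphism of `curveC` lifts to an
explicit isomorphism between `curveU` and a conjugate of it (`exists_isCurveLift`), and changes of
variables induce isomorphisms of formal group laws because they map lines to lines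
(`subst_formalIso_formalGroupLaw`). Uniqueness (`IsFormalLift.unique`) uses only the series `[2](z)
= 2z - 3u₁z² + ⋯`. Its quadratic coefficient determines the conjugate of `u₁` to one order more than
the isomorphism `f` is known, and its reduction, `z⁴` times a unit with zero derivative, then
determines `f` to that order as well. Uniqueness also yields multiplicativity of the action and
allows it to be computed from the explicit lifts. -/

namespace MoravaE

noncomputable section

/-! ### Cochains modulo two -/

section HomogeneousCochains

variable {X Y M : Type*} {A : Type*} [AddCommGroup A]

/-- The differential of homogeneous cochains, without signs. -/
def homD {n : ℕ} (c : (Fin n → X) → A) : (Fin (n + 1) → X) → A :=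
  fun x => ∑ i : Fin (n + 1), c (i.removeNth x)

/-- The differential of inhomogeneous cochains with trivial action, without signs. -/
def inhomD (op : M → M → M) {n : ℕ} (F : (Fin n → M) → A) : (Fin (n + 1) → M) → A :=
  fun y => F (Fin.tail y) + ∑ j : Fin (n + 1), F (Fin.contractNth j op y)

/-- The consecutive differences of a tuple. -/
def diffs (δ : X → X → M) {n : ℕ} (x : Fin (n + 1) → X) : Fin n → M :=
  fun i => δ (x i.castSucc) (x i.succ)

theorem diffs_removeNth_zero (δ : X → X → M) {n : ℕ} (x : Fin (n + 2) → X) :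
    diffs δ ((0 : Fin (n + 2)).removeNth x) = Fin.tail (diffs δ x) := by
  funext i
  simp [diffs, Fin.removeNth, Fin.tail]

theorem diffs_removeNth_succ {δ : X → X → M} {op : M → M → M}
    (hδ : ∀ x y z, op (δ x y) (δ y z) = δ x z) {n : ℕ} (x : Fin (n + 2) → X) (j : Fin (n + 1)) :
    diffs δ (j.succ.removeNth x) = Fin.contractNth j op (diffs δ x) := by
  funext i
  rcases lt_trichotomy (i : ℕ) (j : ℕ) with h | h | h
  · rw [Fin.contractNth_apply_of_lt _ _ _ _ h]
    simp only [diffs, Fin.removeNth]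
    rw [Fin.succAbove_of_castSucc_lt, Fin.succAbove_of_castSucc_lt]
    · rfl
    · simp [Fin.lt_def]; omega
    · simp [Fin.lt_def]; omega
  · rw [Fin.contractNth_apply_of_eq _ _ _ _ h]
    simp only [diffs, Fin.removeNth]
    rw [← Fin.succ_castSucc, hδ, Fin.succAbove_of_castSucc_lt, Fin.succAbove_of_le_castSucc]
    · simp [Fin.le_def]; omega
    · simp [Fin.lt_def]; omega
  · rw [Fin.contractNth_apply_of_gt _ _ _ _ h]
    simp only [diffs, Fin.removeNth]
    rw [Fin.succAbove_of_le_castSucc, Fin.succAbove_of_le_castSucc]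
    · rfl
    · simp [Fin.le_def]; omega
    · simp [Fin.le_def]; omega

theorem homD_comp_diffs {δ : X → X → M} {op : M → M → M}
    (hδ : ∀ x y z, op (δ x y) (δ y z) = δ x z) {n : ℕ} (F : (Fin n → M) → A) :
    homD (fun x : Fin (n + 1) → X => F (diffs δ x)) = fun x => inhomD op F (diffs δ x) := by
  funext x
  rw [homD, Fin.sum_univ_succ, inhomD, diffs_removeNth_zero]
  simp only [diffs_removeNth_succ hδ]

theorem homD_comp {n : ℕ} (c : (Fin n → Y) → A) (r : X → Y) :
    homD (fun x => c (r ∘ x)) = fun x => homD c (r ∘ x) := rfl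

theorem homD_add {n : ℕ} (c c' : (Fin n → X) → A) :
    homD (fun x => c x + c' x) = fun x => homD c x + homD c' x := by
  funext x
  simp [homD, Finset.sum_add_distrib]

theorem homD_cons {n : ℕ} (c : (Fin (n + 1) → X) → A) (x : X) (y : Fin (n + 1) → X) :
    homD c (Fin.cons x y : Fin (n + 2) → X) = c y + homD (fun z => c (Fin.cons x z)) y := by
  rw [homD, Fin.sum_univ_succ]
  congr 1
  refine Finset.sum_congr rfl fun i _ => ?_
  congr 1
  funext k
  refine Fin.cases ?_ (fun k => ?_) k
  · simp [Fin.removeNth]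
  · simp [Fin.removeNth]

/-- The prism operator, a homotopy between the identity and the operator induced by `r`. -/
def prism (r : X → X) : (n : ℕ) → ((Fin (n + 1) → X) → A) → (Fin n → X) → A
  | 0, _, _ => 0
  | n + 1, c, x =>
    c (Fin.cons (x 0) (Fin.cons (r (x 0)) (r ∘ Fin.tail x)))
      + prism r n (fun y => c (Fin.cons (x 0) y)) (Fin.tail x)

theorem prism_add (r : X → X) {n : ℕ} (c c' : (Fin (n + 1) → X) → A) (x : Fin n → X) :
    prism r n (fun y => c y + c' y) x = prism r n c x + prism r n c' x := by
  induction n with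
  | zero => simp [prism]
  | succ n ih => simp only [prism]; rw [ih]; abel

theorem prism_zero (r : X → X) {n : ℕ} (x : Fin n → X) :
    prism r n (0 : (Fin (n + 1) → X) → A) x = 0 := by
  induction n with
  | zero => rfl
  | succ n ih => exact (congrArg₂ (· + ·) rfl (ih _)).trans (add_zero 0)

/-- In the applications `t` is left translation by `τ`. The homotopy then inherits `τ`-invariance
from the cochain, and so can be restricted to the subgroup generated by `τ`. -/
theorem prism_comp (r : X → X) (t : X → X) (ht : ∀ x, r (t x) = t (r x)) {n : ℕ}
    (c : (Fin (n + 1) → X) → A) (x : Fin n → X) :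
    prism r n c (t ∘ x) = prism r n (fun y => c (t ∘ y)) x := by
  induction n with
  | zero => simp [prism]
  | succ n ih =>
    simp only [prism]
    have h : Fin.tail (t ∘ x) = t ∘ Fin.tail x := rfl
    rw [h, ih]
    congr 1
    · congr 1
      funext i
      refine Fin.cases rfl (fun i => Fin.cases ?_ (fun i => ?_) i) i
      · simp [ht]
      · simp [ht, Fin.tail]
    · congr 1
      funext y
      congr 1
      funext i
      exact Fin.cases rfl (fun i => rfl) i

/-- Induction on the number of vertices, splitting off the first one with `homD_cons`. All faces
other than the two ends of the prism occur twice and cancel because `A` has exponent two, so no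
signs are needed. -/
theorem prism_homotopy (h2 : ∀ a : A, a + a = 0) (r : X → X) {n : ℕ} (c : (Fin (n + 1) → X) → A)
    (x : Fin (n + 1) → X) :
    homD (prism r n c) x + prism r (n + 1) (homD c) x = c x + c (r ∘ x) := by
  induction n with
  | zero =>
    have e : homD (prism r 0 c) x = 0 := by simp [homD, prism]
    rw [e]
    simp only [prism, homD, add_zero, zero_add]
    rw [Fin.sum_univ_two, add_comm]
    congr 1
    · congr 1
      funext i
      have : i = 0 := Subsingleton.elim (α := Fin 1) _ _
      subst this; simp [Fin.removeNth]
    · congr 1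
      funext i
      have : i = 0 := Subsingleton.elim (α := Fin 1) _ _
      subst this; simp [Fin.removeNth]
  | succ n ih =>
    obtain ⟨x0, x', rfl⟩ : ∃ x0 x', x = Fin.cons x0 x' := ⟨x 0, Fin.tail x, (Fin.cons_self_tail x).symm⟩
    have hr : (r ∘ (Fin.cons x0 x' : Fin (n + 2) → X)) = Fin.cons (r x0) (r ∘ x') := by
      funext i; exact Fin.cases rfl (fun i => rfl) i
    rw [homD_cons, hr]
    have e1 : (fun z : Fin n → X => prism r (n + 1) c (Fin.cons x0 z)) = fun z =>
        c (Fin.cons x0 (Fin.cons (r x0) (r ∘ z))) + prism r n (fun y => c (Fin.cons x0 y)) z := by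
      funext z; simp [prism]
    have e2 : prism r (n + 2) (homD c) (Fin.cons x0 x') =
        homD c (Fin.cons x0 (Fin.cons (r x0) (r ∘ x'))) +
          (prism r (n + 1) c x' + prism r (n + 1) (homD fun y => c (Fin.cons x0 y)) x') := by
      rw [prism]
      simp only [Fin.cons_zero, Fin.tail_cons]
      simp only [homD_cons, prism_add]
    have e3 := homD_comp (fun z : Fin n → X => c (Fin.cons x0 (Fin.cons (r x0) z))) r
    rw [e1, e2, homD_add, e3]
    simp only [homD_cons]
    have := ih (fun y => c (Fin.cons x0 y)) x'
    have h3 := h2 (prism r (n + 1) c x')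
    have h4 := h2 (homD (fun z : Fin n → X => c (Fin.cons x0 (Fin.cons (r x0) z))) (r ∘ x'))
    have h5 := h2 (c (Fin.cons x0 (r ∘ x')))
    generalize prism r (n + 1) c x' = p at *
    generalize homD (fun z : Fin n → X => c (Fin.cons x0 (Fin.cons (r x0) z))) (r ∘ x') = q at *
    generalize c (Fin.cons x0 (r ∘ x')) = w at *
    have e4 := eq_sub_of_add_eq this
    rw [e4]
    generalize prism r (n + 1) (homD fun y => c (Fin.cons x0 y)) x' = p' at *
    calc _ = (p + p) + (q + q) + (w + w) + (c (Fin.cons x0 x') + c (Fin.cons (r x0) (r ∘ x'))) := by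
          abel
      _ = _ := by rw [h3, h4, h5]; abel

end HomogeneousCochains

/-! ### Cochains of the group of order two -/

section OrderTwo

variable {A : Type*} [AddCommGroup A]

/-- The contraction at the first place multiplies the first two entries; all others leave the first
entry alone. The summand added on the left is the face that the differential of the slice has and
the differential of `F` lacks. -/
theorem inhomD_cons {n : ℕ} (F : (Fin (n + 1) → Bool) → A) (x : Bool) (b : Fin (n + 1) → Bool) :
    inhomD xor F (Fin.cons x b : Fin (n + 2) → Bool) + F (Fin.cons x (Fin.tail b)) =
      F b + F (Fin.cons (xor x (b 0)) (Fin.tail b)) + inhomD xor (fun z => F (Fin.cons x z)) b := by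
  rw [inhomD, Fin.sum_univ_succ, inhomD, Fin.tail_cons]
  have e0 : Fin.contractNth 0 xor (Fin.cons x b : Fin (n + 2) → Bool) =
      Fin.cons (xor x (b 0)) (Fin.tail b) := by
    funext k
    refine Fin.cases ?_ (fun k => ?_) k
    · rw [Fin.contractNth_apply_of_eq _ _ _ _ rfl]; simp
    · rw [Fin.contractNth_apply_of_gt _ _ _ _ (by simp)]; simp [Fin.tail]
  have e1 : ∀ j : Fin (n + 1), Fin.contractNth j.succ xor (Fin.cons x b : Fin (n + 2) → Bool) =
      Fin.cons x (Fin.contractNth j xor b) := by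
    intro j
    funext k
    refine Fin.cases ?_ (fun k => ?_) k
    · rw [Fin.contractNth_apply_of_lt _ _ _ _ (by simp)]; simp
    · simp only [Fin.contractNth, Fin.val_succ, Fin.cons_succ, Nat.add_lt_add_iff_right,
        Nat.add_right_cancel_iff, ← Fin.succ_castSucc]
  simp only [e0, e1]
  abel

theorem inhomD_cons_false (h2 : ∀ a : A, a + a = 0) {n : ℕ} (F : (Fin (n + 1) → Bool) → A)
    (b : Fin (n + 1) → Bool) :
    inhomD xor F (Fin.cons false b : Fin (n + 2) → Bool) =
      F (Fin.cons false (Fin.tail b)) + inhomD xor (fun z => F (Fin.cons false z)) b := by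
  have := inhomD_cons F false b
  rw [Bool.false_xor, Fin.cons_self_tail, h2] at this
  rw [eq_sub_of_add_eq this, zero_add, sub_eq_add_neg, ← eq_neg_of_add_eq_zero_left (h2 _), add_comm]

theorem inhomD_cons_true {n : ℕ} (F : (Fin (n + 1) → Bool) → A)
    (b : Fin (n + 1) → Bool) :
    inhomD xor F (Fin.cons true b : Fin (n + 2) → Bool) =
      F (Fin.cons false (Fin.tail b)) + inhomD xor (fun z => F (Fin.cons true z)) b := by
  have h := inhomD_cons F true b
  have h3 : F b + F (Fin.cons (xor true (b 0)) (Fin.tail b)) =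
      F (Fin.cons false (Fin.tail b)) + F (Fin.cons true (Fin.tail b)) := by
    conv_lhs => rw [← Fin.cons_self_tail b]
    cases hb : b 0 <;> simp [add_comm]
  rw [h3] at h
  have h4 := eq_sub_of_add_eq h
  rw [h4]
  abel

/-- The sum of all values of a cochain of the group of order two. -/
def totalSum {n : ℕ} (F : (Fin n → Bool) → A) : A := ∑ b, F b

theorem totalSum_succ {n : ℕ} (F : (Fin (n + 1) → Bool) → A) :
    totalSum F = totalSum fun b => F (Fin.cons false b) + F (Fin.cons true b) := by
  rw [totalSum, ← (Fin.consEquiv fun _ => Bool).sum_comp, Fintype.sum_prod_type, totalSum,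
    Finset.sum_add_distrib, Fintype.sum_bool, add_comm]
  rfl

/-- By `inhomD_cons_false` and `inhomD_cons_true`, the two slices of a coboundary add up to the
coboundary of the sum of the slices, one degree lower. -/
theorem totalSum_inhomD (h2 : ∀ a : A, a + a = 0) {n : ℕ} (F : (Fin n → Bool) → A) :
    totalSum (inhomD xor F) = 0 := by
  induction n with
  | zero =>
    have : ∀ b, inhomD xor F b = 0 := by
      intro b
      rw [inhomD, Fin.sum_univ_one, Subsingleton.elim (Fin.tail b) (Fin.contractNth 0 xor b), h2]
    simp [totalSum, this]
  | succ n ih =>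
    rw [totalSum_succ, ← ih fun b => F (Fin.cons false b) + F (Fin.cons true b)]
    congr 1
    funext b
    rw [inhomD_cons_false h2, inhomD_cons_true, add_add_add_comm, h2, zero_add]
    simp only [inhomD, Finset.sum_add_distrib]
    abel

theorem eq_zero_of_totalSum_zero (F : (Fin 0 → Bool) → A) (h : totalSum F = 0) (b) : F b = 0 := by
  rw [totalSum, Fintype.sum_unique] at h
  exact (congrArg F (Subsingleton.elim _ _)).trans h

/-- A cocycle of the group of order two with total sum zero is a coboundary. -/
theorem exists_inhomD_eq (h2 : ∀ a : A, a + a = 0) {n : ℕ} (F : (Fin (n + 1) → Bool) → A)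
    (hF : ∀ b, inhomD xor F b = 0) (hs : totalSum F = 0) : ∃ B, ∀ b, inhomD xor B b = F b := by
  have key0 : ∀ b : Fin (n + 1) → Bool,
      inhomD xor (fun z => F (Fin.cons false z)) b = F (Fin.cons false (Fin.tail b)) := by
    intro b
    have := hF (Fin.cons false b)
    rw [inhomD_cons_false h2] at this
    rw [eq_neg_of_add_eq_zero_right this, ← eq_neg_of_add_eq_zero_left (h2 _)]
  have key1 : ∀ b : Fin (n + 1) → Bool,
      inhomD xor (fun z => F (Fin.cons false z) + F (Fin.cons true z)) b = 0 := by
    intro b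
    have := hF (Fin.cons true b)
    rw [inhomD_cons_true, ← key0] at this
    rw [← this]
    simp only [inhomD, Finset.sum_add_distrib]
    abel
  -- As a function of its first entry, `F` is its slice at `false` plus an indicator times the sum
  -- of both slices. By `key0` the first part is a coboundary; by `key1` the second is governed by a
  -- cocycle one degree lower.
  have expand : ∀ b : Fin (n + 1) → Bool, F b = F (Fin.cons false (Fin.tail b)) +
      bif b 0 then F (Fin.cons false (Fin.tail b)) + F (Fin.cons true (Fin.tail b)) else 0 := by
    intro b
    conv_lhs => rw [← Fin.cons_self_tail b]
    cases b 0
    · simp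
    · rw [cond_true, ← add_assoc, h2, zero_add]
  rw [totalSum_succ] at hs
  cases n with
  | zero =>
    refine ⟨fun z => F (Fin.cons false z), fun b => ?_⟩
    rw [key0, expand b]
    have := eq_zero_of_totalSum_zero _ hs (Fin.tail b)
    rw [this]
    simp
  | succ n =>
    obtain ⟨B, hB⟩ := exists_inhomD_eq h2 _ key1 hs
    refine ⟨fun z => F (Fin.cons false z) + bif z 0 then B (Fin.tail z) else 0, fun b => ?_⟩
    have hadd : inhomD xor (fun z => F (Fin.cons false z) + bif z 0 then B (Fin.tail z) else 0) b =
        inhomD xor (fun z => F (Fin.cons false z)) b +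
          inhomD xor (fun z : Fin (n + 1) → Bool => bif z 0 then B (Fin.tail z) else 0) b := by
      simp only [inhomD, Finset.sum_add_distrib]
      abel
    rw [hadd, key0, expand b]
    congr 1
    rw [← Fin.cons_self_tail b]
    cases b 0
    · rw [inhomD_cons_false h2]
      simp [inhomD]
    · rw [inhomD_cons_true]
      simpa using hB _

end OrderTwo

/-! ### Restriction to a central involution that acts trivially, and transfer back. -/

section CentralInvolution

variable {k : Type} [CommRing k] {G : Type} [Group G] {A : Type} [CommRing A] [Algebra k A]

theorem add_self_eq_zero_of_two (h2 : (2 : A) = 0) (a : A) : a + a = 0 := by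
  rw [← two_mul, h2, zero_mul]

theorem d_apply_of_two (h2 : (2 : A) = 0) (α : G →* (A ≃ₐ[k] A)) {n : ℕ} (f : (Fin n → G) → A)
    (y : Fin (n + 1) → G) : (inhomogeneousCochains.d (coeffRep α) n).hom f y =
      α (y 0) (f (Fin.tail y)) + ∑ j : Fin (n + 1), f (Fin.contractNth j (· * ·) y) := by
  refine (inhomogeneousCochains.d_hom_apply (coeffRep α) n f _).trans ?_
  refine congrArg₂ (· + ·) rfl (Finset.sum_congr rfl fun j _ => ?_)
  change ((-1 : k) ^ ((j : ℕ) + 1)) • (f _ : A) = _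
  have h1 : (-1 : A) = 1 := by linear_combination -h2
  rw [Algebra.smul_def, map_pow, map_neg, map_one, h1, one_pow, one_mul]

/-- The homogeneous cochain that corresponds to an inhomogeneous one. -/
def homog (α : G →* (A ≃ₐ[k] A)) {n : ℕ} (f : (Fin n → G) → A) : (Fin (n + 1) → G) → A :=
  fun x => α (x 0) (f (diffs (fun g h => g⁻¹ * h) x))

/-- The homogeneous form removes the action from the differential, so that the homotopies above,
which know nothing of the action, apply. -/
theorem homD_homog (h2 : (2 : A) = 0) (α : G →* (A ≃ₐ[k] A)) {n : ℕ} (f : (Fin n → G) → A) :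
    homD (homog α f) = homog α ((inhomogeneousCochains.d (coeffRep α) n).hom f) := by
  funext x
  have hδ : ∀ x y z : G, (x⁻¹ * y) * (y⁻¹ * z) = x⁻¹ * z := fun x y z => by group
  rw [homD, Fin.sum_univ_succ, homog, homog, diffs_removeNth_zero, d_apply_of_two h2, map_add,
    ← AlgEquiv.mul_apply, ← map_mul, map_sum]
  congr 1
  · congr 2
    simp [diffs, Fin.removeNth]
  · refine Finset.sum_congr rfl fun j _ => ?_
    rw [homog, diffs_removeNth_succ hδ]
    rfl

theorem homog_mul_left (α : G →* (A ≃ₐ[k] A)) {n : ℕ} (f : (Fin n → G) → A) (g : G)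
    (x : Fin (n + 1) → G) : homog α f (fun i => g * x i) = α g (homog α f x) := by
  simp only [homog, map_mul, AlgEquiv.mul_apply]
  congr 3
  funext i
  simp [diffs]

theorem diffs_partialProd {n : ℕ} (y : Fin n → G) :
    diffs (fun g h : G => g⁻¹ * h) (Fin.partialProd y) = y := by
  funext i
  exact Fin.partialProd_right_inv y i

theorem homog_partialProd (α : G →* (A ≃ₐ[k] A)) {n : ℕ} (f : (Fin n → G) → A) (y : Fin n → G) :
    homog α f (Fin.partialProd y) = f y := by
  simp [homog, diffs_partialProd]

/-- An equivariant homogeneous cochain comes from an inhomogeneous one. -/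
theorem homog_of_equivariant (α : G →* (A ≃ₐ[k] A)) {n : ℕ} (c : (Fin (n + 1) → G) → A)
    (hc : ∀ g x, c (fun i => g * x i) = α g (c x)) :
    homog α (fun y => c (Fin.partialProd y)) = c := by
  funext x
  rw [homog, ← hc]
  congr 1
  exact Fin.partialProd_left_inv x

/-- The subgroup of order two generated by an involution, parametrized by `Bool`. -/
def boolPow (τ : G) (b : Bool) : G := if b then τ else 1

theorem boolPow_xor {τ : G} (hτ : τ * τ = 1) (a b : Bool) :
    boolPow τ (xor a b) = boolPow τ a * boolPow τ b := by
  cases a <;> cases b <;> simp [boolPow, hτ]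

/-- The sum of the values of a cochain on the tuples in the subgroup generated by `τ`. -/
def evalSum (τ : G) {n : ℕ} (f : (Fin n → G) → A) : A := totalSum fun b => f (boolPow τ ∘ b)

theorem evalSum_add (τ : G) {n : ℕ} (f f' : (Fin n → G) → A) :
    evalSum τ (f + f') = evalSum τ f + evalSum τ f' := by
  simp [evalSum, totalSum, Finset.sum_add_distrib]

theorem evalSum_zero_degree (τ : G) (f : (Fin 0 → G) → A) (x) : evalSum τ f = f x := by
  rw [evalSum, totalSum, Fintype.sum_unique]
  exact congrArg f (Subsingleton.elim _ _)

theorem evalSum_one_degree (τ : G) (f : (Fin 1 → G) → A) :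
    evalSum τ f = f (fun _ => 1) + f (fun _ => τ) := by
  rw [evalSum, totalSum_succ, totalSum, Fintype.sum_unique]
  congr 1 <;>
  · congr 1
    funext i
    rw [Subsingleton.elim (α := Fin 1) i 0]
    simp [boolPow]

variable {α : G →* (A ≃ₐ[k] A)} {τ : G} 

theorem boolPow_act (ht : ∀ a, α τ a = a) (b : Bool) (a : A) : α (boolPow τ b) a = a := by
  cases b <;> simp [boolPow, ht]

theorem d_boolPow (h2 : (2 : A) = 0) (hτ : τ * τ = 1) (ht : ∀ a, α τ a = a) {n : ℕ}
    (f : (Fin n → G) → A) (b : Fin (n + 1) → Bool) :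
    (inhomogeneousCochains.d (coeffRep α) n).hom f (boolPow τ ∘ b) =
      inhomD xor (fun b => f (boolPow τ ∘ b)) b := by
  rw [d_apply_of_two h2, inhomD, Function.comp_apply, boolPow_act ht]
  congr 1
  refine Finset.sum_congr rfl fun j _ => congrArg f ?_
  funext i
  simp only [Fin.contractNth, Function.comp_apply]
  split_ifs <;> simp [boolPow_xor hτ]

theorem evalSum_d (h2 : (2 : A) = 0) (hτ : τ * τ = 1) (ht : ∀ a, α τ a = a) {n : ℕ}
    (f : (Fin n → G) → A) : evalSum τ ((inhomogeneousCochains.d (coeffRep α) n).hom f) = 0 := by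
  rw [evalSum, ← totalSum_inhomD (add_self_eq_zero_of_two h2) fun b => f (boolPow τ ∘ b)]
  congr 1
  funext b
  exact d_boolPow h2 hτ ht f b

/-- The twist in the cup product disappears because the subgroup acts trivially, and a sum over
tuples of length `p + q` of a product of functions of the two halves factors. -/
theorem evalSum_cup (ht : ∀ a, α τ a = a) {p q : ℕ} (f : (Fin p → G) → A) (h : (Fin q → G) → A) :
    evalSum τ (cup α f h) = evalSum τ f * evalSum τ h := by
  simp only [evalSum, totalSum]
  rw [← (Fin.appendEquiv p q).sum_comp, Fintype.sum_prod_type, Finset.sum_mul_sum]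
  refine Finset.sum_congr rfl fun a _ => Finset.sum_congr rfl fun b _ => ?_
  rw [cup]
  have hl : ∀ l : List Bool, ∀ x, α (l.map (boolPow τ)).prod x = x := by
    intro l x
    induction l with
    | nil => simp
    | cons b l ih => rw [List.map_cons, List.prod_cons, map_mul, AlgEquiv.mul_apply, ih,
        boolPow_act ht]
  have e1 : (List.ofFn fun i => (boolPow τ ∘ (Fin.appendEquiv p q) (a, b)) (Fin.castAdd q i)) =
      (List.ofFn a).map (boolPow τ) := by
    rw [List.map_ofFn]
    congr 1
    funext i
    simp
  rw [e1, hl]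
  congr 2 <;>
  · funext i
    simp

theorem homog_boolPow (hτ : τ * τ = 1) (ht : ∀ a, α τ a = a) {n : ℕ} (f : (Fin n → G) → A)
    (b : Fin (n + 1) → Bool) :
    homog α f (boolPow τ ∘ b) = f (boolPow τ ∘ diffs xor b) := by
  rw [homog, Function.comp_apply, boolPow_act ht]
  congr 1
  funext i
  have hinv : ∀ b, (boolPow τ b)⁻¹ = boolPow τ b := by
    intro b
    cases b
    · simp [boolPow]
    · simp [boolPow, inv_eq_of_mul_eq_one_left hτ]
  simp [diffs, boolPow_xor hτ, hinv]

theorem xor_diffs (x y z : Bool) : xor (xor x y) (xor y z) = xor x z := by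
  cases x <;> cases y <;> cases z <;> rfl

theorem exists_diffs_xor {n : ℕ} (b : Fin n → Bool) :
    ∃ x : Fin (n + 1) → Bool, diffs xor x = b := by
  induction n with
  | zero => exact ⟨fun _ => false, Subsingleton.elim _ _⟩
  | succ n ih =>
    obtain ⟨x, hx⟩ := ih (Fin.tail b)
    refine ⟨Fin.cons (xor (b 0) (x 0)) x, ?_⟩
    funext i
    refine Fin.cases ?_ (fun i => ?_) i
    · simp [diffs]
    · exact congrFun hx i

/-- A homogeneous cochain that is invariant under `τ`, restricted to the subgroup generated by
`τ`. -/
theorem exists_restrict (hτ : τ * τ = 1) {n : ℕ} (c : (Fin (n + 1) → G) → A)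
    (hc : ∀ x, c (fun i => τ * x i) = c x) :
    ∃ F : (Fin n → Bool) → A, ∀ b, c (boolPow τ ∘ b) = F (diffs xor b) := by
  choose s hs using fun b : Fin n → Bool => exists_diffs_xor b
  refine ⟨fun b => c (boolPow τ ∘ s b), fun b => ?_⟩
  have key : ∀ u : Bool, ∀ x, c (fun i => boolPow τ u * x i) = c x := by
    intro u x
    cases u
    · simp [boolPow]
    · exact hc x
  -- Two tuples with the same consecutive differences are translates of each other, by the
  -- discrepancy of their first entries.
  have h1 : ∀ i, b i = xor (xor (b 0) (s (diffs xor b) 0)) (s (diffs xor b) i) := by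
    intro i
    induction i using Fin.induction with
    | zero => cases b 0 <;> cases s (diffs xor b) 0 <;> rfl
    | succ i ih =>
      have h2 := congrFun (hs (diffs xor b)) i
      simp only [diffs] at h2
      have h3 : b i.succ = xor (b i.castSucc) (xor (b i.castSucc) (b i.succ)) := by
        cases b i.castSucc <;> cases b i.succ <;> rfl
      rw [h3, ← h2]
      conv_lhs => arg 1; rw [ih]
      generalize s _ i.castSucc = p
      generalize s _ i.succ = q
      generalize s _ 0 = r
      generalize b 0 = w
      revert p q r w
      decide
  refine Eq.trans ?_ (key (xor (b 0) (s (diffs xor b) 0)) (boolPow τ ∘ s (diffs xor b)))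
  congr 1
  funext i
  rw [Function.comp_apply, Function.comp_apply, ← boolPow_xor hτ, ← h1]

/-- A cochain on which `evalSum` vanishes because it is the coboundary of a cochain
that is only invariant under `τ`. -/
theorem evalSum_eq_zero_of_homog_eq (h2 : (2 : A) = 0) (hτ : τ * τ = 1)
    {n : ℕ} (F : (Fin (n + 1) → Bool) → A) (c : (Fin (n + 1) → G) → A)
    (hc : ∀ x, c (fun i => τ * x i) = c x)
    (h : ∀ b, homD c (boolPow τ ∘ b) = F (diffs xor b)) : totalSum F = 0 := by
  obtain ⟨B, hB⟩ := exists_restrict hτ c hc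
  rw [← totalSum_inhomD (add_self_eq_zero_of_two h2) B]
  congr 1
  funext b
  obtain ⟨x, rfl⟩ := exists_diffs_xor b
  rw [← h]
  exact (congrFun (homD_comp_diffs xor_diffs B) x).symm.trans (by simp only [← hB]; rfl) |>.symm

/-- The values of `evalSum` on cocycles are invariant. -/
theorem evalSum_invariant (h2 : (2 : A) = 0) (hτ : τ * τ = 1) (hc : ∀ g, g * τ = τ * g)
    (ht : ∀ a, α τ a = a) {n : ℕ} (f : (Fin n → G) → A)
    (hf : (inhomogeneousCochains.d (coeffRep α) n).hom f = 0) (g : G) :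
    α g (evalSum τ f) = evalSum τ f := by
  have hcoc : homD (homog α f) = 0 := by
    rw [homD_homog h2, hf]
    funext x
    exact map_zero (α (x 0))
  have ha2 := add_self_eq_zero_of_two h2
  have hcommute : ∀ b, g * boolPow τ b = boolPow τ b * g := by
    intro b; cases b <;> simp [boolPow, hc]
  -- Since the cochain is closed, the prism operator exhibits its sum with its right translate by
  -- `g` as a coboundary.
  have hom : ∀ x, homD (prism (· * g) n (homog α f)) x = homog α f x + homog α f ((· * g) ∘ x) := by
    intro x
    have := prism_homotopy ha2 (· * g) (homog α f) x
    rw [hcoc] at this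
    rw [← this, prism_zero, add_zero]
  -- On tuples in the subgroup, right translation by `g` is left translation because `τ` is central,
  -- and left translation acts through `α g`.
  have hact : ∀ b : Fin (n + 1) → Bool, homog α f ((· * g) ∘ (boolPow τ ∘ b)) =
      α g (f (boolPow τ ∘ diffs xor b)) := by
    intro b
    rw [← homog_boolPow hτ ht f b, ← homog_mul_left]
    congr 1
    funext i
    simp [hcommute]
  have e0 : totalSum (fun b => f (boolPow τ ∘ b) + α g (f (boolPow τ ∘ b))) = 0 := by
    cases n with
    | zero =>
      rw [totalSum, Fintype.sum_unique]
      have := hom (boolPow τ ∘ fun _ => false)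
      rw [hact, homog_boolPow hτ ht] at this
      have h0 : homD (prism (· * g) 0 (homog α f)) (boolPow τ ∘ fun _ => false) = 0 := by
        simp [homD, prism]
      rw [h0] at this
      exact (congrArg (fun b => f (boolPow τ ∘ b) + α g (f (boolPow τ ∘ b)))
        (Subsingleton.elim _ _)).trans this.symm
    | succ n =>
      refine evalSum_eq_zero_of_homog_eq h2 hτ _ (prism (· * g) (n + 1) (homog α f)) ?_ ?_
      · intro x
        refine (prism_comp (· * g) (τ * ·) (fun x => mul_assoc _ _ _) _ x).trans ?_
        congr 1
        funext y
        exact (homog_mul_left α f τ y).trans (ht _)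
      · intro b
        rw [hom, hact, homog_boolPow hτ ht]
  rw [totalSum, Finset.sum_add_distrib, ← map_sum] at e0
  have h3 := ha2 (evalSum τ f)
  rw [evalSum, totalSum] at *
  exact (add_left_cancel (e0.trans h3.symm))

open Classical in
/-- If the relative trace of `a` is `v`, then a cocycle on which `evalSum` vanishes is killed
by `v` in cohomology. -/
theorem exists_d_eq_of_evalSum_eq_zero (h2 : (2 : A) = 0) (hτ : τ * τ = 1)
    (hc : ∀ g, g * τ = τ * g) (ht : ∀ a, α τ a = a) [Fintype (G ⧸ Subgroup.zpowers τ)]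
    (hτ1 : τ ≠ 1) (a v : A) (hv : ∑ q : G ⧸ Subgroup.zpowers τ, α q.out a = v) {n : ℕ}
    (f : (Fin (n + 1) → G) → A)
    (hf : (inhomogeneousCochains.d (coeffRep α) (n + 1)).hom f = 0) (he : evalSum τ f = 0) :
    ∃ f', (inhomogeneousCochains.d (coeffRep α) n).hom f' = fun x => v * f x := by
  have ha2 := add_self_eq_zero_of_two h2
  have hcoc : homD (homog α f) = 0 := by
    rw [homD_homog h2, hf]
    funext x
    exact map_zero (α (x 0))
  have hz : ∀ x : G, x ∈ Subgroup.zpowers τ → x = 1 ∨ x = τ := by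
    rintro _ ⟨m, rfl⟩
    have h2' : τ ^ (2 : ℤ) = 1 := by rw [zpow_two, hτ]
    rcases Int.even_or_odd m with ⟨r, rfl⟩ | ⟨r, rfl⟩
    · left; beta_reduce; rw [← two_mul, zpow_mul, h2', one_zpow]
    · right; beta_reduce; rw [zpow_add, zpow_mul, h2', one_zpow, one_mul, zpow_one]
  obtain ⟨B, hB⟩ := exists_inhomD_eq ha2 (fun b => f (boolPow τ ∘ b))
    (fun b => by rw [← d_boolPow h2 hτ ht, hf]; rfl) he
  -- the retraction of the group to the subgroup
  let ν : G → Bool := fun g => decide (g ≠ (g : G ⧸ Subgroup.zpowers τ).out)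
  have hν : ∀ g, ν (τ * g) = !ν g := by
    intro g
    have e : ((τ * g : G) : G ⧸ Subgroup.zpowers τ) = g := by
      rw [← hc, QuotientGroup.eq]
      simp
    simp only [ν, e]
    have h1 : g⁻¹ * (g : G ⧸ Subgroup.zpowers τ).out ∈ Subgroup.zpowers τ := by
      rw [← QuotientGroup.eq, QuotientGroup.out_eq']
    generalize (g : G ⧸ Subgroup.zpowers τ).out = o at h1
    rcases hz _ h1 with h | h
    · have : o = g := by rw [inv_mul_eq_one] at h; exact h.symm
      subst this
      simp [hτ1]
    · have : o = τ * g := by rw [inv_mul_eq_iff_eq_mul] at h; rw [h, hc]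
      subst this
      simp [hτ1]
  have hcr : ∀ x : Fin (n + 2) → G, homog α f ((boolPow τ ∘ ν) ∘ x) =
      homD (fun y : Fin (n + 1) → G => B (diffs xor (ν ∘ y))) x := by
    intro x
    have h1 := homog_boolPow hτ ht f (ν ∘ x)
    rw [← hB] at h1
    refine h1.trans ?_
    exact (congrFun (homD_comp_diffs xor_diffs B) (ν ∘ x)).symm
  -- The prism joins `f` to its pullback along the retraction, and that pullback is the coboundary
  -- of the pullback of `B`. The result bounds `f`, but it is only known to be invariant under `τ`.
  let b : (Fin (n + 1) → G) → A := fun x =>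
    prism (boolPow τ ∘ ν) (n + 1) (homog α f) x + B (diffs xor (ν ∘ x))
  have hb : homD b = homog α f := by
    funext x
    simp only [b]
    rw [homD_add]
    have := prism_homotopy ha2 (boolPow τ ∘ ν) (homog α f) x
    rw [hcoc, hcr] at this
    rw [prism_zero, add_zero] at this
    beta_reduce
    rw [this, add_assoc, ha2, add_zero]
  have hbτ : ∀ x, b (fun i => τ * x i) = b x := by
    intro x
    simp only [b]
    congr 1
    · refine (prism_comp (boolPow τ ∘ ν) (τ * ·) (fun x => ?_) _ x).trans ?_
      · simp only [Function.comp_apply, hν]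
        cases ν x <;> simp [boolPow, hτ]
      · congr 1
        funext y
        exact (homog_mul_left α f τ y).trans (ht _)
    · congr 1
      funext i
      simp [diffs, hν]
  have hbτ' : ∀ g ∈ Subgroup.zpowers τ, ∀ x, b (fun i => g * x i) = b x := by
    intro g hg x
    rcases hz g hg with rfl | rfl
    · simp
    · exact hbτ x
  have hact : ∀ g ∈ Subgroup.zpowers τ, ∀ a, α g a = a := by
    intro g hg x
    rcases hz g hg with rfl | rfl
    · simp
    · exact ht x
  -- Transfer: the sum over cosets restores equivariance at the price of replacing the weight `a` by
  -- its trace `v`. By `hT` a summand does not depend on the representative of the coset.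
  let T : (Fin (n + 1) → G) → G ⧸ Subgroup.zpowers τ → A := fun x q =>
    α q.out (a * b fun i => q.out⁻¹ * x i)
  have hT : ∀ x (g : G), T x g = α g (a * b fun i => g⁻¹ * x i) := by
    intro x g
    simp only [T]
    obtain ⟨h, hh⟩ := QuotientGroup.mk_out_eq_mul (Subgroup.zpowers τ) g
    rw [hh, map_mul α, AlgEquiv.mul_apply, hact _ h.2]
    congr 2
    rw [← hbτ' _ h.2]
    congr 1
    funext i
    group
  let c : (Fin (n + 1) → G) → A := fun x => ∑ q, T x q
  have hceq : ∀ g x, c (fun i => g * x i) = α g (c x) := by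
    intro g x
    simp only [c]
    rw [map_sum, ← Equiv.sum_comp (MulAction.toPerm g : Equiv.Perm (G ⧸ Subgroup.zpowers τ))]
    refine Finset.sum_congr rfl fun q _ => ?_
    induction q using QuotientGroup.induction_on with
    | H q =>
      have : (MulAction.toPerm g : Equiv.Perm (G ⧸ Subgroup.zpowers τ)) (q : G ⧸ Subgroup.zpowers τ) =
        ((g * q : G) : G ⧸ Subgroup.zpowers τ) := rfl
      rw [this, hT, hT, map_mul α, AlgEquiv.mul_apply]
      congr 4
      funext i
      group
  have hcd : ∀ x, homD c x = v * homog α f x := by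
    intro x
    rw [← hv, Finset.sum_mul]
    simp only [homD, c, T]
    rw [Finset.sum_comm]
    refine Finset.sum_congr rfl fun q _ => ?_
    rw [← map_sum, ← Finset.mul_sum, map_mul]
    congr 1
    have h3 := congrFun hb (fun i => q.out⁻¹ * x i)
    rw [homog_mul_left, homD] at h3
    have h4 := congrArg (α q.out) h3
    rw [← AlgEquiv.mul_apply (α q.out), ← map_mul, mul_inv_cancel, map_one] at h4
    exact h4
  refine ⟨fun y => c (Fin.partialProd y), ?_⟩
  funext y
  rw [← homog_partialProd α ((inhomogeneousCochains.d (coeffRep α) n).hom _) y, ← homD_homog h2,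
    homog_of_equivariant α c hceq, hcd, homog_partialProd]

end CentralInvolution

/-! ### Restriction to the involution on cohomology classes. -/

section EvalClass

variable {k : Type} [CommRing k] {G : Type} [Group G] {A : Type} [CommRing A] [Algebra k A]
  {α : G →* (A ≃ₐ[k] A)} {τ : G}

theorem cohomology_induction {s : ℕ} {C : groupCohomology (coeffRep α) s → Prop}
    (h : ∀ z, C (groupCohomology.π (coeffRep α) s z)) (x) : C x := groupCohomology_induction_on x h

theorem iCocycles_injective (s : ℕ) :
    Function.Injective (groupCohomology.iCocycles (coeffRep α) s) :=
  (ModuleCat.mono_iff_injective _).1 inferInstance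

theorem d_iCocycles {s : ℕ} (z : groupCohomology.cocycles (coeffRep α) s) :
    (inhomogeneousCochains.d (coeffRep α) s).hom (groupCohomology.iCocycles (coeffRep α) s z) = 0 := by
  rw [← groupCohomology.inhomogeneousCochains.d_def]
  exact congr($((groupCohomology.inhomogeneousCochains (coeffRep α)).iCycles_d s (s + 1)) z)

theorem π_eq_zero_of_d_eq {s : ℕ} (z : groupCohomology.cocycles (coeffRep α) (s + 1))
    (f : (Fin s → G) → A)
    (hf : (inhomogeneousCochains.d (coeffRep α) s).hom f =
      groupCohomology.iCocycles (coeffRep α) (s + 1) z) :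
    groupCohomology.π (coeffRep α) (s + 1) z = 0 := by
  have h1 : z = groupCohomology.toCocycles (coeffRep α) s (s + 1) f := by
    apply iCocycles_injective
    rw [← hf, ← groupCohomology.inhomogeneousCochains.d_def]
    exact congr($((groupCohomology.inhomogeneousCochains (coeffRep α)).toCycles_i s (s + 1)) f).symm
  rw [h1]
  exact congr($((groupCohomology.inhomogeneousCochains
    (coeffRep α)).toCycles_comp_homologyπ s (s + 1)) f)

/-- `evalSum` as a linear map. -/
def evalHom (α : G →* (A ≃ₐ[k] A)) (τ : G) (s : ℕ) :
    (groupCohomology.inhomogeneousCochains (coeffRep α)).X s ⟶ ModuleCat.of k A :=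
  ModuleCat.ofHom
    { toFun := fun f => evalSum τ (A := A) f
      map_add' := fun f g => evalSum_add τ f g
      map_smul' := fun r f => by
        change totalSum _ = r • totalSum _
        rw [totalSum, totalSum, Finset.smul_sum]
        rfl }

theorem toCycles_evalHom (h2 : (2 : A) = 0) (hτ : τ * τ = 1) (ht : ∀ a, α τ a = a) (i s : ℕ) :
    (groupCohomology.inhomogeneousCochains (coeffRep α)).toCycles i s ≫
      groupCohomology.iCocycles (coeffRep α) s ≫ evalHom α τ s = 0 := by
  rw [HomologicalComplex.toCycles_i_assoc]
  -- The second case is needed for `s = 0`, which has no predecessor; there the map into degree `s`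
  -- is zero.
  by_cases h : i + 1 = s
  · subst h
    rw [groupCohomology.inhomogeneousCochains.d_def]
    ext f
    exact evalSum_d h2 hτ ht f
  · rw [HomologicalComplex.shape _ _ _ h, Limits.zero_comp]

/-- `evalSum` on cohomology classes. -/
def evalClass (h2 : (2 : A) = 0) (hτ : τ * τ = 1) (ht : ∀ a, α τ a = a) (s : ℕ) :
    groupCohomology (coeffRep α) s ⟶ ModuleCat.of k A :=
  ((groupCohomology.inhomogeneousCochains (coeffRep α)).homologyIsCokernel _ s rfl).desc
    (Limits.CokernelCofork.ofπ (groupCohomology.iCocycles (coeffRep α) s ≫ evalHom α τ s)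
      (toCycles_evalHom h2 hτ ht _ s))

theorem evalClass_π (h2 : (2 : A) = 0) (hτ : τ * τ = 1) (ht : ∀ a, α τ a = a) (s : ℕ)
    (z : groupCohomology.cocycles (coeffRep α) s) :
    evalClass h2 hτ ht s (groupCohomology.π (coeffRep α) s z) =
      evalSum τ (groupCohomology.iCocycles (coeffRep α) s z) := by
  have h := ((groupCohomology.inhomogeneousCochains (coeffRep α)).homologyIsCokernel _ s rfl).fac
    (Limits.CokernelCofork.ofπ (groupCohomology.iCocycles (coeffRep α) s ≫ evalHom α τ s)
      (toCycles_evalHom h2 hτ ht _ s)) Limits.WalkingParallelPair.one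
  exact congr($h z)

theorem evalClass_cup (h2 : (2 : A) = 0) (hτ : τ * τ = 1) (ht : ∀ a, α τ a = a) (p q : ℕ)
    (z : groupCohomology.cocycles (coeffRep α) p) (w : groupCohomology.cocycles (coeffRep α) q) :
    evalClass h2 hτ ht (p + q) (groupCohomology.π (coeffRep α) (p + q) (cupCocycle α z w)) =
      evalClass h2 hτ ht p (groupCohomology.π (coeffRep α) p z) *
        evalClass h2 hτ ht q (groupCohomology.π (coeffRep α) q w) := by
  rw [evalClass_π, evalClass_π, evalClass_π, cupCocycle, groupCohomology.iCocycles_mk]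
  exact evalSum_cup ht _ _

theorem evalClass_invariant (h2 : (2 : A) = 0) (hτ : τ * τ = 1) (hc : ∀ g, g * τ = τ * g)
    (ht : ∀ a, α τ a = a) (s : ℕ) (x : groupCohomology (coeffRep α) s) (g : G) :
    α g (evalClass h2 hτ ht s x) = evalClass h2 hτ ht s x := by
  induction x using cohomology_induction with
  | h z =>
    rw [evalClass_π]
    exact evalSum_invariant h2 hτ hc ht _ (d_iCocycles z) g

theorem iCocycles_π_inv (a : A) (ha : ∀ g, α g a = a) :
    ∃ z : groupCohomology.cocycles (coeffRep α) 0,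
      groupCohomology.π (coeffRep α) 0 z = invariantClass α a ha ∧
      groupCohomology.iCocycles (coeffRep α) 0 z = fun _ => a := by
  refine ⟨(groupCohomology.cocyclesIso₀ (coeffRep α)).inv ⟨a, ha⟩, ?_, ?_⟩
  · rw [invariantClass, groupCohomology.H0Iso]
    rfl
  · have := congr($(groupCohomology.cocyclesIso₀_inv_comp_iCocycles (coeffRep α)) ⟨a, ha⟩)
    exact this

theorem evalClass_invariantClass (h2 : (2 : A) = 0) (hτ : τ * τ = 1) (ht : ∀ a, α τ a = a)
    (a : A) (ha : ∀ g, α g a = a) : evalClass h2 hτ ht 0 (invariantClass α a ha) = a := by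
  obtain ⟨z, hz, hz'⟩ := iCocycles_π_inv a ha
  rw [← hz, evalClass_π, hz']
  exact evalSum_zero_degree τ _ default

theorem map_coeffHom_π {B : Type} [CommRing B] [Algebra k B] {β : G →* (B ≃ₐ[k] B)}
    (f : A →ₗ[k] B) (hf : ∀ g a, f (α g a) = β g (f a)) (s : ℕ)
    (z : groupCohomology.cocycles (coeffRep α) s) :
    ∃ z', groupCohomology.map (MonoidHom.id G) (coeffHom α β f hf) s
          (groupCohomology.π (coeffRep α) s z) = groupCohomology.π (coeffRep β) s z' ∧
      ∀ x, groupCohomology.iCocycles (coeffRep β) s z' x =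
        f (groupCohomology.iCocycles (coeffRep α) s z x : A) := by
  have h1 := HomologicalComplex.homologyπ_naturality
      (groupCohomology.cochainsMap (A := coeffRep α) (B := coeffRep β) (MonoidHom.id G)
        (coeffHom α β f hf)) s
  have h2 := HomologicalComplex.cyclesMap_i
      (groupCohomology.cochainsMap (A := coeffRep α) (B := coeffRep β) (MonoidHom.id G)
        (coeffHom α β f hf)) s
  exact ⟨_, congr($h1 z), fun x => congrFun congr($h2 z) x⟩

theorem mulInvariant_π (a : A) (ha : ∀ g, α g a = a) (s : ℕ)
    (z : groupCohomology.cocycles (coeffRep α) s) :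
    ∃ z', mulInvariant α a ha s (groupCohomology.π (coeffRep α) s z) =
        groupCohomology.π (coeffRep α) s z' ∧
      ∀ x, groupCohomology.iCocycles (coeffRep α) s z' x =
        a * (groupCohomology.iCocycles (coeffRep α) s z x : A) :=
  map_coeffHom_π (LinearMap.mulLeft k a) (fun g b => by simp [ha]) s z

theorem mulInvariant_pow (a : A) (ha : ∀ g, α g a = a) (n s : ℕ)
    (x : groupCohomology (coeffRep α) s) :
    (mulInvariant α a ha s)^[n] x =
      mulInvariant α (a ^ n) (fun g => by rw [map_pow, ha]) s x := by
  induction x using cohomology_induction with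
  | h z =>
    induction n generalizing z with
    | zero =>
      obtain ⟨z', h, h'⟩ := mulInvariant_π (a ^ 0) (fun g => by rw [map_pow, ha]) s z
      rw [h, Function.iterate_zero, id]
      congr 1
      apply iCocycles_injective
      funext x
      rw [h', pow_zero, one_mul]
    | succ n ih =>
      rw [Function.iterate_succ_apply]
      obtain ⟨z', h, h'⟩ := mulInvariant_π a ha s z
      rw [h, ih]
      obtain ⟨z'', h1, h1'⟩ := mulInvariant_π (a ^ n) (fun g => by rw [map_pow, ha]) s z'
      obtain ⟨w, h3, h3'⟩ := mulInvariant_π (a ^ (n + 1)) (fun g => by rw [map_pow, ha]) s z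
      rw [h1, h3]
      congr 1
      apply iCocycles_injective
      funext x
      rw [h1', h3', h', pow_succ, mul_assoc]

/-- If the relative trace of some element is `v ^ n`, then the classes on which `evalClass`
vanishes are killed by `v ^ n`. -/
theorem mulInvariant_eq_zero (h2 : (2 : A) = 0) (hτ : τ * τ = 1) (hc : ∀ g, g * τ = τ * g)
    (ht : ∀ a, α τ a = a) [Fintype (G ⧸ Subgroup.zpowers τ)] (hτ1 : τ ≠ 1) (a v : A)
    (hv : ∀ g, α g v = v) (n : ℕ)
    (ha : ∑ q : G ⧸ Subgroup.zpowers τ, α q.out a = v ^ n) (s : ℕ)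
    (x : groupCohomology (coeffRep α) s) (hx : evalClass h2 hτ ht s x = 0) :
    (mulInvariant α v hv s)^[n] x = 0 := by
  rw [mulInvariant_pow]
  induction x using cohomology_induction with
  | h z =>
    rw [evalClass_π] at hx
    obtain ⟨z', h, h'⟩ := mulInvariant_π (v ^ n) (fun g => by rw [map_pow, hv]) s z
    rw [h]
    cases s with
    | zero =>
      have : z' = 0 := by
        apply iCocycles_injective
        funext x
        rw [h']
        refine (congrArg (v ^ n * ·) ((evalSum_zero_degree τ (A := A)
          (groupCohomology.iCocycles (coeffRep α) 0 z) x).symm.trans hx)).trans ?_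
        rw [map_zero]
        exact mul_zero _
      rw [this, map_zero]
    | succ s =>
      obtain ⟨f', hf'⟩ := exists_d_eq_of_evalSum_eq_zero h2 hτ hc ht hτ1 a (v ^ n) ha _
        (d_iCocycles z) hx
      exact π_eq_zero_of_d_eq z' f' (hf'.trans (funext fun x => (h' x).symm))

end EvalClass

/-! ### The Bockstein restricted to the involution. -/

theorem two_eq_zero_EV0 : (2 : EV0) = 0 := by
  have h : red (2 : E) = 0 := (red_eq_zero_iff _).2 ⟨1, (mul_one _).symm⟩
  rwa [map_ofNat] at h

theorem two_ne_zero_E : (2 : E) ≠ 0 := by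
  have h0 : (2 : W4) ≠ 0 := WittVector.p_nonzero 2 F4
  intro h
  have h1 : (2 : E0) = 0 := by
    have h2 := congrArg (fun p : E => p.coeff 0) (h : (2 : E) = 0)
    have h3 : (2 : E) = LaurentPolynomial.C (2 : E0) := (map_ofNat _ 2).symm
    rw [h3] at h2
    simpa using h2
  refine h0 (PowerSeries.C_injective ?_)
  rw [map_ofNat, map_zero, h1]

theorem iCocycles_isoCocycles₁ {k G A : Type} [CommRing k] [Group G] [CommRing A] [Algebra k A]
    {α : G →* (A ≃ₐ[k] A)} (c : groupCohomology.cocycles₁ (coeffRep α)) (y : Fin 1 → G) :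
    groupCohomology.iCocycles (coeffRep α) 1
      ((groupCohomology.isoCocycles₁ (coeffRep α)).inv c) y = c.1 (y 0) := by
  have := congr($(groupCohomology.isoCocycles₁_inv_comp_iCocycles (coeffRep α)) c)
  exact congrFun this y

/-- The connecting cocycle is `g ↦ (g x - x) / 2`, well defined as 2 is not a zero divisor in `E`.
It is `0` at `1` and `-x` at `τ`, so its values over the subgroup sum to `x` modulo 2. -/
theorem evalClass_bockstein {G : Type} [Group G] (σ : G →* (E ≃ₐ[W4] E)) {τ : G}
    (hτ : τ * τ = 1) (ht : ∀ a, modTwo σ τ a = a) (x : E)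
    (hx : ∀ g, modTwo σ g (red x) = red x) (h : σ τ x = -x) :
    evalClass two_eq_zero_EV0 hτ ht 1 (bockstein σ (invariantClass (modTwo σ) (red x) hx)) =
      red x := by
  have hc : ∀ g, ∃ c, σ g x - x = 2 * c := fun g => by
    rw [← red_eq_zero_iff, map_sub, ← autModTwo_red]
    exact sub_eq_zero.2 (hx g)
  choose c hc using hc
  have hδ := groupCohomology.δ₀_apply (bocksteinSequence_shortExact σ) ⟨red x, hx⟩ x rfl c
    (by
      funext g
      exact (hc g).symm)
  have h0 : invariantClass (modTwo σ) (red x) hx =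
    (groupCohomology.H0Iso (bocksteinSequence σ).X₃).inv ⟨red x, hx⟩ := rfl
  rw [bockstein, h0, hδ]
  obtain ⟨z, hz, hz'⟩ := map_coeffHom_π (α := σ) (β := modTwo σ) red.toLinearMap (fun _ _ => rfl) 1
    ((groupCohomology.isoCocycles₁ (coeffRep σ)).inv
      ⟨c, groupCohomology.mem_cocycles₁_of_comp_eq_d₀₁ (bocksteinSequence_shortExact σ)
        (y := x) (x := c) (by funext g; exact (hc g).symm)⟩)
  refine (congrArg (evalClass two_eq_zero_EV0 hτ ht 1) hz).trans ?_
  rw [evalClass_π]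
  refine (evalSum_one_degree τ (A := EV0) _).trans ?_
  rw [hz', hz', iCocycles_isoCocycles₁, iCocycles_isoCocycles₁]
  have c1 : c 1 = 0 := by
    have := hc 1
    rw [map_one, AlgEquiv.one_apply, sub_self] at this
    exact ((mul_eq_zero.1 this.symm).resolve_left two_ne_zero_E)
  have cτ : c τ = -x := by
    have := hc τ
    rw [h] at this
    refine mul_left_cancel₀ two_ne_zero_E (this.symm.trans ?_)
    ring
  change red (c 1) + red (c τ) = red x
  rw [c1, cτ, map_zero, zero_add, map_neg]
  linear_combination -(red x) * two_eq_zero_EV0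

/-! ### Expansions of power series -/

section Expansion

variable {k : Type*} [Field k]

/-- The solution of a triangular system of linear equations. -/
def triSolve (M : ℕ → ℕ → k) (f : ℕ → k) : ℕ → k
  | n => (f n - ∑ m : Fin n, triSolve M f m * M n m) / M n n
decreasing_by exact m.2

theorem triSolve_spec (M : ℕ → ℕ → k) (hM : ∀ n, M n n ≠ 0) (f : ℕ → k) (n : ℕ) :
    ∑ m ∈ Finset.range (n + 1), triSolve M f m * M n m = f n := by
  rw [Finset.sum_range_succ, Finset.sum_range]
  conv_lhs => arg 2; rw [triSolve]
  rw [div_mul_cancel₀ _ (hM n)]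
  ring

/-- Every power series is a combination of `1, X, …, X ^ (D - 1)` with coefficients that are power
series in a series `e` of order `D`. -/
theorem exists_expansion {D : ℕ} (hD : 0 < D) (e w : PowerSeries k)
    (hw : PowerSeries.constantCoeff w ≠ 0) (he : e = PowerSeries.X ^ D * w) (f : PowerSeries k) :
    ∃ c : Fin D → PowerSeries k, f = ∑ i : Fin D, PowerSeries.X ^ (i : ℕ) * PowerSeries.subst e (c i) := by
  have hs : PowerSeries.HasSubst e := by
    apply PowerSeries.HasSubst.of_constantCoeff_zero'
    rw [he, map_mul, map_pow, PowerSeries.constantCoeff_X, zero_pow hD.ne', zero_mul]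
  -- The product with index `m` has order exactly `m`, because `m % D + D * (m / D) = m`. The matrix
  -- of coefficients is therefore triangular with nonzero diagonal.
  let M : ℕ → ℕ → k := fun n m => PowerSeries.coeff n (PowerSeries.X ^ (m % D) * e ^ (m / D))
  have hb : ∀ m, PowerSeries.X ^ (m % D) * e ^ (m / D) = PowerSeries.X ^ m * w ^ (m / D) := by
    intro m
    rw [he, mul_pow, ← pow_mul, ← mul_assoc, ← pow_add, Nat.mod_add_div]
  have hM : ∀ n, M n n ≠ 0 := by
    intro n
    simp only [M, hb]
    rw [PowerSeries.coeff_X_pow_mul', if_pos le_rfl, Nat.sub_self,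
      PowerSeries.coeff_zero_eq_constantCoeff_apply, map_pow]
    exact pow_ne_zero _ hw
  have hM0 : ∀ n m, n < m → M n m = 0 := by
    intro n m h
    simp only [M, hb]
    rw [PowerSeries.coeff_X_pow_mul', if_neg (by omega)]
  let a := triSolve M fun n => PowerSeries.coeff n f
  -- The unknown with index `i + D * q` is the coefficient of `e ^ q` in the series that multiplies
  -- `X ^ i`.
  refine ⟨fun i => PowerSeries.mk fun q => a (i + D * q), ?_⟩
  ext n
  have h1 : ∀ i : Fin D, PowerSeries.coeff n (PowerSeries.X ^ (i : ℕ) *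
      PowerSeries.subst e (PowerSeries.mk fun q => a (i + D * q))) =
      ∑ q : Fin (n + 1), a (i + D * q) * M n (i + D * q) := by
    intro i
    have hm : ∀ q, (i + D * q) % D = i ∧ (i + D * q) / D = q := fun q =>
      ⟨by rw [Nat.add_mul_mod_self_left, Nat.mod_eq_of_lt i.2],
        by rw [Nat.add_mul_div_left _ _ hD, Nat.div_eq_of_lt i.2, zero_add]⟩
    rw [PowerSeries.coeff_X_pow_mul']
    split_ifs with h
    · rw [PowerSeries.coeff_subst' hs, finsum_eq_sum_of_support_subset (s := Finset.range (n + 1)),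
        Finset.sum_range]
      · refine Finset.sum_congr rfl fun q _ => ?_
        simp only [M, (hm q).1, (hm q).2]
        rw [PowerSeries.coeff_mk, smul_eq_mul, PowerSeries.coeff_X_pow_mul', if_pos h]
      · intro q hq
        rw [Finset.coe_range, Set.mem_Iio]
        by_contra hlt
        refine hq ?_
        beta_reduce
        rw [he, mul_pow, ← pow_mul, PowerSeries.coeff_X_pow_mul', if_neg, smul_zero]
        have : q ≤ D * q := Nat.le_mul_of_pos_left q hD
        omega
    · refine (Finset.sum_eq_zero fun q _ => ?_).symm
      rw [hM0 _ _ (by omega), mul_zero]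
  rw [map_sum, Finset.sum_congr rfl fun i _ => h1 i, Finset.sum_comm, ← Fintype.sum_prod_type']
  have h2 := Equiv.sum_comp (finProdFinEquiv (m := n + 1) (n := D)) fun m => a m * M n m
  refine Eq.trans ?_ h2.symm
  rw [← Finset.sum_range fun m => a m * M n m, ← Finset.sum_subset
    (Finset.range_subset_range.2 (Nat.le_mul_of_pos_right (n + 1) hD))]
  · exact (triSolve_spec M hM (fun n => PowerSeries.coeff n f) n).symm
  · intro m _ h
    rw [hM0 _ _ (by simpa using h), mul_zero]

/-- A nonzero `p` is a power of `X` times a unit, so its value at `e` is a power of `e` times a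
unit, in a domain. -/
theorem subst_injective {D : ℕ} (hD : 0 < D) (e w : PowerSeries k)
    (hw : PowerSeries.constantCoeff w ≠ 0) (he : e = PowerSeries.X ^ D * w) (p : PowerSeries k)
    (hp : PowerSeries.subst e p = 0) : p = 0 := by
  by_contra h
  have hs : PowerSeries.HasSubst e := by
    apply PowerSeries.HasSubst.of_constantCoeff_zero'
    rw [he, map_mul, map_pow, PowerSeries.constantCoeff_X, zero_pow hD.ne', zero_mul]
  obtain ⟨q, hq, hq'⟩ : ∃ q : PowerSeries k, PowerSeries.constantCoeff q ≠ 0 ∧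
      p = PowerSeries.X ^ p.order.toNat * q := by
    refine ⟨_, ?_, (PowerSeries.X_pow_order_mul_divXPowOrder (f := p)).symm⟩
    rw [PowerSeries.constantCoeff_divXPowOrder]
    exact PowerSeries.coeff_order (by simpa using h)
  rw [hq', PowerSeries.subst_mul hs, PowerSeries.subst_pow hs, PowerSeries.subst_X hs] at hp
  have he0 : e ≠ 0 := by
    rw [he]
    refine mul_ne_zero (pow_ne_zero _ PowerSeries.X_ne_zero) ?_
    rintro rfl
    simp at hw
  have h1 := (mul_eq_zero.1 hp).resolve_left (pow_ne_zero _ he0)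
  obtain ⟨u, rfl⟩ := (PowerSeries.isUnit_iff_constantCoeff.2 (isUnit_iff_ne_zero.2 hq))
  have h2 := (u.isUnit.map (PowerSeries.substAlgHom hs)).ne_zero
  rw [PowerSeries.coe_substAlgHom] at h2
  exact h2 h1

end Expansion

/-! ### Reduction modulo two -/

/-- Reduction of the coefficients `E_0 → F₄[[u₁]]` modulo 2. -/
def redSeries : E0 →+* PowerSeries F4 := PowerSeries.map (WittVector.constantCoeff : W4 →+* F4)

theorem redSeries_surjective : Function.Surjective redSeries :=
  PowerSeries.map_surjective _ (WittVector.constantCoeff_surjective 2)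

theorem redSeries_eq_zero_iff (a : E0) : redSeries a = 0 ↔ ∃ b, a = 2 * b := by
  constructor
  · intro h
    have h1 : ∀ n, ∃ b, PowerSeries.coeff n a = 2 * b := by
      intro n
      have : PowerSeries.coeff n a ∈ RingHom.ker (WittVector.constantCoeff : W4 →+* F4) := by
        have := congrArg (PowerSeries.coeff n) h
        rwa [redSeries, PowerSeries.coeff_map, map_zero] at this
      rw [WittVector.ker_constantCoeff] at this
      exact_mod_cast Ideal.mem_span_singleton'.1 this |>.imp fun b hb => by rw [← hb, mul_comm]; rfl
    choose b hb using h1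
    refine ⟨PowerSeries.mk b, ?_⟩
    ext1 n
    have : (2 : E0) = PowerSeries.C 2 := (map_ofNat _ 2).symm
    rw [hb, this, PowerSeries.coeff_C_mul, PowerSeries.coeff_mk]
  · rintro ⟨b, rfl⟩
    have : (2 : PowerSeries F4) = 0 := by
      have : (2 : F4) = 0 := CharTwo.two_eq_zero
      rw [← map_ofNat PowerSeries.C 2, this, map_zero]
    rw [map_mul, map_ofNat, this, zero_mul]

/-- The field of fractions of `F₄[[u₁]]`. -/
def LF : Type := FractionRing (PowerSeries F4)

instance : Field LF := inferInstanceAs (Field (FractionRing (PowerSeries F4)))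

instance : Algebra (PowerSeries F4) LF :=
  inferInstanceAs (Algebra (PowerSeries F4) (FractionRing (PowerSeries F4)))

instance : IsFractionRing (PowerSeries F4) LF :=
  inferInstanceAs (IsFractionRing (PowerSeries F4) (FractionRing (PowerSeries F4)))

/-- The map `E_0 → F₄[[u₁]] → F₄((u₁))`. -/
def toLF : E0 →+* LF := (algebraMap (PowerSeries F4) LF).comp redSeries

theorem toLF_eq_iff (a b : E0) : toLF a = toLF b ↔ redSeries a = redSeries b :=
  (IsFractionRing.injective (PowerSeries F4) LF).eq_iff

/-! ### The localized coefficient ring -/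

theorem laurentC_injective {R : Type*} [Semiring R] :
    Function.Injective (LaurentPolynomial.C : R →+* LaurentPolynomial R) := fun a b h => by
  have := congrArg (fun p => p.coeff 0) h
  simpa using this

/-- The ring `F₄((u₁))[u^{±1}]`. -/
abbrev ULoc : Type := LaurentPolynomial LF

/-- The map `E_* → F₄((u₁))[u^{±1}]`. -/
def toULift : E →+* ULoc := AddMonoidAlgebra.mapRingHom ℤ toLF

theorem toULift_coeff (x : E) (n : ℤ) : (toULift x).coeff n = toLF (x.coeff n) := by
  simp [toULift]

theorem toULift_C_mul_T (a : E0) (n : ℤ) :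
    toULift (LaurentPolynomial.C a * LaurentPolynomial.T n) =
      LaurentPolynomial.C (toLF a) * LaurentPolynomial.T n := by
  rw [← LaurentPolynomial.single_eq_C_mul_T, ← LaurentPolynomial.single_eq_C_mul_T]
  simp [toULift, -LaurentPolynomial.single_eq_C_mul_T]

theorem toULift_C (a : E0) : toULift (LaurentPolynomial.C a) = LaurentPolynomial.C (toLF a) := by
  have := toULift_C_mul_T a 0
  simpa using this

theorem toULift_eq_zero_iff (x : E) : toULift x = 0 ↔ ∃ y, x = 2 * y := by
  constructor
  · intro h
    have h1 : ∀ a, ∃ b, redSeries a = 0 → a = 2 * b := fun a => by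
      by_cases ha : redSeries a = 0
      · exact ((redSeries_eq_zero_iff a).1 ha).imp fun b hb _ => hb
      · exact ⟨0, fun h => absurd h ha⟩
    choose b hb using h1
    refine ⟨∑ n ∈ x.coeff.support, AddMonoidAlgebra.single n (b (x.coeff n)), ?_⟩
    have h2 : x = ∑ n ∈ x.coeff.support, AddMonoidAlgebra.single n (x.coeff n) :=
      (AddMonoidAlgebra.sum_coeff_single x).symm
    conv_lhs => rw [h2]
    rw [Finset.mul_sum]
    refine Finset.sum_congr rfl fun n _ => ?_
    have h3 : redSeries (x.coeff n) = 0 := by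
      have := congrArg (fun p : ULoc => p.coeff n) h
      simp only [toULift_coeff] at this
      rw [← map_zero redSeries, ← toLF_eq_iff, this, map_zero]
      rfl
    have h4 : (2 : E) = LaurentPolynomial.C 2 := (map_ofNat _ 2).symm
    conv_lhs => rw [hb _ h3]
    rw [LaurentPolynomial.single_eq_C_mul_T, LaurentPolynomial.single_eq_C_mul_T, h4, map_mul,
      mul_assoc]
  · rintro ⟨y, rfl⟩
    have : toLF 2 = toLF 0 := by
      rw [toLF_eq_iff, map_zero]
      exact (redSeries_eq_zero_iff 2).2 ⟨1, (mul_one _).symm⟩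
    have h4 : (2 : E) = LaurentPolynomial.C 2 := (map_ofNat _ 2).symm
    rw [map_mul, h4, toULift_C, this, map_zero, map_zero, zero_mul]

/-- The map `E_* / 2 → F₄((u₁))[u^{±1}]`. -/
def toU : EV0 →+* ULoc :=
  Ideal.Quotient.lift (Ideal.span {(2 : E)}) toULift fun x hx => by
    rw [toULift_eq_zero_iff]
    exact Ideal.mem_span_singleton.1 hx

theorem toU_red (x : E) : toU (red x) = toULift x := rfl

/-- Passing to `F₄((u₁))[u^{±1}]` loses nothing and makes `v₁` a unit, so that identities can be
checked there. -/
theorem toU_injective : Function.Injective toU := by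
  rw [injective_iff_map_eq_zero]
  intro x hx
  obtain ⟨x, rfl⟩ := red_surjective x
  rw [toU_red, toULift_eq_zero_iff] at hx
  exact (red_eq_zero_iff x).2 hx

/-- The image of an element of `E_0` in `E_* / 2`. -/
def redC (a : E0) : EV0 := red (LaurentPolynomial.C a)

theorem redC_eq_iff (a b : E0) : redC a = redC b ↔ redSeries a = redSeries b := by
  rw [← toLF_eq_iff, ← toU_injective.eq_iff, redC, redC, toU_red, toU_red, toULift_C, toULift_C]
  exact laurentC_injective.eq_iff

theorem toU_redC (a : E0) : toU (redC a) = LaurentPolynomial.C (toLF a) := by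
  rw [redC, toU_red, toULift_C]

/-- Units of `F₄((u₁))` as units of `F₄((u₁))[u^{±1}]`. -/
def unitC (x : LF) (hx : x ≠ 0) : ULocˣ :=
  Units.map (LaurentPolynomial.C : LF →+* ULoc).toMonoidHom (Units.mk0 x hx)

/-- The variable `u` as a unit. -/
def unitT : ULocˣ where
  val := LaurentPolynomial.T 1
  inv := LaurentPolynomial.T (-1)
  val_inv := by rw [← LaurentPolynomial.T_add]; rfl
  inv_val := by rw [← LaurentPolynomial.T_add]; rfl

theorem unitT_zpow (n : ℤ) : ((unitT ^ n : ULocˣ) : ULoc) = LaurentPolynomial.T n := by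
  induction n using Int.induction_on with
  | zero => rfl
  | succ n ih => rw [zpow_add_one, Units.val_mul, ih, LaurentPolynomial.T_add]; rfl
  | pred n ih =>
    rw [zpow_sub_one, Units.val_mul, ih, sub_eq_add_neg, LaurentPolynomial.T_add]; rfl

theorem redSeries_u₁ : redSeries u₁ = PowerSeries.X := by simp [redSeries, u₁]

theorem toLF_u₁_ne_zero : toLF u₁ ≠ 0 := by
  rw [← map_zero toLF, Ne, toLF_eq_iff, redSeries_u₁, map_zero]
  exact PowerSeries.X_ne_zero

/-- The element `v₁` as a unit. -/
def unitV : ULocˣ := unitC (toLF u₁) toLF_u₁_ne_zero * unitT⁻¹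

theorem toU_v₁ : toU (red v₁) = unitV := by
  rw [toU_red, v₁, toULift_C_mul_T]
  rfl

/-- The hypotheses on `e`: it has order `D` modulo 2. -/
structure HasRedOrder (D : ℕ) (e : E0) : Prop where
  pos : 0 < D
  order : ∃ w : PowerSeries F4, PowerSeries.constantCoeff w ≠ 0 ∧
    redSeries e = PowerSeries.X ^ D * w
  constantCoeff : PowerSeries.constantCoeff e = 0

section Presentation

variable {D : ℕ} {e : E0} (H : HasRedOrder D e)

include H

theorem HasRedOrder.hasSubst : PowerSeries.HasSubst e :=
  PowerSeries.HasSubst.of_constantCoeff_zero' H.constantCoeff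

theorem HasRedOrder.hasSubst_red : PowerSeries.HasSubst (redSeries e) := by
  apply PowerSeries.HasSubst.of_constantCoeff_zero'
  obtain ⟨w, -, hw⟩ := H.order
  rw [hw, map_mul, map_pow, PowerSeries.constantCoeff_X, zero_pow H.pos.ne', zero_mul]

theorem HasRedOrder.subst_injective (p : PowerSeries F4)
    (hp : PowerSeries.subst (redSeries e) p = 0) : p = 0 := by
  obtain ⟨w, hw, hw'⟩ := H.order
  exact MoravaE.subst_injective H.pos _ w hw hw' p hp

theorem HasRedOrder.redSeries_subst (p : PowerSeries W4) :
    redSeries (PowerSeries.subst e p) =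
      PowerSeries.subst (redSeries e) (redSeries p) :=
  PowerSeries.map_subst H.hasSubst p

theorem HasRedOrder.toLF_ne_zero : toLF e ≠ 0 := by
  rw [← map_zero toLF, Ne, toLF_eq_iff, map_zero]
  intro h
  have := H.subst_injective PowerSeries.X (by rw [PowerSeries.subst_X H.hasSubst_red, h])
  exact PowerSeries.X_ne_zero this

omit H in
/-- The monomial `v ^ a * y ^ b * h ^ c`, where `y = v ^ D / e`. -/
def monomialHom (H : HasRedOrder D e) : Multiplicative (ℤ × ℤ × ℕ) →* Polynomial ULoc where
  toFun x := Polynomial.C ((unitV ^ (x.toAdd.1) *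
      (unitV ^ D * (unitC _ H.toLF_ne_zero)⁻¹) ^ (x.toAdd.2.1) : ULocˣ) : ULoc) *
    -- The variable `h` goes to `v₁ X` rather than `X`, because `evalClass` sends the Bockstein of
    -- `v₁` to `v₁`.
    (Polynomial.C (unitV : ULoc) * Polynomial.X) ^ x.toAdd.2.2
  map_one' := by simp
  map_mul' x y := by
    simp only [toAdd_mul, Prod.fst_add, Prod.snd_add, zpow_add, pow_add, Units.val_mul, map_mul]
    ring

omit H in
/-- Evaluation of power series at `e`. -/
def evalAt (H : HasRedOrder D e) : PowerSeries F4 →+* ULoc :=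
  ((LaurentPolynomial.C : LF →+* ULoc).comp (algebraMap (PowerSeries F4) LF)).comp
    ((PowerSeries.substAlgHom (R := F4) H.hasSubst_red).toRingHom :
      PowerSeries F4 →+* PowerSeries F4)

theorem evalAt_redSeries (p : PowerSeries W4) :
    evalAt H (redSeries p) = toU (evalSeries e p) := by
  rw [evalSeries, toU_red, toULift_C]
  simp only [evalAt, RingHom.comp_apply, toLF, H.redSeries_subst]
  rw [← PowerSeries.coe_substAlgHom H.hasSubst_red]
  rfl

theorem evalAt_eq (p : PowerSeries F4) : evalAt H p =
    LaurentPolynomial.C (algebraMap _ LF (PowerSeries.subst (redSeries e) p)) := by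
  rw [← PowerSeries.coe_substAlgHom H.hasSubst_red]
  rfl

theorem evalAt_X : evalAt H PowerSeries.X = unitC _ H.toLF_ne_zero := by
  rw [evalAt_eq, PowerSeries.subst_X H.hasSubst_red]
  rfl

omit H in
/-- The comparison map from `F₄[[e]][v^{±1}, y^{±1}, h]`. -/
def compareLift (H : HasRedOrder D e) : LaurentRing →+* Polynomial ULoc :=
  AddMonoidAlgebra.liftNCRingHom (Polynomial.C.comp (evalAt H)) (monomialHom H)
    fun _ _ => Commute.all _ _

theorem compareLift_single (a b : ℤ) (c : ℕ) (p : PowerSeries F4) :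
    compareLift H (AddMonoidAlgebra.single (a, b, c) p) =
      Polynomial.C (evalAt H p * ((unitV ^ (a + c) *
      (unitV ^ D * (unitC _ H.toLF_ne_zero)⁻¹) ^ b : ULocˣ) : ULoc)) * Polynomial.X ^ c := by
  rw [compareLift, AddMonoidAlgebra.liftNCRingHom_single]
  change _ * (_ * (Polynomial.C (unitV : ULoc) * Polynomial.X) ^ c) = _
  rw [zpow_add, mul_pow, ← Polynomial.C_pow]
  simp only [Units.val_mul, map_mul, zpow_natCast, Units.val_pow_eq_pow_val, RingHom.comp_apply,
    toAdd_ofAdd]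
  ring

omit H in
/-- The hypotheses on a relation that is equivalent to `v ^ D = y * e`. -/
structure IsGoodRelation (H : HasRedOrder D e) (r : LaurentRing) : Prop where
  mon_mul : mon r (-D) 1 0 * algebraMap (PowerSeries F4) (Presented r) PowerSeries.X = 1
  compareLift_eq : compareLift H r = 0

omit H in
/-- The comparison map from the ring with the presentation. -/
def compare {H : HasRedOrder D e} {r : LaurentRing} (hr : IsGoodRelation H r) :
    Presented r →+* Polynomial ULoc :=
  Ideal.Quotient.lift (Ideal.span {r}) (compareLift H) fun x hx => by
    obtain ⟨y, rfl⟩ := Ideal.mem_span_singleton.1 hx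
    rw [map_mul, hr.compareLift_eq, zero_mul]

variable {H} {r : LaurentRing} (hr : IsGoodRelation H r)

omit H in
theorem mon_mul_mon (r : LaurentRing) (a b a' b' : ℤ) (c c' : ℕ) :
    mon r a b c * mon r a' b' c' = mon r (a + a') (b + b') (c + c') := by
  refine (map_mul (Ideal.Quotient.mk (Ideal.span {r})) _ _).symm.trans ?_
  rw [AddMonoidAlgebra.single_mul_single, one_mul]
  rfl

omit H in
theorem mon_zero (r : LaurentRing) : mon r 0 0 0 = 1 := rfl

omit H in
theorem algebraMap_mul_mon (r : LaurentRing) (a b : ℤ) (c : ℕ) (p : PowerSeries F4) :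
    algebraMap (PowerSeries F4) (Presented r) p * mon r a b c =
      Ideal.Quotient.mk (Ideal.span {r}) (AddMonoidAlgebra.single (a, b, c) p) := by
  refine (map_mul (Ideal.Quotient.mk (Ideal.span {r})) (AddMonoidAlgebra.single (0, 0, 0) p)
    _).symm.trans ?_
  rw [AddMonoidAlgebra.single_mul_single, mul_one]
  congr 3
  simp

omit H in
theorem presented_induction {r : LaurentRing} {P : Presented r → Prop} (x : Presented r)
    (h0 : P 0) (hadd : ∀ x y, P x → P y → P (x + y))
    (hmon : ∀ a b c p, P (algebraMap (PowerSeries F4) (Presented r) p * mon r a b c)) : P x := by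
  obtain ⟨x, rfl⟩ := Ideal.Quotient.mk_surjective (I := Ideal.span {r}) x
  induction x using AddMonoidAlgebra.induction_linear with
  | zero => exact h0
  | add x y hx hy => rw [map_add]; exact hadd _ _ hx hy
  | single m p => rw [← algebraMap_mul_mon r m.1 m.2.1 m.2.2]; exact hmon _ _ _ _

omit H in
theorem compare_algebraMap_mul_mon {H : HasRedOrder D e} (hr : IsGoodRelation H r) (a b : ℤ)
    (c : ℕ) (p : PowerSeries F4) :
    compare hr (algebraMap (PowerSeries F4) (Presented r) p * mon r a b c) =
      Polynomial.C (evalAt H p * ((unitV ^ (a + c) *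
      (unitV ^ D * (unitC _ H.toLF_ne_zero)⁻¹) ^ b : ULocˣ) : ULoc)) * Polynomial.X ^ c := by
  rw [algebraMap_mul_mon]
  exact compareLift_single H a b c p

omit H in
theorem compare_mon {H : HasRedOrder D e} (hr : IsGoodRelation H r) (a b : ℤ) (c : ℕ) :
    compare hr (mon r a b c) =
      Polynomial.C ((unitV ^ (a + c) *
      (unitV ^ D * (unitC _ H.toLF_ne_zero)⁻¹) ^ b : ULocˣ) : ULoc) * Polynomial.X ^ c := by
  have := compare_algebraMap_mul_mon hr a b c 1
  rwa [map_one, one_mul, map_one, one_mul] at this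

omit H in
theorem compare_algebraMap {H : HasRedOrder D e} (hr : IsGoodRelation H r) (p : PowerSeries F4) :
    compare hr (algebraMap (PowerSeries F4) (Presented r) p) = Polynomial.C (evalAt H p) := by
  have := compare_algebraMap_mul_mon hr 0 0 0 p
  rw [mon_zero, mul_one] at this
  simpa using this

omit H in
theorem unitV_zpow_coeff (n m : ℤ) (a : LF) :
    (LaurentPolynomial.C a * ((unitV ^ n : ULocˣ) : ULoc)).coeff m =
      if m = -n then a * toLF u₁ ^ n else 0 := by
  have h1 : ((unitV ^ n : ULocˣ) : ULoc) =
      LaurentPolynomial.C (toLF u₁ ^ n) * LaurentPolynomial.T (-n) := by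
    rw [unitV, mul_zpow, inv_zpow', Units.val_mul, unitT_zpow]
    congr 1
    rw [unitC, ← map_zpow, Units.coe_map, Units.val_zpow_eq_zpow_val]
    rfl
  rw [h1, ← mul_assoc, ← map_mul, ← LaurentPolynomial.single_eq_C_mul_T,
    AddMonoidAlgebra.coeff_single, Finsupp.single_apply]
  simp only [eq_comm]

/-- The relation makes `e` a unit, and multiplication by a power of `e` removes all powers of `y`.
The remaining monomials in `v` and `h` have images in distinct bidegrees, where
`HasRedOrder.subst_injective` recovers their coefficients. -/
theorem compare_injective : Function.Injective (compare hr) := by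
  rw [injective_iff_map_eq_zero]
  have hunit : IsUnit (algebraMap (PowerSeries F4) (Presented r) PowerSeries.X) :=
    IsUnit.of_mul_eq_one _ ((mul_comm _ _).trans hr.mon_mul)
  have hpow : ∀ n : ℕ, mon r (-D * n) n 0 *
      algebraMap (PowerSeries F4) (Presented r) PowerSeries.X ^ n = 1 := by
    intro n
    induction n with
    | zero => simp [mon_zero]
    | succ n ih =>
      have : mon r (-D * (n + 1 : ℕ)) (n + 1 : ℕ) 0 = mon r (-D * n) n 0 * mon r (-D) 1 0 := by
        rw [mon_mul_mon]
        push_cast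
        congr 1
        ring
      rw [this, pow_succ]
      linear_combination ih + (mon r (-D * n) n 0 *
        algebraMap (PowerSeries F4) (Presented r) PowerSeries.X ^ n) * hr.mon_mul
  -- normal forms
  have hnf : ∀ x : Presented r, ∃ (N : ℕ) (q : AddMonoidAlgebra (PowerSeries F4) (ℤ × ℕ)),
      algebraMap (PowerSeries F4) (Presented r) PowerSeries.X ^ N * x =
        q.coeff.sum fun m p => algebraMap (PowerSeries F4) (Presented r) p * mon r m.1 0 m.2 := by
    intro x
    have hsum_add : ∀ q q' : AddMonoidAlgebra (PowerSeries F4) (ℤ × ℕ),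
        ((q + q').coeff.sum fun m p => algebraMap (PowerSeries F4) (Presented r) p *
          mon r m.1 0 m.2) = (q.coeff.sum fun m p => algebraMap (PowerSeries F4) (Presented r) p *
          mon r m.1 0 m.2) + q'.coeff.sum fun m p => algebraMap (PowerSeries F4) (Presented r) p *
          mon r m.1 0 m.2 := by
      intro q q'
      rw [AddMonoidAlgebra.coeff_add, Finsupp.sum_add_index']
      · simp
      · intro m p p'; rw [map_add, add_mul]
    have hsum_X : ∀ (n : ℕ) (q : AddMonoidAlgebra (PowerSeries F4) (ℤ × ℕ)),
        algebraMap (PowerSeries F4) (Presented r) PowerSeries.X ^ n *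
          (q.coeff.sum fun m p => algebraMap (PowerSeries F4) (Presented r) p * mon r m.1 0 m.2) =
        ((PowerSeries.X (R := F4) ^ n • q).coeff.sum fun m p =>
          algebraMap (PowerSeries F4) (Presented r) p * mon r m.1 0 m.2) := by
      intro n q
      rw [AddMonoidAlgebra.coeff_smul, Finsupp.sum_smul_index, Finsupp.mul_sum]
      · simp only [map_mul, map_pow, mul_assoc]
      · simp
    induction x using presented_induction with
    | h0 => exact ⟨0, 0, by simp⟩
    | hadd x y hx hy =>
      obtain ⟨N, q, h⟩ := hx
      obtain ⟨N', q', h'⟩ := hy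
      refine ⟨N + N', PowerSeries.X (R := F4) ^ N' • q + PowerSeries.X (R := F4) ^ N • q', ?_⟩
      rw [hsum_add, ← hsum_X, ← hsum_X, ← h, ← h']
      ring
    | hmon a b c p =>
      rcases Int.le_total 0 b with hb | hb
      · obtain ⟨b, rfl⟩ := Int.eq_ofNat_of_zero_le hb
        -- For `b ≥ 0` the product `y ^ b * e ^ b` is `v ^ (D * b)`.
        refine ⟨b, AddMonoidAlgebra.single (a + D * b, c) p, ?_⟩
        rw [AddMonoidAlgebra.coeff_single, Finsupp.sum_single_index (by simp)]
        have : mon r a b c = mon r (-D * b) b 0 * mon r (a + D * b) 0 c := by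
          rw [mon_mul_mon]
          congr 1 <;> simp
        rw [this]
        linear_combination (algebraMap (PowerSeries F4) (Presented r) p *
          mon r (a + D * b) 0 c) * hpow b
      · obtain ⟨n, rfl⟩ := Int.exists_eq_neg_ofNat hb
        -- A negative power of `y` needs no multiplication, since `y ^ (-n) = e ^ n * v ^ (-D * n)`.
        refine ⟨0, AddMonoidAlgebra.single (a - D * n, c) (PowerSeries.X ^ n * p), ?_⟩
        rw [AddMonoidAlgebra.coeff_single, Finsupp.sum_single_index (by simp)]
        have : mon r (-D * n) n 0 * mon r a (-n) c = mon r (a - D * n) 0 c := by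
          rw [mon_mul_mon]
          congr 1 <;> [ring; ring; simp]
        dsimp only
        rw [← this, map_mul, map_pow]
        linear_combination (-algebraMap (PowerSeries F4) (Presented r) p *
          mon r a (-n) c) * hpow n
  intro x hx
  obtain ⟨N, q, hq⟩ := hnf x
  have h1 : q = 0 := by
    have h2 := congrArg (compare hr) hq
    rw [map_mul, hx, mul_zero, Finsupp.sum, map_sum] at h2
    ext1
    ext1 m
    obtain ⟨k, c⟩ := m
    -- The monomial `v ^ k * h ^ c` maps to a multiple of `u ^ (-(k + c)) X ^ c`, so this double
    -- coefficient isolates it.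
    have h3 := congrArg (fun P : Polynomial ULoc => (P.coeff c).coeff (-(k + c))) h2
    have hterm : ∀ m : ℤ × ℕ, ((compare hr (algebraMap (PowerSeries F4) (Presented r) (q.coeff m) *
        mon r m.1 0 m.2)).coeff c).coeff (-(k + c)) = if m = (k, c) then
          algebraMap _ LF (PowerSeries.subst (redSeries e) (q.coeff m)) * toLF u₁ ^ (k + c)
          else 0 := by
      rintro ⟨k', c'⟩
      rw [compare_algebraMap_mul_mon, zpow_zero, mul_one, Polynomial.coeff_C_mul_X_pow, evalAt_eq]
      by_cases hc : c = c'
      · subst hc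
        rw [if_pos rfl, unitV_zpow_coeff]
        by_cases hk : k = k'
        · subst hk
          rw [if_pos rfl, if_pos rfl]
        · rw [if_neg (by omega), if_neg (fun h => hk (congrArg Prod.fst h).symm)]
      · rw [if_neg hc, if_neg (fun h => hc (congrArg Prod.snd h).symm)]
        rfl
    simp only [Polynomial.finsetSum_coeff, AddMonoidAlgebra.coeff_sum, Finsupp.finsetSum_apply,
      hterm, Finset.sum_ite_eq'] at h3
    by_contra hne
    rw [if_pos (Finsupp.mem_support_iff.2 hne)] at h3
    have h4 := (mul_eq_zero.1 h3.symm).resolve_right (zpow_ne_zero _ toLF_u₁_ne_zero)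
    rw [map_eq_zero_iff _ (IsFractionRing.injective (PowerSeries F4) LF)] at h4
    exact hne (H.subst_injective _ h4)
  rw [h1] at hq
  simp only [AddMonoidAlgebra.coeff_zero, Finsupp.sum_zero_index] at hq
  exact ((hunit.pow N).mul_right_eq_zero).1 hq

end Presentation

/-! ### Actions with known ring of invariants -/

theorem modTwo_red {G : Type} [Group G] (σ : G →* (E ≃ₐ[W4] E)) (g : G) (x : E) :
    modTwo σ g (red x) = red (σ g x) := rfl

theorem redC_mul (a b : E0) : redC (a * b) = redC a * redC b := by simp [redC]

theorem redC_pow (a : E0) (n : ℕ) : redC (a ^ n) = redC a ^ n := by simp [redC]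

theorem redC_sum {ι : Type*} (s : Finset ι) (f : ι → E0) :
    redC (∑ i ∈ s, f i) = ∑ i ∈ s, redC (f i) := by simp [redC]

theorem evalSeries_eq (e : E0) (p : PowerSeries W4) :
    evalSeries e p = redC (PowerSeries.subst e p) := rfl

theorem red_v₁_pow (n : ℕ) :
    red v₁ ^ n = redC (u₁ ^ n) * red (LaurentPolynomial.T (-n)) := by
  have h : v₁ ^ n = LaurentPolynomial.C (u₁ ^ n) * LaurentPolynomial.T (-n) := by
    rw [v₁, mul_pow, ← map_pow, LaurentPolynomial.T_pow]
    congr 2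
    ring
  rw [← map_pow, h, map_mul]
  rfl

/-- The point is to split off the factor `u₁ ^ n` that turns `u⁻ⁿ` into `v₁ ^ n`. As `D` is
positive, the subtraction in the exponent is not truncated. -/
theorem redC_pow_eq {D : ℕ} (hD : 0 < D) (e w : E0)
    (h : redSeries e = PowerSeries.X ^ D * redSeries w) (n : ℕ) :
    redC (e ^ n) = redC (u₁ ^ (D * n - n) * w ^ n * u₁ ^ n) := by
  rw [redC_eq_iff, map_pow, h, map_mul, map_mul, map_pow, map_pow, map_pow, redSeries_u₁]
  obtain ⟨m, hm⟩ := Nat.exists_eq_add_of_le (Nat.le_mul_of_pos_left n hD)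
  rw [mul_pow, ← pow_mul, hm, Nat.add_sub_cancel_left, pow_add]
  ring

/-- An action of `G` on `E_*` such that the cohomology modulo 2 can be computed: a central element
`τ` of order two acts trivially modulo 2, the quotient by `τ` has order `D` and acts faithfully
modulo 2, and `e` is an invariant of order `D`. -/
structure IsGoodAction {G : Type} [Group G] (σ : G →* (E ≃ₐ[W4] E)) (τ : G)
    (φ : G → (E0 ≃ₐ[W4] E0)) (D : ℕ) (e : E0) (y : E) : Prop where
  order : HasRedOrder D e
  apply_C : ∀ g a, σ g (LaurentPolynomial.C a) = LaurentPolynomial.C (φ g a)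
  apply_T : ∀ g n, ∃ t, σ g (LaurentPolynomial.T n) = LaurentPolynomial.C t * LaurentPolynomial.T n
  inv_v : ∀ g, modTwo σ g (red v₁) = red v₁
  inv_y : ∀ g, modTwo σ g (red y) = red y
  inv_e : ∀ p g, modTwo σ g (evalSeries e p) = evalSeries e p
  rel : red y * redC e = red v₁ ^ D
  mul_self : τ * τ = 1
  ne_one : τ ≠ 1
  central : ∀ g, g * τ = τ * g
  trivial : ∀ a, modTwo σ τ a = a
  apply_v : σ τ v₁ = -v₁
  faithful : ∀ g, redSeries (φ g u₁) = PowerSeries.X → g ∈ Subgroup.zpowers τ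
  card : Nat.card (G ⧸ Subgroup.zpowers τ) = D

namespace IsGoodAction

variable {G : Type} [Group G] {σ : G →* (E ≃ₐ[W4] E)} {τ : G} {φ : G → (E0 ≃ₐ[W4] E0)} {D : ℕ}
  {e : E0} {y : E} (H : IsGoodAction σ τ φ D e y)

include H

theorem modTwo_redC (g : G) (a : E0) : modTwo σ g (redC a) = redC (φ g a) := by
  rw [redC, modTwo_red, H.apply_C, redC]

theorem φ_mul (g h : G) (a : E0) : φ (g * h) a = φ g (φ h a) := by
  apply laurentC_injective
  rw [← H.apply_C, map_mul, AlgEquiv.mul_apply, H.apply_C, H.apply_C]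

theorem φ_one (a : E0) : φ 1 a = a := by
  apply laurentC_injective
  rw [← H.apply_C, map_one, AlgEquiv.one_apply]

theorem redSeries_φ {a b : E0} (h : redSeries a = redSeries b) (g : G) :
    redSeries (φ g a) = redSeries (φ g b) := by
  rw [← redC_eq_iff, ← H.modTwo_redC, ← H.modTwo_redC, (redC_eq_iff a b).2 h]

theorem redSeries_φ_subst (g : G) (p : PowerSeries W4) :
    redSeries (φ g (PowerSeries.subst e p)) = redSeries (PowerSeries.subst e p) := by
  rw [← redC_eq_iff, ← H.modTwo_redC]
  exact H.inv_e p g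

/-- Then `g⁻¹ * h` fixes `u₁` modulo 2 and faithfulness applies. Hence `u₁` has as many conjugates
as there are cosets. -/
theorem mk_eq_of_redSeries_eq {g h : G} (hgh : redSeries (φ g u₁) = redSeries (φ h u₁)) :
    (g : G ⧸ Subgroup.zpowers τ) = h := by
  rw [QuotientGroup.eq]
  apply H.faithful
  rw [H.φ_mul, ← H.redSeries_φ hgh, ← H.φ_mul, inv_mul_cancel, H.φ_one, redSeries_u₁]

theorem finite : Finite (G ⧸ Subgroup.zpowers τ) :=
  Nat.finite_of_card_ne_zero (by rw [H.card]; exact H.order.pos.ne')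

/-- Galois theory by counting roots. Write `a` modulo 2 as a polynomial in `u₁` of degree below `D`
whose coefficients are series in `e`. By invariance this polynomial takes the value `a` at all `D`
conjugates of `u₁`, so it is constant. -/
theorem exists_evalSeries (a : E0) (ha : ∀ g, redSeries (φ g a) = redSeries a) :
    ∃ p, redC a = evalSeries e p := by
  have := H.finite
  have := Fintype.ofFinite (G ⧸ Subgroup.zpowers τ)
  obtain ⟨w, hw, hw'⟩ := H.order.order
  obtain ⟨c, hc⟩ := exists_expansion H.order.pos _ w hw hw' (redSeries a)
  choose c' hc' using fun i => redSeries_surjective (c i)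
  let a' : E0 := ∑ i : Fin D, u₁ ^ (i : ℕ) * PowerSeries.subst e (c' i)
  have haa' : redSeries a = redSeries a' := by
    rw [hc, map_sum]
    refine Finset.sum_congr rfl fun i _ => ?_
    rw [map_mul, map_pow, redSeries_u₁, H.order.redSeries_subst, hc']
  let P : Polynomial (PowerSeries F4) := (∑ i : Fin D, Polynomial.monomial i
    (redSeries (PowerSeries.subst e (c' i)))) - Polynomial.C (redSeries a)
  have hP : P = 0 := by
    refine Polynomial.eq_zero_of_natDegree_lt_card_of_eval_eq_zero
      (f := fun q : G ⧸ Subgroup.zpowers τ => redSeries (φ q.out u₁)) P ?_ ?_ ?_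
    · intro q q' h
      have := H.mk_eq_of_redSeries_eq h
      rwa [QuotientGroup.out_eq', QuotientGroup.out_eq'] at this
    · intro q
      rw [Polynomial.eval_sub, Polynomial.eval_C, sub_eq_zero, ← ha q.out, H.redSeries_φ haa',
        map_sum, map_sum, Polynomial.eval_finsetSum]
      refine Finset.sum_congr rfl fun i _ => ?_
      rw [map_mul, map_pow, map_mul, map_pow, H.redSeries_φ_subst, Polynomial.eval_monomial,
        mul_comm]
    · rw [← Nat.card_eq_fintype_card, H.card]
      refine lt_of_le_of_lt (b := D - 1) ?_ (by have := H.order.pos; omega)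
      refine (Polynomial.natDegree_sub_le _ _).trans (max_le ?_ ?_)
      · refine Polynomial.natDegree_sum_le_of_forall_le _ _ fun i _ => ?_
        refine (Polynomial.natDegree_monomial_le _).trans ?_
        omega
      · rw [Polynomial.natDegree_C]; omega
  refine ⟨c' ⟨0, H.order.pos⟩, ?_⟩
  rw [evalSeries_eq, redC_eq_iff]
  have := congrArg (fun P => Polynomial.coeff P 0) hP
  simp only [P, Polynomial.coeff_sub, Polynomial.finsetSum_coeff, Polynomial.coeff_monomial,
    Polynomial.coeff_C_zero, Polynomial.coeff_zero] at this
  rw [Finset.sum_eq_single ⟨0, H.order.pos⟩] at this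
  · rw [if_pos rfl] at this
    exact (sub_eq_zero.1 this).symm
  · intro i _ hi
    rw [if_neg]
    exact fun h => hi (Fin.ext h)
  · intro h
    exact absurd (Finset.mem_univ _) h

/-- Independence of characters gives an element with nonzero trace. The trace is invariant, so it is
a series in `e`, that is, `e ^ m` times a unit series; the inverse of the unit is invariant and
moves inside the trace. The factor `y ^ m` then turns `e ^ m` into `v₁ ^ (D * m)`. -/
theorem exists_trace [Fintype (G ⧸ Subgroup.zpowers τ)] : ∃ (n : ℕ) (a : EV0),
    ∑ q : G ⧸ Subgroup.zpowers τ, modTwo σ q.out a = red v₁ ^ n := by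
  let χ : G ⧸ Subgroup.zpowers τ → (E0 →* PowerSeries F4) := fun q =>
    (redSeries : E0 →* PowerSeries F4).comp ((φ q.out : E0 →+* E0) : E0 →* E0)
  have hχ : Function.Injective χ := by
    intro q q' h
    have := H.mk_eq_of_redSeries_eq (DFunLike.congr_fun h u₁)
    rwa [QuotientGroup.out_eq', QuotientGroup.out_eq'] at this
  have hli := (linearIndependent_monoidHom E0 (PowerSeries F4)).comp χ hχ
  have hne : ∃ a, ∑ q, χ q a ≠ 0 := by
    by_contra! hcon
    have h1 := Fintype.linearIndependent_iff.1 hli (fun _ => 1) (by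
      funext a
      simpa using hcon a)
    have := H.finite
    exact one_ne_zero (h1 ((1 : G) : G ⧸ Subgroup.zpowers τ))
  obtain ⟨a, ha⟩ := hne
  let A0 : E0 := ∑ q : G ⧸ Subgroup.zpowers τ, φ q.out a
  have hA0 : redSeries A0 ≠ 0 := by
    simp only [A0, map_sum]
    exact ha
  -- Modulo 2 a conjugate depends only on the coset, so the sum over chosen representatives is
  -- permuted by the action.
  have hτact : ∀ (g : G) (h : Subgroup.zpowers τ) (b : E0),
      redC (φ (g * h) b) = redC (φ g b) := by
    intro g h b
    rw [← H.modTwo_redC, ← H.modTwo_redC, map_mul, AlgEquiv.mul_apply]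
    congr 1
    obtain ⟨h, hh⟩ := h
    have hle : Subgroup.zpowers τ ≤ (modTwo σ).ker := by
      rw [Subgroup.zpowers_le, MonoidHom.mem_ker]
      exact AlgEquiv.ext H.trivial
    have := hle hh
    rw [MonoidHom.mem_ker] at this
    rw [this]
    rfl
  have hout : ∀ (g : G) (b : E0),
      redC (φ (g : G ⧸ Subgroup.zpowers τ).out b) = redC (φ g b) := by
    intro g b
    obtain ⟨h, hh⟩ := QuotientGroup.mk_out_eq_mul (Subgroup.zpowers τ) g
    rw [hh, hτact]
  have hinv : ∀ g, redSeries (φ g A0) = redSeries A0 := by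
    intro g
    rw [← redC_eq_iff]
    simp only [A0, map_sum, redC_sum]
    refine Eq.trans ?_ (Equiv.sum_comp (MulAction.toPerm g : Equiv.Perm (G ⧸ Subgroup.zpowers τ))
      fun q => redC (φ q.out a))
    refine Finset.sum_congr rfl fun q _ => ?_
    induction q using QuotientGroup.induction_on with
    | H q =>
      have h1 : (MulAction.toPerm g : Equiv.Perm (G ⧸ Subgroup.zpowers τ))
        (q : G ⧸ Subgroup.zpowers τ) = ((g * q : G) : G ⧸ Subgroup.zpowers τ) := rfl
      rw [h1, hout (g * q), H.φ_mul, ← H.modTwo_redC, ← H.modTwo_redC, H.modTwo_redC _ a, hout,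
        H.modTwo_redC]
  obtain ⟨p, hp⟩ := H.exists_evalSeries A0 hinv
  have hp0 : redSeries p ≠ 0 := by
    intro h
    apply hA0
    rw [evalSeries_eq, redC_eq_iff, H.order.redSeries_subst, h] at hp
    rw [hp, ← PowerSeries.coe_substAlgHom H.order.hasSubst_red, map_zero]
  obtain ⟨m, w, hw⟩ : ∃ (m : ℕ) (w : PowerSeries W4), redSeries (p * w) =
      PowerSeries.X ^ m := by
    have h1 := PowerSeries.X_pow_order_mul_divXPowOrder (f := redSeries p)
    have h2 : IsUnit (redSeries p).divXPowOrder := by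
      rw [PowerSeries.isUnit_iff_constantCoeff, PowerSeries.constantCoeff_divXPowOrder,
        isUnit_iff_ne_zero]
      exact PowerSeries.coeff_order (by simpa using hp0)
    obtain ⟨w, hw⟩ := h2.exists_right_inv
    obtain ⟨w', rfl⟩ := redSeries_surjective w
    exact ⟨_, w', by rw [map_mul]; conv_lhs => rw [← h1, mul_assoc, hw, mul_one]⟩
  refine ⟨D * m, red y ^ m * redC (a * PowerSeries.subst e w), ?_⟩
  have h1 : ∀ q : G ⧸ Subgroup.zpowers τ, modTwo σ q.out
      (red y ^ m * redC (a * PowerSeries.subst e w)) =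
      red y ^ m * (redC (φ q.out a) * evalSeries e w) := by
    intro q
    rw [map_mul, map_pow, H.inv_y, redC_mul, map_mul, H.modTwo_redC]
    congr 2
    exact H.inv_e w _
  rw [Finset.sum_congr rfl fun q _ => h1 q, ← Finset.mul_sum, ← Finset.sum_mul, ← redC_sum]
  change _ * (redC A0 * _) = _
  rw [hp, evalSeries_eq, evalSeries_eq, ← redC_mul, ← PowerSeries.subst_mul H.order.hasSubst,
    pow_mul, ← H.rel, mul_pow, ← redC_pow]
  congr 1
  rw [redC_eq_iff, H.order.redSeries_subst, hw, PowerSeries.subst_pow H.order.hasSubst_red,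
    PowerSeries.subst_X H.order.hasSubst_red, map_pow]

/-- `y` becomes `v₁ ^ D / e`. -/
theorem toU_y : toU (red y) = ((unitV ^ D * (unitC _ H.order.toLF_ne_zero)⁻¹ : ULocˣ) : ULoc) := by
  have h := congrArg toU H.rel
  rw [map_mul, map_pow, toU_v₁, toU_redC] at h
  rw [Units.val_mul, ← Units.mul_inv_eq_iff_eq_mul, inv_inv] 
  exact h

/-- Multiplied by a power of `e`, the element becomes `v₁ ^ n` times an element of degree zero,
which is invariant because the other factors are. That element is a series in `e`, and division by
`e = v₁ ^ D / y` leaves a monomial of the presented ring with a series as coefficient. -/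
theorem mem_range_of_homogeneous {r : LaurentRing} (hr : IsGoodRelation H.order r) (a : E0) (n : ℤ)
    (ha : ∀ g, modTwo σ g (red (LaurentPolynomial.C a * LaurentPolynomial.T (-n))) =
      red (LaurentPolynomial.C a * LaurentPolynomial.T (-n))) (s : ℕ) :
    ∃ x ∈ bidegree r (2 * D) s (2 * n), compare hr x =
      Polynomial.C (toU (red (LaurentPolynomial.C a * LaurentPolynomial.T (-n)))) *
        Polynomial.X ^ s := by
  -- an invariant power series `f` with `a u⁻ⁿ e ^ N = f v₁ ^ n`
  obtain ⟨f, N, hf, hinv⟩ : ∃ (f : E0) (N : ℕ),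
      toU (red (LaurentPolynomial.C a * LaurentPolynomial.T (-n)) * redC e ^ N) =
        toU (redC f) * ((unitV ^ n : ULocˣ) : ULoc) ∧
      ∀ g, redC (φ g f) = redC f := by
    rcases Int.le_total 0 n with hn | hn
    · obtain ⟨n, rfl⟩ := Int.eq_ofNat_of_zero_le hn
      obtain ⟨w, hw, hw'⟩ := H.order.order
      obtain ⟨w', rfl⟩ := redSeries_surjective w
      have hen := redC_pow_eq H.order.pos e w' hw' n
      have hvn := red_v₁_pow n
      have key : red (LaurentPolynomial.C a * LaurentPolynomial.T (-n)) * redC e ^ n =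
          redC (a * (u₁ ^ (D * n - n) * w' ^ n)) * red v₁ ^ n := by
        rw [← redC_pow, hen, map_mul, hvn, redC_mul a, redC_mul _ (u₁ ^ n)]
        change redC a * _ * _ = _
        ring
      refine ⟨a * (u₁ ^ (D * n - n) * w' ^ n), n, ?_, fun g => ?_⟩
      · rw [key, map_mul, map_pow, toU_v₁, zpow_natCast, Units.val_pow_eq_pow_val]
      · apply toU_injective
        have h1 := congrArg (modTwo σ g) key
        have hee : modTwo σ g (redC e) = redC e := by
          have := H.inv_e PowerSeries.X g
          rwa [evalSeries_eq, PowerSeries.subst_X H.order.hasSubst] at this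
        rw [map_mul, ha, map_pow, hee, key, map_mul, map_pow, H.inv_v, H.modTwo_redC] at h1
        have h2 := congrArg toU h1
        rw [map_mul, map_mul, map_pow, toU_v₁] at h2
        exact ((unitV.isUnit.pow n).mul_right_cancel h2).symm
    · obtain ⟨n, rfl⟩ := Int.exists_eq_neg_ofNat hn
      have hvn := red_v₁_pow n
      have key : red (LaurentPolynomial.C a * LaurentPolynomial.T (-(-(n : ℤ)))) * red v₁ ^ n =
          redC (a * u₁ ^ n) := by
        rw [hvn, map_mul, redC_mul]
        have : red (LaurentPolynomial.T (-(-(n : ℤ)))) * red (LaurentPolynomial.T (-n)) = 1 := by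
          rw [← map_mul, ← LaurentPolynomial.T_add]
          simp
        change redC a * _ * _ = _
        linear_combination (redC a * redC (u₁ ^ n)) * this
      refine ⟨a * u₁ ^ n, 0, ?_, fun g => ?_⟩
      · rw [pow_zero, mul_one, ← key, map_mul toU _ (red v₁ ^ n), map_pow, toU_v₁, mul_assoc,
          ← Units.val_pow_eq_pow_val, ← Units.val_mul, ← zpow_natCast, ← zpow_add]
        simp
      · rw [← H.modTwo_redC, ← key, map_mul, ha, map_pow, H.inv_v]
  obtain ⟨p, hp⟩ := H.exists_evalSeries f fun g => (redC_eq_iff _ _).1 (hinv g)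
  -- The exponent of `v` is lowered by `s` because `h ^ s` already contributes `v₁ ^ s`. In the
  -- internal degree the two contributions of `s` cancel.
  refine ⟨algebraMap _ _ (redSeries p) * mon r (n - D * N - s) N s, ?_, ?_⟩
  · rw [← Algebra.smul_def]
    refine Submodule.smul_mem _ _ (Submodule.subset_span ⟨_, _, ?_, rfl⟩)
    ring
  · rw [compare_algebraMap_mul_mon, evalAt_redSeries, ← hp]
    congr 2
    rw [map_mul, map_pow, toU_redC] at hf
    have h1 : LaurentPolynomial.C (toLF e) ^ N =
        ((unitC _ H.order.toLF_ne_zero ^ N : ULocˣ) : ULoc) := rfl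
    rw [h1, ← Units.eq_mul_inv_iff_mul_eq, mul_assoc, ← Units.val_mul] at hf
    rw [hf]
    congr 2
    rw [mul_zpow, ← zpow_natCast unitV D, ← zpow_mul, ← mul_assoc, ← zpow_add]
    congr 2
    ring

/-- The action preserves the grading by powers of `u`, so the homogeneous components of an invariant
are invariant. -/
theorem mem_range_of_invariant {r : LaurentRing} (hr : IsGoodRelation H.order r) (x : EV0)
    (hx : ∀ g, modTwo σ g x = x) (s : ℕ) :
    ∃ z, compare hr z = Polynomial.C (toU x) * Polynomial.X ^ s := by
  obtain ⟨x, rfl⟩ := red_surjective x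
  have hsum : x = ∑ n ∈ x.coeff.support, LaurentPolynomial.C (x.coeff n) *
      LaurentPolynomial.T n := by
    conv_lhs => rw [← AddMonoidAlgebra.sum_coeff_single x]
    exact Finset.sum_congr rfl fun n _ => LaurentPolynomial.single_eq_C_mul_T _ _
  choose t ht using H.apply_T
  have hact : ∀ g, σ g x = ∑ n ∈ x.coeff.support, LaurentPolynomial.C (φ g (x.coeff n) * t g n) *
      LaurentPolynomial.T n := by
    intro g
    conv_lhs => rw [hsum, map_sum]
    refine Finset.sum_congr rfl fun n _ => ?_
    rw [map_mul, H.apply_C, ht, map_mul, mul_assoc]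
  have hcoeff : ∀ g n, n ∈ x.coeff.support →
      toLF (φ g (x.coeff n) * t g n) = toLF (x.coeff n) := by
    intro g n hn
    have h1 := congrArg toU (hx g)
    rw [modTwo_red, toU_red, toU_red] at h1
    have h2 := congrArg (fun p : ULoc => p.coeff n) h1
    simp only [toULift_coeff] at h2
    rw [← h2, hact]
    congr 1
    simp only [← LaurentPolynomial.single_eq_C_mul_T, AddMonoidAlgebra.coeff_sum,
      Finsupp.finsetSum_apply, AddMonoidAlgebra.coeff_single, Finsupp.single_apply,
      Finset.sum_ite_eq', if_pos hn]
  have hterm : ∀ n ∈ x.coeff.support, ∃ z, compare hr z = Polynomial.C (toU (red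
      (LaurentPolynomial.C (x.coeff n) * LaurentPolynomial.T n))) * Polynomial.X ^ s := by
    intro n hn
    obtain ⟨z, -, hz⟩ := H.mem_range_of_homogeneous hr (x.coeff n) (-n) (fun g => by
      rw [modTwo_red, neg_neg, map_mul, H.apply_C, ht, ← mul_assoc, ← map_mul, map_mul red,
        map_mul red]
      congr 1
      exact (redC_eq_iff _ _).2 ((toLF_eq_iff _ _).1 (hcoeff g n hn))) s
    rw [neg_neg] at hz
    exact ⟨z, hz⟩
  choose! z hz using hterm
  refine ⟨∑ n ∈ x.coeff.support, z n, ?_⟩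
  rw [map_sum, Finset.sum_congr rfl hz, ← Finset.sum_mul, ← map_sum, ← map_sum, ← map_sum, ← hsum]

end IsGoodAction

/-! ### The comparison map on cohomology and the localization. -/

section

variable {G : Type} [Group G] {σ : G →* (E ≃ₐ[W4] E)} {τ : G} {φ : G → (E0 ≃ₐ[W4] E0)} {D : ℕ}
  {e : E0} {y : E}

namespace IsGoodAction

variable (H : IsGoodAction σ τ φ D e y)

/-- `evalSum` on the cohomology of `E_* / 2`. -/
def evalMod (s : ℕ) (x : groupCohomology (coeffRep (modTwo σ)) s) : EV0 :=
  evalClass two_eq_zero_EV0 H.mul_self H.trivial s x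

theorem evalMod_add (s : ℕ) (x x' : groupCohomology (coeffRep (modTwo σ)) s) :
    H.evalMod s (x + x') = H.evalMod s x + H.evalMod s x' :=
  map_add (evalClass two_eq_zero_EV0 H.mul_self H.trivial s).hom x x'

variable {r : LaurentRing} (hr : IsGoodRelation H.order r)

theorem exists_compare_eq (s : ℕ) (x : groupCohomology (coeffRep (modTwo σ)) s) :
    ∃ z, compare hr z = Polynomial.C (toU (H.evalMod s x)) * Polynomial.X ^ s :=
  H.mem_range_of_invariant hr _
    (evalClass_invariant two_eq_zero_EV0 H.mul_self H.central H.trivial s x) s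

/-- The comparison map from cohomology to the ring with the presentation. -/
def theta (s : ℕ) : groupCohomology (coeffRep (modTwo σ)) s →+ Presented r :=
  AddMonoidHom.mk' (fun x => (H.exists_compare_eq hr s x).choose) fun x x' => by
    apply compare_injective hr
    rw [map_add, (H.exists_compare_eq hr s _).choose_spec,
      (H.exists_compare_eq hr s _).choose_spec, (H.exists_compare_eq hr s _).choose_spec,
      evalMod_add, map_add, map_add, add_mul]

theorem compare_theta (s : ℕ) (x : groupCohomology (coeffRep (modTwo σ)) s) :
    compare hr (H.theta hr s x) = Polynomial.C (toU (H.evalMod s x)) * Polynomial.X ^ s :=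
  (H.exists_compare_eq hr s x).choose_spec

theorem theta_eq_iff (s : ℕ) (x : groupCohomology (coeffRep (modTwo σ)) s) (z : Presented r) :
    H.theta hr s x = z ↔
      compare hr z = Polynomial.C (toU (H.evalMod s x)) * Polynomial.X ^ s := by
  rw [← compare_theta H hr, (compare_injective hr).eq_iff, eq_comm]

theorem theta_invariantClass (a : EV0) (ha : ∀ g, modTwo σ g a = a) (z : Presented r) :
    H.theta hr 0 (invariantClass (modTwo σ) a ha) = z ↔ compare hr z = Polynomial.C (toU a) := by
  rw [theta_eq_iff, evalMod, evalClass_invariantClass, pow_zero, mul_one]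

theorem theta_one : H.theta hr 0 (invariantClass (modTwo σ) 1 fun _ => map_one _) = 1 := by
  rw [theta_invariantClass, map_one, map_one, map_one]

theorem theta_v : H.theta hr 0 (invariantClass (modTwo σ) (red v₁) H.inv_v) = mon r 1 0 0 := by
  rw [theta_invariantClass, compare_mon, toU_v₁]
  simp

theorem theta_y : H.theta hr 0 (invariantClass (modTwo σ) (red y) H.inv_y) = mon r 0 1 0 := by
  rw [theta_invariantClass, compare_mon, H.toU_y]
  simp

theorem theta_e (p : PowerSeries W4) :
    H.theta hr 0 (invariantClass (modTwo σ) (evalSeries e p) (H.inv_e p)) =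
      algebraMap (PowerSeries F4) (Presented r)
        (PowerSeries.map (WittVector.constantCoeff : W4 →+* F4) p) := by
  rw [theta_invariantClass, compare_algebraMap, ← evalAt_redSeries]
  rfl

theorem theta_bockstein :
    H.theta hr 1 (bockstein σ (invariantClass (modTwo σ) (red v₁) H.inv_v)) = mon r 0 0 1 := by
  rw [theta_eq_iff, evalMod, evalClass_bockstein σ H.mul_self H.trivial v₁ H.inv_v H.apply_v,
    compare_mon, toU_v₁]
  simp

theorem theta_cup (p q : ℕ) (z : groupCohomology.cocycles (coeffRep (modTwo σ)) p)
    (w : groupCohomology.cocycles (coeffRep (modTwo σ)) q) :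
    H.theta hr (p + q) (groupCohomology.π (coeffRep (modTwo σ)) (p + q)
        (cupCocycle (modTwo σ) z w)) =
      H.theta hr p (groupCohomology.π (coeffRep (modTwo σ)) p z) *
        H.theta hr q (groupCohomology.π (coeffRep (modTwo σ)) q w) := by
  have h : H.evalMod (p + q) (groupCohomology.π (coeffRep (modTwo σ)) (p + q)
      (cupCocycle (modTwo σ) z w)) = H.evalMod p (groupCohomology.π (coeffRep (modTwo σ)) p z) *
        H.evalMod q (groupCohomology.π (coeffRep (modTwo σ)) q w) :=
    evalClass_cup two_eq_zero_EV0 H.mul_self H.trivial p q z w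
  rw [theta_eq_iff, map_mul, compare_theta, compare_theta, h, map_mul, map_mul, pow_add]
  ring

theorem theta_mem_bidegree (s : ℕ) (n : ℤ)
    (z : groupCohomology.cocycles (coeffRep (modTwo σ)) s)
    (hz : ∀ x, groupCohomology.iCocycles (coeffRep (modTwo σ)) s z x ∈ internalDegree n) :
    H.theta hr s (groupCohomology.π (coeffRep (modTwo σ)) s z) ∈
      bidegree r (2 * D) s (2 * n) := by
  have hev : ∃ a : E0, H.evalMod s (groupCohomology.π (coeffRep (modTwo σ)) s z) =
      red (LaurentPolynomial.C a * LaurentPolynomial.T (-n)) := by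
    choose a ha using hz
    rw [evalMod, evalClass_π]
    refine ⟨∑ b, a (boolPow τ ∘ b), ?_⟩
    rw [map_sum, Finset.sum_mul, map_sum]
    exact Finset.sum_congr rfl fun b _ => ha _
  obtain ⟨a, ha⟩ := hev
  obtain ⟨x, hx, hx'⟩ := H.mem_range_of_homogeneous hr a n (fun g => by
    rw [← ha]
    exact evalClass_invariant two_eq_zero_EV0 H.mul_self H.central H.trivial s _ g) s
  rwa [(H.theta_eq_iff hr s _ x).2 (by rw [hx', ha])]

/-- The image of the cohomology ring. -/
def thetaRange : Subring (Presented r) where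
  carrier := Set.range (DirectSum.toAddMonoid (H.theta hr))
  zero_mem' := ⟨0, map_zero _⟩
  add_mem' := by
    rintro _ _ ⟨x, rfl⟩ ⟨x', rfl⟩
    exact ⟨x + x', map_add _ _ _⟩
  neg_mem' := by
    rintro _ ⟨x, rfl⟩
    exact ⟨-x, map_neg _ _⟩
  one_mem' := ⟨DirectSum.of _ 0 (invariantClass (modTwo σ) 1 fun _ => map_one _), by
    rw [DirectSum.toAddMonoid_of, theta_one]⟩
  mul_mem' := by
    rintro _ _ ⟨x, rfl⟩ ⟨x', rfl⟩
    induction x using DirectSum.induction_on with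
    | zero => exact ⟨0, by simp⟩
    | add x z hx hz =>
      obtain ⟨u, hu⟩ := hx
      obtain ⟨w, hw⟩ := hz
      exact ⟨u + w, by rw [map_add, hu, hw, map_add, add_mul]⟩
    | of p x =>
      induction x' using DirectSum.induction_on with
      | zero => exact ⟨0, by simp⟩
      | add x z hx hz =>
        obtain ⟨u, hu⟩ := hx
        obtain ⟨w, hw⟩ := hz
        exact ⟨u + w, by rw [map_add, hu, hw, map_add, mul_add]⟩
      | of q x' =>
        induction x using cohomology_induction with
        | h z =>
          induction x' using cohomology_induction with
          | h z' =>
            refine ⟨DirectSum.of _ (p + q) (groupCohomology.π (coeffRep (modTwo σ)) (p + q)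
              (cupCocycle (modTwo σ) z z')), ?_⟩
            rw [DirectSum.toAddMonoid_of, DirectSum.toAddMonoid_of, DirectSum.toAddMonoid_of,
              theta_cup]

theorem theta_mem_range (s : ℕ) (x : groupCohomology (coeffRep (modTwo σ)) s) :
    H.theta hr s x ∈ H.thetaRange hr :=
  ⟨DirectSum.of _ s x, DirectSum.toAddMonoid_of _ _ _⟩

theorem mon_npow (r : LaurentRing) (a b : ℤ) (c n : ℕ) :
    mon r a b c ^ n = mon r (n * a) (n * b) (n * c) := by
  induction n with
  | zero => simp [mon_zero]
  | succ n ih =>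
    rw [pow_succ, ih, mon_mul_mon]
    push_cast
    congr 1 <;> ring

/-- The range is a subring containing `v₁`, `y`, `h₁` and all series in `e`, so only negative powers
of `v₁` and `y` need the extra factor. -/
theorem exists_pow_mul_mem (x : Presented r) : ∃ n : ℕ, mon r 1 0 0 ^ n * x ∈ H.thetaRange hr := by
  have hv : mon r 1 0 0 ∈ H.thetaRange hr := by
    rw [← H.theta_v hr]; exact H.theta_mem_range hr _ _
  have hy : mon r 0 1 0 ∈ H.thetaRange hr := by
    rw [← H.theta_y hr]; exact H.theta_mem_range hr _ _
  have hh : mon r 0 0 1 ∈ H.thetaRange hr := by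
    rw [← H.theta_bockstein hr]; exact H.theta_mem_range hr _ _
  have hp : ∀ p : PowerSeries F4, algebraMap (PowerSeries F4) (Presented r) p ∈
      H.thetaRange hr := by
    intro p
    obtain ⟨p', rfl⟩ := redSeries_surjective p
    have := H.theta_mem_range hr 0 (invariantClass (modTwo σ) (evalSeries e p') (H.inv_e p'))
    rwa [theta_e] at this
  -- The inverse of `y` is reached only up to a power of `v`, through `v ^ D * y⁻¹ = e`.
  have hy' : mon r D (-1) 0 ∈ H.thetaRange hr := by
    have h1 : mon r D (-1) 0 = algebraMap (PowerSeries F4) (Presented r) PowerSeries.X := by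
      have h2 := hr.mon_mul
      have h3 : mon r D (-1) 0 * mon r (-D) 1 0 = 1 := by
        rw [mon_mul_mon, ← mon_zero]
        congr 1 <;> simp
      linear_combination (-mon r D (-1) 0) * h2 +
        algebraMap (PowerSeries F4) (Presented r) PowerSeries.X * h3
    rw [h1]
    exact hp _
  induction x using presented_induction with
  | h0 => exact ⟨0, by rw [mul_zero]; exact Subring.zero_mem _⟩
  | hadd x z hx hz =>
    obtain ⟨n, hn⟩ := hx
    obtain ⟨m, hm⟩ := hz
    refine ⟨n + m, ?_⟩
    have : mon r 1 0 0 ^ (n + m) * (x + z) = mon r 1 0 0 ^ m * (mon r 1 0 0 ^ n * x) +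
      mon r 1 0 0 ^ n * (mon r 1 0 0 ^ m * z) := by ring
    rw [this]
    exact Subring.add_mem _ (Subring.mul_mem _ (Subring.pow_mem _ hv _) hn)
      (Subring.mul_mem _ (Subring.pow_mem _ hv _) hm)
  | hmon a b c p =>
    have hb : ∃ m : ℕ, mon r m b 0 ∈ H.thetaRange hr := by
      rcases Int.le_total 0 b with hb | hb
      · obtain ⟨b, rfl⟩ := Int.eq_ofNat_of_zero_le hb
        refine ⟨0, ?_⟩
        have h1 := mon_npow r 0 1 0 b
        have h2 := Subring.pow_mem _ hy b
        rw [h1] at h2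
        simpa using h2
      · obtain ⟨b, rfl⟩ := Int.exists_eq_neg_ofNat hb
        refine ⟨b * D, ?_⟩
        have h1 := mon_npow r D (-1) 0 b
        have h2 := Subring.pow_mem _ hy' b
        rw [h1] at h2
        simpa using h2
    obtain ⟨m, hm⟩ := hb
    refine ⟨m + a.natAbs, ?_⟩
    have h1 : mon r 1 0 0 ^ (m + a.natAbs) *
        (algebraMap (PowerSeries F4) (Presented r) p * mon r a b c) =
        algebraMap (PowerSeries F4) (Presented r) p * (mon r m b 0 *
          (mon r 1 0 0 ^ (a.natAbs + a).toNat * mon r 0 0 1 ^ c)) := by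
      have h2 : mon r 1 0 0 ^ (m + a.natAbs) * mon r a b c =
          mon r m b 0 * (mon r 1 0 0 ^ (a.natAbs + a).toNat * mon r 0 0 1 ^ c) := by
        rw [mon_npow, mon_npow, mon_npow, mon_mul_mon, mon_mul_mon, mon_mul_mon]
        congr 1
        · have : ((a.natAbs + a).toNat : ℤ) = a.natAbs + a := Int.toNat_of_nonneg (by omega)
          rw [this]
          push_cast
          ring
        · simp
        · simp
      rw [← h2]
      ring
    rw [h1]
    exact Subring.mul_mem _ (hp p) (Subring.mul_mem _ hm
      (Subring.mul_mem _ (Subring.pow_mem _ hv _) (Subring.pow_mem _ hh _)))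

/-- The powers of `X` separate the cohomological degrees, so no cancellation between different
degrees is possible. -/
theorem toAddMonoid_theta_eq_zero (x : ⨁ s, groupCohomology (coeffRep (modTwo σ)) s)
    (hx : DirectSum.toAddMonoid (H.theta hr) x = 0) (s : ℕ) : H.evalMod s (x s) = 0 := by
  have key : ∀ x : ⨁ s, groupCohomology (coeffRep (modTwo σ)) s,
      (compare hr (DirectSum.toAddMonoid (H.theta hr) x)).coeff s = toU (H.evalMod s (x s)) := by
    intro x
    induction x using DirectSum.induction_on with
    | zero =>
      rw [map_zero, map_zero, Polynomial.coeff_zero]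
      have : H.evalMod s 0 = 0 := map_zero (evalClass two_eq_zero_EV0 H.mul_self H.trivial s).hom
      exact ((congrArg toU this).trans (map_zero _)).symm
    | add x z hx hz =>
      rw [map_add, map_add, Polynomial.coeff_add, hx, hz, DirectSum.add_apply, evalMod_add, map_add]
    | of t x =>
      rw [DirectSum.toAddMonoid_of, compare_theta, Polynomial.coeff_C_mul_X_pow]
      by_cases h : s = t
      · subst h
        rw [if_pos rfl, DirectSum.of_eq_same]
      · rw [if_neg h, DirectSum.of_eq_of_ne _ _ _ h]
        have : H.evalMod s 0 = 0 := map_zero (evalClass two_eq_zero_EV0 H.mul_self H.trivial s).hom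
        exact ((congrArg toU this).trans (map_zero _)).symm
  apply toU_injective
  rw [← key, hx, map_zero, map_zero, Polynomial.coeff_zero]

theorem localizedCohomologyIso (H : IsGoodAction σ τ φ D e y) (hr : IsGoodRelation H.order r) :
    LocalizedCohomologyIso σ y (2 * D) e r := by
  refine ⟨H.inv_v, H.inv_y, H.inv_e, H.theta hr, ⟨H.theta_one hr, H.theta_cup hr, ?_, ?_, ?_⟩,
    H.theta_mem_bidegree hr, H.theta_v hr, H.theta_y hr, H.theta_e hr, H.theta_bockstein hr⟩
  · rw [theta_v]
    refine IsUnit.of_mul_eq_one (mon r (-1) 0 0) ?_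
    rw [mon_mul_mon, ← mon_zero]
    congr 1
  · intro x
    obtain ⟨n, z, hz⟩ := H.exists_pow_mul_mem hr x
    exact ⟨n, z, by rw [theta_v, hz]⟩
  · intro x hx
    have := H.finite
    have := Fintype.ofFinite (G ⧸ Subgroup.zpowers τ)
    obtain ⟨n, a, ha⟩ := H.exists_trace
    exact ⟨n, fun s => mulInvariant_eq_zero two_eq_zero_EV0 H.mul_self H.central H.trivial H.ne_one
      a (red v₁) H.inv_v n ha s (x s) (H.toAddMonoid_theta_eq_zero hr x hx s)⟩

end IsGoodAction

/-- The relation `v ^ 3 = y e`. -/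
theorem isGoodRelation_relC6 {e : E0} (H : HasRedOrder 3 e) : IsGoodRelation H relC6 where
  mon_mul := by
    have h : mon relC6 3 0 0 = algebraMap (PowerSeries F4) (Presented relC6) PowerSeries.X *
        mon relC6 0 1 0 := by
      rw [algebraMap_mul_mon]
      exact Ideal.Quotient.eq.2 (Ideal.mem_span_singleton_self relC6)
    have h1 : mon relC6 (-(3 : ℕ)) 1 0 = mon relC6 (-3) 0 0 * mon relC6 0 1 0 := by
      rw [mon_mul_mon]
      rfl
    have h2 : mon relC6 (-3) 0 0 * mon relC6 3 0 0 = 1 := mon_mul_mon ..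
    rw [h1]
    linear_combination h2 - mon relC6 (-3) 0 0 * h
  compareLift_eq := by
    rw [relC6, map_sub, compareLift_single, compareLift_single, sub_eq_zero, evalAt_X, map_one,
      one_mul, ← Units.val_mul]
    congr 3
    simp [zpow_ofNat]

/-- The relation `y⁻¹ v ^ 12 = e`. -/
theorem isGoodRelation_relG24 {e : E0} (H : HasRedOrder 12 e) : IsGoodRelation H relG24 where
  mon_mul := by
    have h : mon relG24 12 (-1) 0 =
        algebraMap (PowerSeries F4) (Presented relG24) PowerSeries.X * mon relG24 0 0 0 := by
      rw [algebraMap_mul_mon]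
      exact Ideal.Quotient.eq.2 (Ideal.mem_span_singleton_self relG24)
    have h2 : mon relG24 (-(12 : ℕ)) 1 0 * mon relG24 12 (-1) 0 = 1 := mon_mul_mon ..
    rw [mon_zero, mul_one] at h
    rw [← h, h2]
  compareLift_eq := by
    rw [relG24, map_sub, compareLift_single, compareLift_single, sub_eq_zero, evalAt_X, map_one,
      one_mul, ← Units.val_mul]
    congr 3
    simp [zpow_ofNat]

end

/-! ### Chords and changes of variables on Weierstrass curves. -/

section

variable {R : Type*} [CommRing R] {S : Type*} [CommRing S] [Algebra R S] (W : WeierstrassCurve R)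

/-- The point with coordinates `z = -x/y`, `w = -1/y` lies on the curve `W`. -/
def OnCurve (z w : S) : Prop :=
  w = z ^ 3 + algebraMap R S W.a₁ * z * w + algebraMap R S W.a₂ * z ^ 2 * w
    + algebraMap R S W.a₃ * w ^ 2 + algebraMap R S W.a₄ * z * w ^ 2 + algebraMap R S W.a₆ * w ^ 3

variable {W}

theorem OnCurve.map {T : Type*} [CommRing T] [Algebra R T] (f : S →ₐ[R] T) {z w : S}
    (h : OnCurve W z w) : OnCurve W (f z) (f w) := by
  have := congrArg f h
  rw [OnCurve]
  simpa only [map_add, map_mul, map_pow, AlgHom.commutes] using this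

/-- The difference of the two equations is `w - w'` times the factor assumed to be a unit. -/
theorem OnCurve.unique {z w w' : S} (h : OnCurve W z w) (h' : OnCurve W z w')
    (hu : IsUnit (1 - (algebraMap R S W.a₁ * z + algebraMap R S W.a₂ * z ^ 2
      + algebraMap R S W.a₃ * (w + w') + algebraMap R S W.a₄ * z * (w + w')
      + algebraMap R S W.a₆ * (w ^ 2 + w * w' + w' ^ 2)))) : w = w' := by
  rw [OnCurve] at h h'
  obtain ⟨d, hd⟩ := hu.exists_right_inv
  linear_combination d * h - d * h' + (w' - w) * hd

/-- In these coordinates the change of variables is a projective linear map. With denominators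
cleared, the equation of `W` becomes `u ^ 6` times that of `c • W`, by the transformation formulas
of the coefficients. -/
theorem OnCurve.variableChange {c : WeierstrassCurve.VariableChange R} {z w d : S}
    (h : OnCurve (c • W) z w)
    (hd : (algebraMap R S c.u ^ 3 - algebraMap R S c.u ^ 2 * algebraMap R S c.s * z
      - algebraMap R S c.t * w) * d = 1) :
    OnCurve W ((algebraMap R S c.u ^ 2 * z + algebraMap R S c.r * w) * d) (w * d) := by
  rw [OnCurve] at h ⊢
  have hu : (c.u : R) * (↑c.u⁻¹ : R) = 1 := c.u.mul_inv
  have h1 : (c.u : R) * (c • W).a₁ = W.a₁ + 2 * c.s := by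
    rw [WeierstrassCurve.variableChange_a₁, ← mul_assoc, hu, one_mul]
  have h2 : (c.u : R) ^ 2 * (c • W).a₂ = W.a₂ - c.s * W.a₁ + 3 * c.r - c.s ^ 2 := by
    rw [WeierstrassCurve.variableChange_a₂, ← mul_assoc, ← mul_pow, hu, one_pow, one_mul]
  have h3 : (c.u : R) ^ 3 * (c • W).a₃ = W.a₃ + c.r * W.a₁ + 2 * c.t := by
    rw [WeierstrassCurve.variableChange_a₃, ← mul_assoc, ← mul_pow, hu, one_pow, one_mul]
  have h4 : (c.u : R) ^ 4 * (c • W).a₄ = W.a₄ - c.s * W.a₃ + 2 * c.r * W.a₂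
      - (c.t + c.r * c.s) * W.a₁ + 3 * c.r ^ 2 - 2 * c.s * c.t := by
    rw [WeierstrassCurve.variableChange_a₄, ← mul_assoc, ← mul_pow, hu, one_pow, one_mul]
  have h6 : (c.u : R) ^ 6 * (c • W).a₆ = W.a₆ + c.r * W.a₄ + c.r ^ 2 * W.a₂ + c.r ^ 3
      - c.t * W.a₃ - c.t ^ 2 - c.r * c.t * W.a₁ := by
    rw [WeierstrassCurve.variableChange_a₆, ← mul_assoc, ← mul_pow, hu, one_pow, one_mul]
  replace h1 := congrArg (algebraMap R S) h1
  replace h2 := congrArg (algebraMap R S) h2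
  replace h3 := congrArg (algebraMap R S) h3
  replace h4 := congrArg (algebraMap R S) h4
  replace h6 := congrArg (algebraMap R S) h6
  simp only [map_mul, map_add, map_sub, map_pow, map_ofNat] at h1 h2 h3 h4 h6
  generalize algebraMap R S c.u = u at *
  generalize algebraMap R S c.r = r at *
  generalize algebraMap R S c.s = s at *
  generalize algebraMap R S c.t = t at *
  generalize algebraMap R S W.a₁ = a₁ at *
  generalize algebraMap R S W.a₂ = a₂ at *
  generalize algebraMap R S W.a₃ = a₃ at *
  generalize algebraMap R S W.a₄ = a₄ at *
  generalize algebraMap R S W.a₆ = a₆ at *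
  obtain ⟨N, hN⟩ : ∃ N, N = u ^ 2 * z + r * w := ⟨_, rfl⟩
  obtain ⟨D, hD⟩ : ∃ D, D = u ^ 3 - u ^ 2 * s * z - t * w := ⟨_, rfl⟩
  have key : w * D ^ 2 = N ^ 3 + a₁ * N * w * D + a₂ * N ^ 2 * w + a₃ * w ^ 2 * D + a₄ * N * w ^ 2
      + a₆ * w ^ 3 := by
    rw [hN, hD]
    linear_combination u ^ 6 * h + u ^ 5 * z * w * h1 + u ^ 4 * z ^ 2 * w * h2
      + u ^ 3 * w ^ 2 * h3 + u ^ 2 * z * w ^ 2 * h4 + w ^ 3 * h6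
  rw [← hD] at hd
  rw [← hN]
  linear_combination d ^ 3 * key - (w * d * (1 + D * d) - a₁ * N * w * d ^ 2 - a₃ * w ^ 2 * d ^ 2) * hd

theorem OnCurve.neg {z w d : S} (h : OnCurve W z w)
    (hd : (1 - algebraMap R S W.a₁ * z - algebraMap R S W.a₃ * w) * d = 1) :
    OnCurve W (-z * d) (-w * d) := by
  rw [OnCurve] at h ⊢
  linear_combination -d ^ 3 * h +
    (w * d + w * d ^ 2) * hd

variable (W) in
/-- The leading coefficient of the cubic equation for the points on the chord `w = l z + n`. -/
def chordLead (l : S) : S :=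
  1 + algebraMap R S W.a₂ * l + algebraMap R S W.a₄ * l ^ 2 + algebraMap R S W.a₆ * l ^ 3

variable (W) in
/-- The quadratic coefficient of the cubic equation for the points on the chord `w = l z + n`. -/
def chordQuad (l n : S) : S :=
  algebraMap R S W.a₁ * l + algebraMap R S W.a₂ * n + algebraMap R S W.a₃ * l ^ 2
    + algebraMap R S (2 * W.a₄) * l * n + algebraMap R S (3 * W.a₆) * l ^ 2 * n

variable (W) in
/-- The chord `w = l z + n` meets the curve `W` in the points with parameters `z₁`, `z₂`, `z₃`,
with coordinates `w₁`, `w₂` at the first two. -/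
structure IsChord (z₁ w₁ z₂ w₂ l n z₃ : S) : Prop where
  on₁ : OnCurve W z₁ w₁
  on₂ : OnCurve W z₂ w₂
  slope : l * (z₂ - z₁) = w₂ - w₁
  intercept : n = w₁ - l * z₁
  sum : (z₁ + z₂ + z₃) * chordLead W l + chordQuad W l n = 0

theorem IsChord.map {T : Type*} [CommRing T] [Algebra R T] (f : S →ₐ[R] T)
    {z₁ w₁ z₂ w₂ l n z₃ : S} (h : IsChord W z₁ w₁ z₂ w₂ l n z₃) :
    IsChord W (f z₁) (f w₁) (f z₂) (f w₂) (f l) (f n) (f z₃) where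
  on₁ := h.on₁.map f
  on₂ := h.on₂.map f
  slope := by simpa using congrArg f h.slope
  intercept := by simpa using congrArg f h.intercept
  sum := by simpa [chordLead, chordQuad] using congrArg f h.sum

/-- The cubic has the roots `z₁` and `z₂`, and `sum` fixes the third by Vieta. Dividing the
difference of two equations by `z₁ - z₂` is where distinctness and the absence of zero divisors
enter. -/
theorem IsChord.cubic [NoZeroDivisors S] {z₁ w₁ z₂ w₂ l n z₃ : S}
    (h : IsChord W z₁ w₁ z₂ w₂ l n z₃) (hne : z₁ ≠ z₂) (z : S) :
    z ^ 3 + algebraMap R S W.a₁ * z * (l * z + n) + algebraMap R S W.a₂ * z ^ 2 * (l * z + n)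
      + algebraMap R S W.a₃ * (l * z + n) ^ 2 + algebraMap R S W.a₄ * z * (l * z + n) ^ 2
      + algebraMap R S W.a₆ * (l * z + n) ^ 3 - (l * z + n) =
      chordLead W l * ((z - z₁) * (z - z₂) * (z - z₃)) := by
  obtain ⟨h1, h2, hl, hn, hs⟩ := h
  obtain rfl : w₁ = l * z₁ + n := by rw [hn]; ring
  obtain rfl : w₂ = l * z₂ + n := by linear_combination -hl
  rw [OnCurve] at h1 h2
  rw [chordLead, chordQuad] at *
  simp only [map_mul, map_ofNat] at hs
  generalize algebraMap R S W.a₁ = a₁ at *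
  generalize algebraMap R S W.a₂ = a₂ at *
  generalize algebraMap R S W.a₃ = a₃ at *
  generalize algebraMap R S W.a₄ = a₄ at *
  generalize algebraMap R S W.a₆ = a₆ at *
  obtain ⟨A, hA⟩ : ∃ A, A = 1 + a₂ * l + a₄ * l ^ 2 + a₆ * l ^ 3 := ⟨_, rfl⟩
  obtain ⟨B, hB⟩ : ∃ B, B = a₁ * l + a₂ * n + a₃ * l ^ 2 + 2 * a₄ * l * n + 3 * a₆ * l ^ 2 * n :=
    ⟨_, rfl⟩
  obtain ⟨C, hC⟩ : ∃ C, C = a₁ * n + 2 * a₃ * l * n + a₄ * n ^ 2 + 3 * a₆ * l * n ^ 2 - l :=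
    ⟨_, rfl⟩
  obtain ⟨F, hF⟩ : ∃ F, F = a₃ * n ^ 2 + a₆ * n ^ 3 - n := ⟨_, rfl⟩
  have k1 : A * z₁ ^ 3 + B * z₁ ^ 2 + C * z₁ + F = 0 := by
    rw [hA, hB, hC, hF]; linear_combination -h1
  have k2 : A * z₂ ^ 3 + B * z₂ ^ 2 + C * z₂ + F = 0 := by
    rw [hA, hB, hC, hF]; linear_combination -h2
  have k3 : A * (z₁ ^ 2 + z₁ * z₂ + z₂ ^ 2) + B * (z₁ + z₂) + C = 0 := by
    refine (mul_eq_zero.1 ?_).resolve_left (sub_ne_zero.2 hne)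
    linear_combination k1 - k2
  rw [← hA, ← hB] at hs
  rw [← hA]
  have k : z ^ 3 + a₁ * z * (l * z + n) + a₂ * z ^ 2 * (l * z + n) + a₃ * (l * z + n) ^ 2
      + a₄ * z * (l * z + n) ^ 2 + a₆ * (l * z + n) ^ 3 - (l * z + n) =
      A * z ^ 3 + B * z ^ 2 + C * z + F := by
    rw [hA, hB, hC, hF]; ring
  rw [k]
  linear_combination k1 + (z - z₁) * k3 + (z - z₁) * (z - z₂) * hs

theorem IsChord.on₃ [NoZeroDivisors S] {z₁ w₁ z₂ w₂ l n z₃ : S}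
    (h : IsChord W z₁ w₁ z₂ w₂ l n z₃) (hne : z₁ ≠ z₂) : OnCurve W z₃ (l * z₃ + n) := by
  have := h.cubic hne z₃
  rw [sub_self, mul_zero, mul_zero] at this
  exact (sub_eq_zero.1 this).symm

theorem IsChord.eq_third [NoZeroDivisors S] {z₁ w₁ z₂ w₂ l n z₃ : S}
    (h : IsChord W z₁ w₁ z₂ w₂ l n z₃) (hne : z₁ ≠ z₂) (hl : chordLead W l ≠ 0) {z : S}
    (hz : OnCurve W z (l * z + n)) (h1 : z ≠ z₁) (h2 : z ≠ z₂) : z = z₃ := by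
  have := h.cubic hne z
  rw [← hz, sub_self, eq_comm] at this
  simpa [hl, sub_eq_zero, h1, h2] using this

/-- A change of variables maps the points on a chord to the points on a chord. -/
theorem IsChord.variableChange [NoZeroDivisors S] {c : WeierstrassCurve.VariableChange R}
    {z₁ w₁ z₂ w₂ l n z₃ Z₁ W₁ Z₂ W₂ Z₃ W₃ L N : S}
    (h : IsChord (c • W) z₁ w₁ z₂ w₂ l n z₃)
    {d₁ d₂ d₃ : S} (hd₁ : (algebraMap R S c.u ^ 3 - algebraMap R S c.u ^ 2 * algebraMap R S c.s * z₁
      - algebraMap R S c.t * w₁) * d₁ = 1)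
    (hd₂ : (algebraMap R S c.u ^ 3 - algebraMap R S c.u ^ 2 * algebraMap R S c.s * z₂
      - algebraMap R S c.t * w₂) * d₂ = 1)
    (hd₃ : (algebraMap R S c.u ^ 3 - algebraMap R S c.u ^ 2 * algebraMap R S c.s * z₃
      - algebraMap R S c.t * (l * z₃ + n)) * d₃ = 1)
    (hZ₁ : Z₁ = (algebraMap R S c.u ^ 2 * z₁ + algebraMap R S c.r * w₁) * d₁) (hW₁ : W₁ = w₁ * d₁)
    (hZ₂ : Z₂ = (algebraMap R S c.u ^ 2 * z₂ + algebraMap R S c.r * w₂) * d₂) (hW₂ : W₂ = w₂ * d₂)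
    (hZ₃ : Z₃ = (algebraMap R S c.u ^ 2 * z₃ + algebraMap R S c.r * (l * z₃ + n)) * d₃)
    (hW₃ : W₃ = (l * z₃ + n) * d₃) (hne : Z₁ ≠ Z₂) (hL : L * (Z₂ - Z₁) = W₂ - W₁)
    (hN : N = W₁ - L * Z₁) : W₃ = L * Z₃ + N := by
  obtain ⟨-, -, hl, hn, -⟩ := h
  obtain rfl : w₁ = l * z₁ + n := by rw [hn]; ring
  obtain rfl : w₂ = l * z₂ + n := by linear_combination -hl
  generalize algebraMap R S c.u = u at *
  generalize algebraMap R S c.r = r at *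
  generalize algebraMap R S c.s = s at *
  generalize algebraMap R S c.t = t at *
  -- Collinearity is the vanishing of a determinant, a condition that a projective linear map
  -- preserves.
  have key : (W₃ - W₁) * (Z₂ - Z₁) = (W₂ - W₁) * (Z₃ - Z₁) := by
    obtain ⟨D₁, hD₁⟩ : ∃ D, D = u ^ 3 - u ^ 2 * s * z₁ - t * (l * z₁ + n) := ⟨_, rfl⟩
    obtain ⟨D₂, hD₂⟩ : ∃ D, D = u ^ 3 - u ^ 2 * s * z₂ - t * (l * z₂ + n) := ⟨_, rfl⟩
    obtain ⟨D₃, hD₃⟩ : ∃ D, D = u ^ 3 - u ^ 2 * s * z₃ - t * (l * z₃ + n) := ⟨_, rfl⟩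
    obtain ⟨N₁, hN₁⟩ : ∃ N, N = u ^ 2 * z₁ + r * (l * z₁ + n) := ⟨_, rfl⟩
    obtain ⟨N₂, hN₂⟩ : ∃ N, N = u ^ 2 * z₂ + r * (l * z₂ + n) := ⟨_, rfl⟩
    obtain ⟨N₃, hN₃⟩ : ∃ N, N = u ^ 2 * z₃ + r * (l * z₃ + n) := ⟨_, rfl⟩
    have k : (l * z₃ + n) * (N₂ * D₁ - N₁ * D₂) + (l * z₁ + n) * (N₃ * D₂ - N₂ * D₃)
        + (l * z₂ + n) * (N₁ * D₃ - N₃ * D₁) = 0 := by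
      rw [hD₁, hD₂, hD₃, hN₁, hN₂, hN₃]; ring
    rw [← hD₁] at hd₁
    rw [← hD₂] at hd₂
    rw [← hD₃] at hd₃
    rw [hW₃, hW₂, hW₁, hZ₁, hZ₂, hZ₃, ← hN₁, ← hN₂, ← hN₃]
    generalize l * z₁ + n = w₁ at *
    generalize l * z₂ + n = w₂ at *
    generalize l * z₃ + n = w₃ at *
    linear_combination d₁ * d₂ * d₃ * k
      - (w₃ * N₂ * d₃ * d₂ - w₂ * N₃ * d₂ * d₃) * hd₁
      - (w₁ * N₃ * d₁ * d₃ - w₃ * N₁ * d₁ * d₃) * hd₂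
      - (w₂ * N₁ * d₁ * d₂ - w₁ * N₂ * d₁ * d₂) * hd₃
  have : (W₃ - W₁ - L * (Z₃ - Z₁)) * (Z₂ - Z₁) = 0 := by
    linear_combination key - (Z₃ - Z₁) * hL
  have := (mul_eq_zero.1 this).resolve_right (sub_ne_zero.2 hne.symm)
  linear_combination this - hN

end

/-! ### The expansion of `w` and the series of the chord. -/

section

variable {R : Type*} [CommRing R] (W : WeierstrassCurve R)

/-- The iteration is contracting: all approximations are divisible by `X ^ 3`, so each increment is
the previous one times a multiple of `X`. -/
theorem X_pow_dvd_wApprox (n : ℕ) : PowerSeries.X ^ 3 ∣ wApprox W n ∧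
    PowerSeries.X ^ (n + 3) ∣ wApprox W (n + 1) - wApprox W n := by
  induction n with
  | zero => simp [wApprox]
  | succ n ih =>
    obtain ⟨⟨a, ha⟩, ⟨b, hb⟩⟩ := ih
    obtain ⟨b', hb'⟩ : ∃ b', wApprox W (n + 1) = PowerSeries.X ^ 3 * b' := by
      refine ⟨a + PowerSeries.X ^ n * b, ?_⟩
      linear_combination ha + hb
    refine ⟨⟨b', hb'⟩, ?_⟩
    refine ⟨b * (PowerSeries.C W.a₁ + PowerSeries.C W.a₂ * PowerSeries.X
      + PowerSeries.C W.a₃ * PowerSeries.X ^ 2 * (b' + a)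
      + PowerSeries.C W.a₄ * PowerSeries.X ^ 3 * (b' + a)
      + PowerSeries.C W.a₆ * PowerSeries.X ^ 5 * (b' ^ 2 + b' * a + a ^ 2)), ?_⟩
    have h1 : ∀ m, wApprox W (m + 1) = PowerSeries.X ^ 3
      + PowerSeries.C W.a₁ * PowerSeries.X * wApprox W m
      + PowerSeries.C W.a₂ * PowerSeries.X ^ 2 * wApprox W m
      + PowerSeries.C W.a₃ * wApprox W m ^ 2
      + PowerSeries.C W.a₄ * PowerSeries.X * wApprox W m ^ 2
      + PowerSeries.C W.a₆ * wApprox W m ^ 3 := fun _ => rfl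
    have h2 : wApprox W (n + 1 + 1) - wApprox W (n + 1) = (wApprox W (n + 1) - wApprox W n) *
        (PowerSeries.C W.a₁ * PowerSeries.X + PowerSeries.C W.a₂ * PowerSeries.X ^ 2
        + PowerSeries.C W.a₃ * (wApprox W (n + 1) + wApprox W n)
        + PowerSeries.C W.a₄ * PowerSeries.X * (wApprox W (n + 1) + wApprox W n)
        + PowerSeries.C W.a₆ * (wApprox W (n + 1) ^ 2 + wApprox W (n + 1) * wApprox W n
          + wApprox W n ^ 2)) := by
      linear_combination h1 (n + 1) - h1 n
    rw [h2, hb, hb', ha]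
    ring

theorem coeff_wSeries {m n : ℕ} (h : m < n + 3) :
    PowerSeries.coeff m (wSeries W) = PowerSeries.coeff m (wApprox W n) := by
  have key : ∀ k l, m < k + 3 →
      PowerSeries.coeff m (wApprox W (k + l)) = PowerSeries.coeff m (wApprox W k) := by
    intro k l hk
    induction l with
    | zero => rfl
    | succ l ih =>
      have := PowerSeries.X_pow_dvd_iff.1 (X_pow_dvd_wApprox W (k + l)).2 m (by omega)
      rw [map_sub, sub_eq_zero] at this
      rw [← ih, ← this]
      rfl
  rw [wSeries, PowerSeries.coeff_mk, ← key m n (by omega), ← key n m h, add_comm]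

theorem onCurve_wSeries : OnCurve W (PowerSeries.X : PowerSeries R) (wSeries W) := by
  have key : ∀ n, PowerSeries.X ^ (n + 3) ∣ wSeries W - wApprox W n := by
    intro n
    rw [PowerSeries.X_pow_dvd_iff]
    intro m hm
    rw [map_sub, coeff_wSeries W hm, sub_self]
  rw [OnCurve, ← sub_eq_zero]
  ext n
  rw [map_zero]
  refine (PowerSeries.X_pow_dvd_iff (n := n + 3)).1 ?_ n (by omega)
  obtain ⟨a, ha⟩ := key n
  obtain ⟨b, hb⟩ := key (n + 1)
  rw [wApprox] at hb
  simp only [PowerSeries.algebraMap_apply, Algebra.algebraMap_self, RingHom.id_apply]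
  refine ⟨PowerSeries.X * b - a * (PowerSeries.C W.a₁ * PowerSeries.X
    + PowerSeries.C W.a₂ * PowerSeries.X ^ 2
    + PowerSeries.C W.a₃ * (wSeries W + wApprox W n)
    + PowerSeries.C W.a₄ * PowerSeries.X * (wSeries W + wApprox W n)
    + PowerSeries.C W.a₆ * (wSeries W ^ 2 + wSeries W * wApprox W n + wApprox W n ^ 2)), ?_⟩
  linear_combination hb - ha * (PowerSeries.C W.a₁ * PowerSeries.X
    + PowerSeries.C W.a₂ * PowerSeries.X ^ 2
    + PowerSeries.C W.a₃ * (wSeries W + wApprox W n)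
    + PowerSeries.C W.a₄ * PowerSeries.X * (wSeries W + wApprox W n)
    + PowerSeries.C W.a₆ * (wSeries W ^ 2 + wSeries W * wApprox W n + wApprox W n ^ 2))

theorem X_pow_dvd_wSeries : PowerSeries.X ^ 3 ∣ wSeries W := by
  rw [PowerSeries.X_pow_dvd_iff]
  intro m hm
  rw [coeff_wSeries W (n := 0) (by omega), wApprox, map_zero]

@[simp]
theorem constantCoeff_wSeries : PowerSeries.constantCoeff (wSeries W) = 0 := by
  rw [← PowerSeries.coeff_zero_eq_constantCoeff_apply]
  exact PowerSeries.X_pow_dvd_iff.1 (X_pow_dvd_wSeries W) 0 (by omega)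

variable {τ : Type*} {W}

/-- For vanishing constant terms the factor in `OnCurve.unique` has constant term 1. This identifies
the `w`-coordinate of every point constructed below. -/
theorem OnCurve.eq_subst {a w : MvPowerSeries τ R} (ha : MvPowerSeries.constantCoeff a = 0)
    (hw : MvPowerSeries.constantCoeff w = 0) (h : OnCurve W a w) :
    w = PowerSeries.subst a (wSeries W) := by
  have hs := PowerSeries.HasSubst.of_constantCoeff_zero ha
  have h' := (onCurve_wSeries W).map (PowerSeries.substAlgHom hs)
  rw [PowerSeries.coe_substAlgHom, PowerSeries.subst_X hs] at h'
  have hw' := PowerSeries.constantCoeff_subst_eq_zero ha _ (constantCoeff_wSeries W)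
  refine h.unique h' (MvPowerSeries.isUnit_iff_constantCoeff.2 ?_)
  simp [ha, hw, hw']

theorem onCurve_subst {a : MvPowerSeries τ R} (ha : MvPowerSeries.constantCoeff a = 0) :
    OnCurve W a (PowerSeries.subst a (wSeries W)) := by
  have hs := PowerSeries.HasSubst.of_constantCoeff_zero ha
  have h' := (onCurve_wSeries W).map (PowerSeries.substAlgHom hs)
  rwa [PowerSeries.coe_substAlgHom, PowerSeries.subst_X hs] at h'

theorem constantCoeff_subst_wSeries {a : MvPowerSeries τ R}
    (ha : MvPowerSeries.constantCoeff a = 0) :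
    MvPowerSeries.constantCoeff (PowerSeries.subst a (wSeries W)) = 0 :=
  PowerSeries.constantCoeff_subst_eq_zero ha _ (constantCoeff_wSeries W)

/-! ### The formal group law -/

variable (W)

@[simp]
theorem constantCoeff_chordSlope : MvPowerSeries.constantCoeff (chordSlope W) = 0 :=
  PowerSeries.X_pow_dvd_iff.1 (X_pow_dvd_wSeries W) 1 (by omega)

@[simp]
theorem constantCoeff_chordIntercept : MvPowerSeries.constantCoeff (chordIntercept W) = 0 := by
  simp [chordIntercept, constantCoeff_subst_wSeries]

/-- Term by term this is `z₂ ^ (m + 1) - z₁ ^ (m + 1) = (z₂ - z₁) * ∑ z₁ ^ i * z₂ ^ j`, summed over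
`i + j = m`. -/
theorem chordSlope_mul : chordSlope W * (MvPowerSeries.X 1 - MvPowerSeries.X 0) =
    PowerSeries.subst (MvPowerSeries.X (1 : Fin 2) : MvPowerSeries (Fin 2) R) (wSeries W) -
      PowerSeries.subst (MvPowerSeries.X (0 : Fin 2) : MvPowerSeries (Fin 2) R) (wSeries W) := by
  ext e
  have h1 : ∀ i : Fin 2, MvPowerSeries.coeff e (chordSlope W * MvPowerSeries.X i) =
      if 1 ≤ e i then PowerSeries.coeff (e 0 + e 1) (wSeries W) else 0 := by
    intro i
    rw [MvPowerSeries.X, MvPowerSeries.coeff_mul_monomial]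
    simp only [Finsupp.single_le_iff, mul_one]
    split_ifs with h
    · refine congrArg (fun m => PowerSeries.coeff m (wSeries W)) ?_
      fin_cases i <;> simp at h ⊢ <;> omega
    · rfl
  have h2 : e = Finsupp.single 1 (e 1) ↔ e 0 = 0 := by
    refine ⟨fun h => by rw [h]; simp, fun h => ?_⟩
    ext i
    fin_cases i <;> simp [h]
  have h3 : e = Finsupp.single 0 (e 0) ↔ e 1 = 0 := by
    refine ⟨fun h => by rw [h]; simp, fun h => ?_⟩
    ext i
    fin_cases i <;> simp [h]
  rw [mul_sub, map_sub, map_sub, h1, h1, PowerSeries.coeff_subst_single,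
    PowerSeries.coeff_subst_single, if_congr h2 rfl rfl, if_congr h3 rfl rfl]
  rcases Nat.eq_zero_or_pos (e 0) with h | h <;> rcases Nat.eq_zero_or_pos (e 1) with h' | h'
  · simp [h, h']
  · simp [h, h'.ne', Nat.succ_le_of_lt h']
  · simp [h', h.ne', Nat.succ_le_of_lt h]
  · simp [h.ne', h'.ne', Nat.succ_le_of_lt h, Nat.succ_le_of_lt h']

/-- The denominator in the definition of `formalGroupLaw`. -/
def negDenom : MvPowerSeries (Fin 2) R :=
  1 - MvPowerSeries.C W.a₁ * thirdPoint W
    - MvPowerSeries.C W.a₃ * (chordSlope W * thirdPoint W + chordIntercept W)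

theorem thirdPoint_sum : (MvPowerSeries.X 0 + MvPowerSeries.X 1 + thirdPoint W) *
    chordLead W (chordSlope W) + chordQuad W (chordSlope W) (chordIntercept W) = 0 := by
  have h := MvPowerSeries.invOfUnit_mul (1 + MvPowerSeries.C W.a₂ * chordSlope W
    + MvPowerSeries.C W.a₄ * chordSlope W ^ 2 + MvPowerSeries.C W.a₆ * chordSlope W ^ 3) 1
    (by simp)
  simp only [thirdPoint, chordLead, chordQuad, MvPowerSeries.algebraMap_apply,
    Algebra.algebraMap_self, RingHom.id_apply]
  linear_combination (-(MvPowerSeries.C W.a₁ * chordSlope W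
    + MvPowerSeries.C W.a₂ * chordIntercept W + MvPowerSeries.C W.a₃ * chordSlope W ^ 2
    + MvPowerSeries.C (2 * W.a₄) * chordSlope W * chordIntercept W
    + MvPowerSeries.C (3 * W.a₆) * chordSlope W ^ 2 * chordIntercept W)) * h

theorem isChord : IsChord W (MvPowerSeries.X 0 : MvPowerSeries (Fin 2) R)
    (PowerSeries.subst (MvPowerSeries.X (0 : Fin 2) : MvPowerSeries (Fin 2) R) (wSeries W))
    (MvPowerSeries.X 1)
    (PowerSeries.subst (MvPowerSeries.X (1 : Fin 2) : MvPowerSeries (Fin 2) R) (wSeries W))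
    (chordSlope W) (chordIntercept W) (thirdPoint W) where
  on₁ := onCurve_subst (by simp)
  on₂ := onCurve_subst (by simp)
  slope := chordSlope_mul W
  intercept := rfl
  sum := thirdPoint_sum W

@[simp]
theorem constantCoeff_thirdPoint : MvPowerSeries.constantCoeff (thirdPoint W) = 0 := by
  have := congrArg MvPowerSeries.constantCoeff (thirdPoint_sum W)
  simpa [chordLead, chordQuad] using this

theorem constantCoeff_negDenom : MvPowerSeries.constantCoeff (negDenom W) = 1 := by
  simp [negDenom]

theorem formalGroupLaw_mul : formalGroupLaw W * negDenom W = -thirdPoint W := by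
  have := MvPowerSeries.invOfUnit_mul (negDenom W) 1 (constantCoeff_negDenom W)
  have h : formalGroupLaw W = -thirdPoint W * MvPowerSeries.invOfUnit (negDenom W) 1 := rfl
  rw [h]
  linear_combination (-thirdPoint W) * this

@[simp]
theorem constantCoeff_formalGroupLaw : MvPowerSeries.constantCoeff (formalGroupLaw W) = 0 := by
  have := congrArg MvPowerSeries.constantCoeff (formalGroupLaw_mul W)
  simpa [constantCoeff_negDenom] using this

theorem coeff_single_mul {i : τ} (f g : MvPowerSeries τ R) :
    MvPowerSeries.coeff (Finsupp.single i 1) (f * g) =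
      MvPowerSeries.coeff (Finsupp.single i 1) f * MvPowerSeries.constantCoeff g +
        MvPowerSeries.constantCoeff f * MvPowerSeries.coeff (Finsupp.single i 1) g := by
  classical
  rw [MvPowerSeries.coeff_mul, Finsupp.antidiagonal_single, Finset.sum_map,
    Finset.Nat.antidiagonal_succ]
  simp [add_comm]

theorem coeff_single_chordSlope (i : Fin 2) :
    MvPowerSeries.coeff (Finsupp.single i 1) (chordSlope W) = 0 := by
  refine PowerSeries.X_pow_dvd_iff.1 (X_pow_dvd_wSeries W) _ ?_
  fin_cases i <;> simp

theorem coeff_single_thirdPoint (i : Fin 2) :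
    MvPowerSeries.coeff (Finsupp.single i 1) (thirdPoint W) = -1 := by
  have h := congrArg (MvPowerSeries.coeff (Finsupp.single i 1)) (thirdPoint_sum W)
  have hn : MvPowerSeries.coeff (Finsupp.single i 1) (chordIntercept W) = 0 := by
    have h3 : PowerSeries.coeff 1 (wSeries W) = 0 :=
      PowerSeries.X_pow_dvd_iff.1 (X_pow_dvd_wSeries W) 1 (by omega)
    rw [chordIntercept, map_sub, coeff_single_mul, coeff_single_chordSlope,
      PowerSeries.coeff_subst_single]
    fin_cases i <;> simp [h3]
  have hX : MvPowerSeries.coeff (Finsupp.single i 1)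
      (MvPowerSeries.X 0 + MvPowerSeries.X 1 : MvPowerSeries (Fin 2) R) = 1 := by
    rw [map_add, MvPowerSeries.coeff_index_single_X, MvPowerSeries.coeff_index_single_X]
    fin_cases i <;> simp
  simp only [chordLead, chordQuad, pow_succ, pow_zero, one_mul, map_add, coeff_single_mul,
    coeff_single_chordSlope, hn, constantCoeff_chordSlope, constantCoeff_chordIntercept, map_mul,
    mul_zero, zero_mul, add_zero, constantCoeff_thirdPoint, MvPowerSeries.constantCoeff_X,
    map_zero, map_one, mul_one] at h
  rw [map_add] at hX
  rw [hX] at h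
  linear_combination h

/-- To first order the third point is at `-z₁ - z₂`, which involves the other variable too. -/
theorem thirdPoint_ne [Nontrivial R] (i : Fin 2) : thirdPoint W ≠ MvPowerSeries.X i := by
  intro h
  have h1 := coeff_single_thirdPoint W (i + 1)
  rw [h, MvPowerSeries.coeff_index_single_X, if_neg (by fin_cases i <;> simp)] at h1
  simp at h1

end

/-! ### Changes of variables as isomorphisms of formal group laws. -/

section

variable {R : Type*} [CommRing R] (c : WeierstrassCurve.VariableChange R) (W : WeierstrassCurve R)

theorem exists_formalIso_eq : ∃ d : PowerSeries R,
    (algebraMap R (PowerSeries R) c.u ^ 3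
      - algebraMap R (PowerSeries R) c.u ^ 2 * algebraMap R (PowerSeries R) c.s * PowerSeries.X
      - algebraMap R (PowerSeries R) c.t * wSeries (c • W)) * d = 1 ∧
    formalIso c W = (algebraMap R (PowerSeries R) c.u ^ 2 * PowerSeries.X
      + algebraMap R (PowerSeries R) c.r * wSeries (c • W)) * d := by
  refine ⟨PowerSeries.invOfUnit (PowerSeries.C ((c.u : R) ^ 3)
      - PowerSeries.C ((c.u : R) ^ 2 * c.s) * PowerSeries.X
      - PowerSeries.C c.t * wSeries (c • W)) (c.u ^ 3), ?_, ?_⟩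
  · simp [PowerSeries.mul_invOfUnit]
  · simp [formalIso]

@[simp]
theorem constantCoeff_formalIso : PowerSeries.constantCoeff (formalIso c W) = 0 := by
  simp [formalIso]

theorem coeff_one_formalIso : PowerSeries.coeff 1 (formalIso c W) = ↑c.u⁻¹ := by
  obtain ⟨d, hd, hf⟩ := exists_formalIso_eq c W
  have hw : PowerSeries.coeff 1 (wSeries (c • W)) = 0 :=
    PowerSeries.X_pow_dvd_iff.1 (X_pow_dvd_wSeries _) 1 (by omega)
  have h0 := congrArg PowerSeries.constantCoeff hd
  simp only [PowerSeries.algebraMap_apply, Algebra.algebraMap_self, RingHom.id_apply, map_mul,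
    map_sub, map_pow, PowerSeries.constantCoeff_C, PowerSeries.constantCoeff_X, mul_zero, sub_zero,
    constantCoeff_wSeries, map_one] at h0
  have hz : PowerSeries.coeff 0 (wSeries (c • W)) = 0 :=
    PowerSeries.X_pow_dvd_iff.1 (X_pow_dvd_wSeries _) 0 (by omega)
  have h1 : (c.u : R) * ↑c.u⁻¹ = 1 := c.u.mul_inv
  have h2 : PowerSeries.coeff 1 (wSeries (c • W) * d) = 0 := by
    rw [PowerSeries.coeff_mul]
    simp [Finset.Nat.antidiagonal_succ, hz, hw]
  rw [hf, add_mul, map_add, mul_assoc, mul_assoc, ← map_pow, PowerSeries.algebraMap_apply,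
    PowerSeries.algebraMap_apply, PowerSeries.coeff_C_mul, PowerSeries.coeff_C_mul, h2,
    ← zero_add 1, PowerSeries.coeff_succ_X_mul]
  simp only [Algebra.algebraMap_self, RingHom.id_apply, PowerSeries.coeff_zero_eq_constantCoeff]
  linear_combination (↑c.u⁻¹ : R) * h0 - (c.u : R) ^ 2 * PowerSeries.constantCoeff d * h1

variable {τ : Type*}

theorem exists_subst_formalIso_eq {a : MvPowerSeries τ R}
    (ha : MvPowerSeries.constantCoeff a = 0) : ∃ d : MvPowerSeries τ R,
    (algebraMap R (MvPowerSeries τ R) c.u ^ 3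
      - algebraMap R (MvPowerSeries τ R) c.u ^ 2 * algebraMap R (MvPowerSeries τ R) c.s * a
      - algebraMap R (MvPowerSeries τ R) c.t * PowerSeries.subst a (wSeries (c • W))) * d = 1 ∧
    PowerSeries.subst a (formalIso c W) = (algebraMap R (MvPowerSeries τ R) c.u ^ 2 * a
      + algebraMap R (MvPowerSeries τ R) c.r * PowerSeries.subst a (wSeries (c • W))) * d ∧
    PowerSeries.subst (PowerSeries.subst a (formalIso c W)) (wSeries W) =
      PowerSeries.subst a (wSeries (c • W)) * d := by
  have hs := PowerSeries.HasSubst.of_constantCoeff_zero ha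
  obtain ⟨d, hd, hf⟩ := exists_formalIso_eq c W
  have hd' := congrArg (PowerSeries.substAlgHom (R := R) hs) hd
  have hf' := congrArg (PowerSeries.substAlgHom (R := R) hs) hf
  simp only [map_mul, map_sub, map_add, map_pow, AlgHom.commutes, map_one,
    PowerSeries.substAlgHom_X] at hd' hf'
  simp only [PowerSeries.coe_substAlgHom] at hd' hf'
  refine ⟨_, hd', hf', (OnCurve.eq_subst
    (PowerSeries.constantCoeff_subst_eq_zero ha _ (constantCoeff_formalIso c W))
    (by rw [map_mul, constantCoeff_subst_wSeries ha, zero_mul]) ?_).symm⟩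
  rw [hf']
  exact (onCurve_subst ha).variableChange hd'

/-- The linear coefficient is a unit, so the series has an inverse under composition. -/
theorem subst_formalIso_injective {a b : MvPowerSeries τ R}
    (ha : MvPowerSeries.constantCoeff a = 0) (hb : MvPowerSeries.constantCoeff b = 0)
    (h : PowerSeries.subst a (formalIso c W) = PowerSeries.subst b (formalIso c W)) : a = b := by
  have h1 : IsUnit (PowerSeries.coeff 1 (formalIso c W)) := by
    rw [coeff_one_formalIso]
    exact Units.isUnit _
  have h0 := constantCoeff_formalIso c W
  have key : ∀ {a : MvPowerSeries τ R}, MvPowerSeries.constantCoeff a = 0 →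
      PowerSeries.subst (PowerSeries.subst a (formalIso c W))
        (PowerSeries.substInvOfIsUnit (formalIso c W) h1) = a := by
    intro a ha
    have hs := PowerSeries.HasSubst.of_constantCoeff_zero ha
    rw [← PowerSeries.subst_comp_subst_apply (PowerSeries.HasSubst.of_constantCoeff_zero' h0) hs,
      PowerSeries.subst_substInvOfIsUnit_left _ h0 h1, PowerSeries.subst_X hs]
  rw [← key ha, h, key hb]

/-- A change of variables is compatible with negation. -/
theorem variableChange_neg {S : Type*} [CommRing S] [Algebra R S] {z w P Q Z V d d' n : S}
    (hn : n = 1 - algebraMap R S (c • W).a₁ * z - algebraMap R S (c • W).a₃ * w)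
    (hP : P * n = -z) (hQ : Q * n = -w)
    (hd : (algebraMap R S c.u ^ 3 - algebraMap R S c.u ^ 2 * algebraMap R S c.s * P
      - algebraMap R S c.t * Q) * d = 1)
    (hd' : (algebraMap R S c.u ^ 3 - algebraMap R S c.u ^ 2 * algebraMap R S c.s * z
      - algebraMap R S c.t * w) * d' = 1)
    (hZ : Z = (algebraMap R S c.u ^ 2 * z + algebraMap R S c.r * w) * d') (hV : V = w * d') :
    (algebraMap R S c.u ^ 2 * P + algebraMap R S c.r * Q) * d *
      (1 - algebraMap R S W.a₁ * Z - algebraMap R S W.a₃ * V) = -Z := by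
  have hu : (c.u : R) * (↑c.u⁻¹ : R) = 1 := c.u.mul_inv
  have h1 : (c.u : R) * (c • W).a₁ = W.a₁ + 2 * c.s := by
    rw [WeierstrassCurve.variableChange_a₁, ← mul_assoc, hu, one_mul]
  have h3 : (c.u : R) ^ 3 * (c • W).a₃ = W.a₃ + c.r * W.a₁ + 2 * c.t := by
    rw [WeierstrassCurve.variableChange_a₃, ← mul_assoc, ← mul_pow, hu, one_pow, one_mul]
  replace h1 := congrArg (algebraMap R S) h1
  replace h3 := congrArg (algebraMap R S) h3
  simp only [map_mul, map_add, map_pow, map_ofNat] at h1 h3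
  generalize algebraMap R S c.u = u at *
  generalize algebraMap R S c.r = r at *
  generalize algebraMap R S c.s = s at *
  generalize algebraMap R S c.t = t at *
  generalize algebraMap R S W.a₁ = a₁ at *
  generalize algebraMap R S W.a₃ = a₃ at *
  have k : u ^ 3 - u ^ 2 * s * z - t * w - a₁ * (u ^ 2 * z + r * w) - a₃ * w =
      n * (u ^ 3 - u ^ 2 * s * P - t * Q) := by
    linear_combination -u ^ 3 * hn + u ^ 2 * s * hP + t * hQ + u ^ 2 * z * h1 + w * h3
  have k' : 1 - a₁ * Z - a₃ * V = d' * (n * (u ^ 3 - u ^ 2 * s * P - t * Q)) := by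
    rw [hZ, hV]
    linear_combination -hd' + d' * k
  rw [k', hZ]
  linear_combination (u ^ 2 * P + r * Q) * d' * n * hd + d' * u ^ 2 * hP + d' * r * hQ

/-- A change of variables maps lines to lines, hence the third point of a chord to the third point
of the image chord, and it commutes with negation. The two identities together give the sum of two
points. -/
theorem subst_formalIso_formalGroupLaw [IsDomain R] :
    PowerSeries.subst (formalGroupLaw (c • W)) (formalIso c W) =
      MvPowerSeries.subst (fun i : Fin 2 =>
        PowerSeries.subst (MvPowerSeries.X i : MvPowerSeries (Fin 2) R) (formalIso c W))
        (formalGroupLaw W) := by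
  have hX : ∀ i : Fin 2, MvPowerSeries.constantCoeff (MvPowerSeries.X i : MvPowerSeries (Fin 2) R) = 0 := fun i => MvPowerSeries.constantCoeff_X i
  have hZ0 : ∀ i : Fin 2, MvPowerSeries.constantCoeff (PowerSeries.subst
      (MvPowerSeries.X i : MvPowerSeries (Fin 2) R) (formalIso c W)) = 0 := fun i =>
    PowerSeries.constantCoeff_subst_eq_zero (hX i) _ (constantCoeff_formalIso c W)
  have hs : MvPowerSeries.HasSubst (fun i : Fin 2 =>
      PowerSeries.subst (MvPowerSeries.X i : MvPowerSeries (Fin 2) R) (formalIso c W)) :=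
    MvPowerSeries.hasSubst_of_constantCoeff_zero hZ0
  obtain ⟨d₁, hd₁, hZ₁, hW₁⟩ := exists_subst_formalIso_eq c W (hX 0)
  obtain ⟨d₂, hd₂, hZ₂, hW₂⟩ := exists_subst_formalIso_eq c W (hX 1)
  obtain ⟨d₃, hd₃, hZ₃, hW₃⟩ := exists_subst_formalIso_eq c W (constantCoeff_thirdPoint (c • W))
  have hne : (MvPowerSeries.X 0 : MvPowerSeries (Fin 2) R) ≠ MvPowerSeries.X 1 := by
    intro h
    have := congrArg (MvPowerSeries.coeff (Finsupp.single 0 1)) h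
    simp [MvPowerSeries.coeff_index_single_X] at this
  have hch := isChord (c • W)
  have hw₃ : chordSlope (c • W) * thirdPoint (c • W) + chordIntercept (c • W) =
      PowerSeries.subst (thirdPoint (c • W)) (wSeries (c • W)) :=
    (hch.on₃ hne).eq_subst (constantCoeff_thirdPoint _) (by simp)
  rw [← hw₃] at hd₃ hZ₃ hW₃
  have hZne := mt (subst_formalIso_injective c W (hX 0) (hX 1)) hne
  have hX' : ∀ i, MvPowerSeries.substAlgHom hs (MvPowerSeries.X i : MvPowerSeries (Fin 2) R) =
      PowerSeries.subst (MvPowerSeries.X i : MvPowerSeries (Fin 2) R) (formalIso c W) :=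
    fun i => MvPowerSeries.substAlgHom_X hs i
  have hw' : ∀ i, MvPowerSeries.substAlgHom hs
      (PowerSeries.subst (MvPowerSeries.X i : MvPowerSeries (Fin 2) R) (wSeries W)) =
      PowerSeries.subst (PowerSeries.subst (MvPowerSeries.X i : MvPowerSeries (Fin 2) R)
        (formalIso c W)) (wSeries W) := fun i =>
    (((onCurve_subst (hX i)).map (MvPowerSeries.substAlgHom hs)).eq_subst
      (by rw [hX', hZ0]) (by
        rw [MvPowerSeries.substAlgHom_apply]
        exact MvPowerSeries.constantCoeff_subst_eq_zero hs hZ0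
          (constantCoeff_subst_wSeries (hX i)))).trans (by rw [hX'])
  have hCh := (isChord W).map (MvPowerSeries.substAlgHom hs)
  rw [hX', hX', hw', hw'] at hCh
  have hL0 : MvPowerSeries.constantCoeff (MvPowerSeries.substAlgHom hs (chordSlope W)) = 0 := by
    rw [MvPowerSeries.substAlgHom_apply]
    exact MvPowerSeries.constantCoeff_subst_eq_zero hs hZ0 (constantCoeff_chordSlope W)
  have hline := hch.variableChange hd₁ hd₂ hd₃ hZ₁ hW₁ hZ₂ hW₂ hZ₃ hW₃ hZne hCh.slope hCh.intercept
  have hon := onCurve_subst (W := W) (PowerSeries.constantCoeff_subst_eq_zero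
    (constantCoeff_thirdPoint (c • W)) _ (constantCoeff_formalIso c W))
  have hthird : PowerSeries.subst (thirdPoint (c • W)) (formalIso c W) =
      MvPowerSeries.substAlgHom hs (thirdPoint W) := by
    -- The image point is on the image chord by `hline`. It is the third point since the cubic is
    -- nondegenerate and the image differs from both first points.
    refine hCh.eq_third hZne ?_ (by rwa [← hline]) ?_ ?_
    · intro h
      have := congrArg MvPowerSeries.constantCoeff h
      simp only [chordLead, map_add, map_one, map_mul, map_pow, hL0, mul_zero, ne_eq,
        OfNat.ofNat_ne_zero, not_false_eq_true, zero_pow, add_zero, map_zero, one_ne_zero] at this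
    · exact mt (subst_formalIso_injective c W (constantCoeff_thirdPoint _) (hX 0))
        (thirdPoint_ne _ 0)
    · exact mt (subst_formalIso_injective c W (constantCoeff_thirdPoint _) (hX 1))
        (thirdPoint_ne _ 1)
  have hC : ∀ x : R, MvPowerSeries.C x = algebraMap R (MvPowerSeries (Fin 2) R) x := fun x => by
    simp [MvPowerSeries.algebraMap_apply]
  have hF := congrArg (MvPowerSeries.substAlgHom hs) (formalGroupLaw_mul W)
  have hDen : MvPowerSeries.substAlgHom hs (negDenom W) = 1
      - algebraMap R _ W.a₁ * PowerSeries.subst (thirdPoint (c • W)) (formalIso c W)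
      - algebraMap R _ W.a₃ *
        PowerSeries.subst (PowerSeries.subst (thirdPoint (c • W)) (formalIso c W)) (wSeries W) := by
    rw [hline, hthird, negDenom, hC, hC]
    simp only [map_sub, map_mul, map_add, map_one, AlgHom.commutes]
  rw [map_mul, map_neg, ← hthird] at hF
  obtain ⟨d₄, hd₄, hZ₄, hW₄⟩ := exists_subst_formalIso_eq c W
    (constantCoeff_formalGroupLaw (c • W))
  have hP := formalGroupLaw_mul (c • W)
  obtain ⟨e, he⟩ : ∃ e, negDenom (c • W) * e = 1 :=
    (MvPowerSeries.isUnit_iff_constantCoeff.2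
      (by rw [constantCoeff_negDenom]; exact isUnit_one)).exists_right_inv
  have hn : negDenom (c • W) = 1 - algebraMap R _ (c • W).a₁ * thirdPoint (c • W)
      - algebraMap R _ (c • W).a₃ *
        (chordSlope (c • W) * thirdPoint (c • W) + chordIntercept (c • W)) := by
    rw [negDenom, hC, hC]
  have hP' : formalGroupLaw (c • W) = -thirdPoint (c • W) * e := by
    linear_combination e * hP - formalGroupLaw (c • W) * he
  have hQ' : PowerSeries.subst (formalGroupLaw (c • W)) (wSeries (c • W)) =
      -(chordSlope (c • W) * thirdPoint (c • W) + chordIntercept (c • W)) * e := by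
    refine (OnCurve.eq_subst (constantCoeff_formalGroupLaw _) (by simp) ?_).symm
    rw [hP']
    exact (hch.on₃ hne).neg (by rw [← hn, he])
  have hQ : PowerSeries.subst (formalGroupLaw (c • W)) (wSeries (c • W)) * negDenom (c • W) =
      -(chordSlope (c • W) * thirdPoint (c • W) + chordIntercept (c • W)) := by
    rw [hQ']
    linear_combination
      -(chordSlope (c • W) * thirdPoint (c • W) + chordIntercept (c • W)) * he
  have := variableChange_neg c W hn hP hQ hd₄ hd₃ hZ₃ hW₃
  rw [← hZ₄, ← hDen, ← hF] at this
  rw [← MvPowerSeries.substAlgHom_apply hs]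
  refine mul_right_cancel₀ ?_ this
  intro h
  have h1 := congrArg MvPowerSeries.constantCoeff hDen
  rw [h] at h1
  simp [PowerSeries.constantCoeff_subst_eq_zero (constantCoeff_thirdPoint (c • W)) _
    (constantCoeff_formalIso c W), constantCoeff_subst_wSeries] at h1

end

/-! ### Base change of the formal group law. -/

section

variable {R S : Type*} [CommRing R] [CommRing S] (f : R →+* S) (W : WeierstrassCurve R)

theorem map_wApprox (n : ℕ) : PowerSeries.map f (wApprox W n) = wApprox (W.map f) n := by
  induction n with
  | zero => simp [wApprox]
  | succ n ih => simp [wApprox, ih]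

theorem map_wSeries : PowerSeries.map f (wSeries W) = wSeries (W.map f) := by
  ext n
  rw [PowerSeries.coeff_map, wSeries, wSeries, PowerSeries.coeff_mk, PowerSeries.coeff_mk,
    ← map_wApprox, PowerSeries.coeff_map]

theorem map_chordSlope : MvPowerSeries.map f (chordSlope W) = chordSlope (W.map f) := by
  ext e
  rw [MvPowerSeries.coeff_map]
  change f (PowerSeries.coeff _ (wSeries W)) = PowerSeries.coeff _ (wSeries (W.map f))
  rw [← map_wSeries, PowerSeries.coeff_map]

theorem map_chordIntercept :
    MvPowerSeries.map f (chordIntercept W) = chordIntercept (W.map f) := by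
  rw [chordIntercept, chordIntercept, map_sub, map_mul, map_chordSlope, MvPowerSeries.map_X,
    PowerSeries.map_subst (PowerSeries.HasSubst.X 0), map_wSeries, MvPowerSeries.map_X]

theorem map_mvInvOfUnit {τ : Type*} (p : MvPowerSeries τ R)
    (h : MvPowerSeries.constantCoeff p = 1) :
    MvPowerSeries.map f (MvPowerSeries.invOfUnit p 1) =
      MvPowerSeries.invOfUnit (MvPowerSeries.map f p) 1 := by
  have h1 := congrArg (MvPowerSeries.map f) (MvPowerSeries.mul_invOfUnit p 1 h)
  have h2 := MvPowerSeries.mul_invOfUnit (MvPowerSeries.map f p) 1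
    (by rw [MvPowerSeries.constantCoeff_map, h, map_one, Units.val_one])
  rw [map_mul, map_one] at h1
  linear_combination (MvPowerSeries.invOfUnit (MvPowerSeries.map f p) 1) * h1 -
    MvPowerSeries.map f (MvPowerSeries.invOfUnit p 1) * h2

theorem map_thirdPoint : MvPowerSeries.map f (thirdPoint W) = thirdPoint (W.map f) := by
  rw [thirdPoint, thirdPoint]
  simp only [map_sub, map_neg, map_mul, MvPowerSeries.map_X]
  rw [map_mvInvOfUnit _ _ (by simp)]
  simp only [map_add, map_mul, map_pow, map_one, map_chordSlope, map_chordIntercept,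
    MvPowerSeries.map_C, WeierstrassCurve.map_a₁, WeierstrassCurve.map_a₂, WeierstrassCurve.map_a₃,
    WeierstrassCurve.map_a₄, WeierstrassCurve.map_a₆, map_ofNat]

theorem map_formalGroupLaw :
    MvPowerSeries.map f (formalGroupLaw W) = formalGroupLaw (W.map f) := by
  rw [formalGroupLaw, formalGroupLaw, map_mul, map_mvInvOfUnit _ _ (by simp)]
  simp only [map_sub, map_add, map_mul, map_neg, map_one, map_chordSlope, map_chordIntercept,
    map_thirdPoint, MvPowerSeries.map_C, WeierstrassCurve.map_a₁, WeierstrassCurve.map_a₃]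

theorem map_formalIso (c : WeierstrassCurve.VariableChange R) :
    PowerSeries.map f (formalIso c W) = formalIso (c.map f) (W.map f) := by
  obtain ⟨d, hd, hf⟩ := exists_formalIso_eq c W
  obtain ⟨d', hd', hf'⟩ := exists_formalIso_eq (c.map f) (W.map f)
  replace hd := congrArg (PowerSeries.map f) hd
  rw [hf, hf']
  rw [WeierstrassCurve.map_variableChange, ← map_wSeries] at hd' ⊢
  simp only [map_mul, map_sub, map_add, map_pow, map_one, PowerSeries.algebraMap_apply,
    Algebra.algebraMap_self, RingHom.id_apply, PowerSeries.map_C, PowerSeries.map_X,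
    WeierstrassCurve.VariableChange.map, Units.coe_map, MonoidHom.coe_coe] at hd hd' ⊢
  linear_combination (PowerSeries.C (f ↑c.u) ^ 2 * PowerSeries.X +
    PowerSeries.C (f c.r) * (PowerSeries.map f) (wSeries (c • W))) *
    (d' * hd - PowerSeries.map f d * hd')

/-! ### The doubling series -/

/-- The power series `[2](z) = F(z, z)`. -/
def doubling : PowerSeries R :=
  MvPowerSeries.subst (fun _ : Fin 2 => (PowerSeries.X : PowerSeries R)) (formalGroupLaw W)

theorem hasSubst_diag : MvPowerSeries.HasSubst (fun _ : Fin 2 => (PowerSeries.X : PowerSeries R)) :=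
  MvPowerSeries.hasSubst_of_constantCoeff_zero fun _ => PowerSeries.constantCoeff_X

theorem map_doubling : PowerSeries.map f (doubling W) = doubling (W.map f) := by
  rw [doubling, doubling, ← map_formalGroupLaw]
  refine (MvPowerSeries.map_subst hasSubst_diag _).trans ?_
  congr 1
  funext i
  exact PowerSeries.map_X f

/-- A homomorphism of formal group laws commutes with doubling. -/
theorem subst_doubling {W' : WeierstrassCurve R} {p : PowerSeries R}
    (hp : PowerSeries.constantCoeff p = 0)
    (h : PowerSeries.subst (formalGroupLaw W') p =
      MvPowerSeries.subst
        (fun i : Fin 2 => PowerSeries.subst (MvPowerSeries.X i : MvPowerSeries (Fin 2) R) p)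
        (formalGroupLaw W)) :
    PowerSeries.subst (doubling W') p = PowerSeries.subst p (doubling W) := by
  have hp' := PowerSeries.HasSubst.of_constantCoeff_zero' hp
  have hs : MvPowerSeries.HasSubst
      (fun i : Fin 2 => PowerSeries.subst (MvPowerSeries.X i : MvPowerSeries (Fin 2) R) p) :=
    MvPowerSeries.hasSubst_of_constantCoeff_zero fun i =>
      PowerSeries.constantCoeff_subst_eq_zero (MvPowerSeries.constantCoeff_X i) _ hp
  have hF := PowerSeries.HasSubst.of_constantCoeff_zero (constantCoeff_formalGroupLaw W')
  have h1 := congrArg (MvPowerSeries.subst (fun _ : Fin 2 => (PowerSeries.X : PowerSeries R))) h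
  rw [PowerSeries.subst, MvPowerSeries.subst_comp_subst_apply hF.const hasSubst_diag,
    MvPowerSeries.subst_comp_subst_apply hs hasSubst_diag] at h1
  have h2 : PowerSeries.subst p (doubling W) = MvPowerSeries.subst (fun _ : Fin 2 => p)
      (formalGroupLaw W) := by
    rw [doubling, PowerSeries.subst, MvPowerSeries.subst_comp_subst_apply hasSubst_diag hp'.const]
    congr 1
    funext i
    exact PowerSeries.subst_X hp'
  rw [h2]
  refine Eq.trans h1 ?_
  congr 1
  funext i
  rw [PowerSeries.subst, MvPowerSeries.subst_comp_subst_apply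
    (PowerSeries.HasSubst.X i).const hasSubst_diag, MvPowerSeries.subst_X hasSubst_diag]
  exact PowerSeries.X_subst p

/-- There are `n + 1` monomials of degree `n`, all with coefficient `c n`. For the slope of the
chord this gives the derivative of `w`, the slope of the tangent. -/
theorem coeff_subst_diag (p : MvPowerSeries (Fin 2) R) (c : ℕ → R)
    (h : ∀ e, MvPowerSeries.coeff e p = c (e 0 + e 1)) (n : ℕ) :
    PowerSeries.coeff n
      (MvPowerSeries.subst (fun _ : Fin 2 => (PowerSeries.X : PowerSeries R)) p) =
      (n + 1) * c n := by
  have hX : ∀ e : Fin 2 →₀ ℕ, (e.prod fun _ m => (PowerSeries.X : PowerSeries R) ^ m) =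
      PowerSeries.X ^ (e 0 + e 1) := by
    intro e
    rw [Finsupp.prod_fintype _ _ (fun _ => pow_zero _), Fin.prod_univ_two, pow_add]
  refine (MvPowerSeries.coeff_subst hasSubst_diag p _).trans ?_
  have h2 : ∀ e : Fin 2 →₀ ℕ, MvPowerSeries.coeff e p •
      (PowerSeries.coeff n (e.prod fun _ m => (PowerSeries.X : PowerSeries R) ^ m)) =
      if e 0 + e 1 = n then c n else 0 := by
    intro e
    rw [hX, PowerSeries.coeff_X_pow, h, smul_eq_mul]
    split_ifs with h1 h2 h2
    · rw [h2, mul_one]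
    · exact absurd h1.symm h2
    · exact absurd h2.symm h1
    · rw [mul_zero]
  refine (finsum_congr h2).trans ?_
  have hinj : Function.Injective fun q : ℕ × ℕ =>
      (Finsupp.equivFunOnFinite.symm ![q.1, q.2] : Fin 2 →₀ ℕ) := by
    intro q q' hq
    have h0 := DFunLike.congr_fun hq 0
    have h1 := DFunLike.congr_fun hq 1
    exact Prod.ext h0 h1
  rw [finsum_eq_sum_of_support_subset (s := (Finset.HasAntidiagonal.antidiagonal n).map ⟨_, hinj⟩),
    Finset.sum_map, Finset.sum_congr rfl (g := fun _ => c n)]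
  · simp
  · intro q hq
    rw [if_pos]
    simpa using Finset.HasAntidiagonal.mem_antidiagonal.1 hq
  · intro e he
    simp only [Function.mem_support, ne_eq, ite_eq_right_iff, Classical.not_imp] at he
    simp only [Finset.coe_map, Function.Embedding.coeFn_mk, Set.mem_image, Finset.mem_coe,
      Finset.HasAntidiagonal.mem_antidiagonal]
    refine ⟨(e 0, e 1), he.1, ?_⟩
    ext i
    fin_cases i <;> rfl

theorem subst_diag_chordSlope :
    MvPowerSeries.subst (fun _ : Fin 2 => (PowerSeries.X : PowerSeries R)) (chordSlope W) =
      PowerSeries.derivative R (wSeries W) := by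
  ext n
  rw [coeff_subst_diag (chordSlope W) (fun m => PowerSeries.coeff (m + 1) (wSeries W)) fun e => rfl,
    PowerSeries.coeff_derivative, mul_comm]

variable (R) in
/-- Restriction of a power series in two variables to the diagonal. -/
def diagHom : MvPowerSeries (Fin 2) R →ₐ[R] PowerSeries R :=
  MvPowerSeries.substAlgHom hasSubst_diag

theorem diagHom_apply (p : MvPowerSeries (Fin 2) R) : diagHom R p =
    MvPowerSeries.subst (fun _ : Fin 2 => (PowerSeries.X : PowerSeries R)) p :=
  MvPowerSeries.substAlgHom_apply hasSubst_diag p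

theorem diagHom_X (i : Fin 2) : diagHom R (MvPowerSeries.X i) = PowerSeries.X :=
  MvPowerSeries.substAlgHom_X hasSubst_diag i

theorem diagHom_subst_X (i : Fin 2) (p : PowerSeries R) :
    diagHom R (PowerSeries.subst (MvPowerSeries.X i : MvPowerSeries (Fin 2) R) p) = p := by
  rw [diagHom_apply, PowerSeries.subst, MvPowerSeries.subst_comp_subst_apply
    (PowerSeries.HasSubst.X i).const hasSubst_diag, MvPowerSeries.subst_X hasSubst_diag]
  exact PowerSeries.X_subst p

/-- The equations that determine the doubling series. -/
theorem exists_doubling_eq : ∃ l n z : PowerSeries R,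
    l = PowerSeries.derivative R (wSeries W) ∧ n = wSeries W - l * PowerSeries.X ∧
    PowerSeries.constantCoeff z = 0 ∧
    (PowerSeries.X + PowerSeries.X + z) * chordLead W l + chordQuad W l n = 0 ∧
    doubling W * (1 - PowerSeries.C W.a₁ * z - PowerSeries.C W.a₃ * (l * z + n)) = -z := by
  have h := (isChord W).map (diagHom R)
  have hF := congrArg (diagHom R) (formalGroupLaw_mul W)
  have hC : ∀ x : R, MvPowerSeries.C x = algebraMap R (MvPowerSeries (Fin 2) R) x := fun x => by
    simp [MvPowerSeries.algebraMap_apply]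
  rw [diagHom_X, diagHom_X, diagHom_subst_X, diagHom_subst_X] at h
  refine ⟨diagHom R (chordSlope W), diagHom R (chordIntercept W), diagHom R (thirdPoint W),
    ?_, h.intercept, ?_, h.sum, ?_⟩
  · rw [diagHom_apply, subst_diag_chordSlope]
  · rw [diagHom_apply]
    exact MvPowerSeries.constantCoeff_subst_eq_zero hasSubst_diag
      (fun _ => PowerSeries.constantCoeff_X) (constantCoeff_thirdPoint W)
  · rw [negDenom, hC, hC] at hF
    simp only [map_mul, map_sub, map_add, map_neg, map_one, AlgHom.commutes] at hF
    rw [doubling, ← diagHom_apply]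
    exact hF

theorem coeff_two_mul (p q : PowerSeries R) : PowerSeries.coeff 2 (p * q) =
    PowerSeries.coeff 0 p * PowerSeries.coeff 2 q + PowerSeries.coeff 1 p * PowerSeries.coeff 1 q
      + PowerSeries.coeff 2 p * PowerSeries.coeff 0 q := by
  rw [PowerSeries.coeff_mul]
  simp [Finset.Nat.antidiagonal_succ, add_assoc]

theorem coeff_one_mul' (p q : PowerSeries R) : PowerSeries.coeff 1 (p * q) =
    PowerSeries.coeff 0 p * PowerSeries.coeff 1 q
      + PowerSeries.coeff 1 p * PowerSeries.coeff 0 q := by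
  rw [PowerSeries.coeff_mul]
  simp [Finset.Nat.antidiagonal_succ]

theorem coeff_three_wSeries : PowerSeries.coeff 3 (wSeries W) = 1 := by
  rw [coeff_wSeries W (n := 1) (by omega)]
  simp [wApprox, PowerSeries.coeff_X_pow]

/-- Through second order only `l = 3z² + ⋯` and `a₁` contribute. The quadratic coefficient is what
makes `u₁` visible in the formal group law of `curveU`. -/
theorem coeff_doubling : PowerSeries.coeff 0 (doubling W) = 0 ∧
    PowerSeries.coeff 1 (doubling W) = 2 ∧ PowerSeries.coeff 2 (doubling W) = -W.a₁ := by
  obtain ⟨l, n, z, hl, hn, hz, hs, hd⟩ := exists_doubling_eq W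
  have hw : ∀ m < 3, PowerSeries.coeff m (wSeries W) = 0 := fun m hm =>
    PowerSeries.X_pow_dvd_iff.1 (X_pow_dvd_wSeries W) m hm
  have hl0 : PowerSeries.coeff 0 l = 0 := by
    rw [hl, PowerSeries.coeff_derivative, hw _ (by omega), zero_mul]
  have hl1 : PowerSeries.coeff 1 l = 0 := by
    rw [hl, PowerSeries.coeff_derivative, hw _ (by omega), zero_mul]
  have hl2 : PowerSeries.coeff 2 l = 3 := by
    rw [hl, PowerSeries.coeff_derivative, coeff_three_wSeries]
    norm_num
  have hX0 : PowerSeries.coeff 0 (PowerSeries.X : PowerSeries R) = 0 := PowerSeries.coeff_zero_X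
  have hX1 : PowerSeries.coeff 1 (PowerSeries.X : PowerSeries R) = 1 := PowerSeries.coeff_one_X
  have hX2 : PowerSeries.coeff 2 (PowerSeries.X : PowerSeries R) = 0 := by
    simp [PowerSeries.coeff_X]
  have hn0 : PowerSeries.coeff 0 n = 0 := by
    rw [hn, map_sub, hw 0 (by omega), PowerSeries.coeff_zero_mul_X, sub_zero]
  have hn1 : PowerSeries.coeff 1 n = 0 := by
    rw [hn, map_sub, hw 1 (by omega), coeff_one_mul', hl0, hl1]; ring
  have hn2 : PowerSeries.coeff 2 n = 0 := by
    rw [hn, map_sub, hw 2 (by omega), coeff_two_mul, hl0, hl1, hX0]; ring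
  rw [← PowerSeries.coeff_zero_eq_constantCoeff_apply] at hz
  simp only [chordLead, chordQuad, PowerSeries.algebraMap_apply, Algebra.algebraMap_self,
    RingHom.id_apply, mul_assoc] at hs
  have hz1 := congrArg (PowerSeries.coeff 1) hs
  have hz2 := congrArg (PowerSeries.coeff 2) hs
  have h0 : PowerSeries.coeff 0 (1 : PowerSeries R) = 1 := by simp
  have h1 : PowerSeries.coeff 1 (1 : PowerSeries R) = 0 := by simp [PowerSeries.coeff_one]
  have h2 : PowerSeries.coeff 2 (1 : PowerSeries R) = 0 := by simp [PowerSeries.coeff_one]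
  have hm : ∀ p q : PowerSeries R, PowerSeries.coeff 0 (p * q) =
    PowerSeries.coeff 0 p * PowerSeries.coeff 0 q := fun p q => by simp
  simp only [pow_succ, pow_zero, one_mul, map_add, coeff_two_mul, coeff_one_mul', hm,
    PowerSeries.coeff_C_mul, map_zero,
    hl0, hl1, hl2, hn0, hn1, hn2, hX0, hX1, hX2, hz, h0, h1, h2, mul_zero, zero_mul, add_zero,
    zero_add, mul_one] at hz1 hz2
  have hd0 := congrArg (PowerSeries.coeff 0) hd
  have hd1 := congrArg (PowerSeries.coeff 1) hd
  have hd2 := congrArg (PowerSeries.coeff 2) hd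
  simp only [map_add, map_sub, map_neg, coeff_two_mul, coeff_one_mul', hm, PowerSeries.coeff_C_mul,
    hl0, hl1, hl2, hn0, hn1, hn2, hz, h0, h1, h2, mul_zero, zero_mul, add_zero,
    mul_one, sub_zero, neg_zero] at hd0 hd1 hd2
  rw [hd0] at hd1 hd2
  have hd1' : PowerSeries.coeff 1 (doubling W) = 2 := by linear_combination hd1 - hz1
  refine ⟨hd0, hd1', ?_⟩
  rw [hd1'] at hd2
  linear_combination hd2 - hz2 + 2 * W.a₁ * hz1

end

/-! ### Power series modulo ideals -/

section

variable {S : Type*} [CommRing S] {I J : Ideal S}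

theorem coeff_mul_mem {p q : PowerSeries S} (hp : ∀ n, PowerSeries.coeff n p ∈ J) (n : ℕ) :
    PowerSeries.coeff n (p * q) ∈ J := by
  rw [PowerSeries.coeff_mul]
  exact Ideal.sum_mem _ fun x _ => Ideal.mul_mem_right _ _ (hp _)

theorem add_pow_of_mul_self_eq_zero {p q : PowerSeries S} (h : q * q = 0) (d : ℕ) :
    (p + q) ^ (d + 1) = p ^ (d + 1) + (d + 1 : ℕ) * (p ^ d * q) := by
  induction d with
  | zero => simp
  | succ d ih =>
    rw [pow_succ, ih]
    push_cast
    linear_combination ((d : PowerSeries S) + 1) * p ^ d * h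

/-- A first-order Taylor expansion: `q` squares to zero, and the linear term vanishes because the
derivative of `r` has coefficients in `I`. -/
theorem subst_add_eq (hIJ : ∀ i ∈ I, ∀ j ∈ J, i * j = 0) (hJI : J ≤ I) {p q r : PowerSeries S}
    (hp : PowerSeries.constantCoeff p = 0) (hq : PowerSeries.constantCoeff q = 0)
    (hqJ : ∀ n, PowerSeries.coeff n q ∈ J)
    (hr : ∀ n : ℕ, ((n + 1 : ℕ) : S) * PowerSeries.coeff (n + 1) r ∈ I) :
    PowerSeries.subst (p + q) r = PowerSeries.subst p r := by
  have hqq : q * q = 0 := by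
    ext n
    rw [PowerSeries.coeff_mul, map_zero]
    exact Finset.sum_eq_zero fun x _ => hIJ _ (hJI (hqJ _)) _ (hqJ _)
  ext e
  rw [PowerSeries.coeff_subst' (PowerSeries.HasSubst.of_constantCoeff_zero' (by simp [hp, hq])),
    PowerSeries.coeff_subst' (PowerSeries.HasSubst.of_constantCoeff_zero' hp)]
  refine finsum_congr fun d => ?_
  cases d with
  | zero => simp
  | succ d =>
    rw [add_pow_of_mul_self_eq_zero hqq, map_add, smul_add, add_eq_left,
      ← map_natCast (PowerSeries.C (R := S)), PowerSeries.coeff_C_mul, smul_eq_mul, ← mul_assoc,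
      mul_comm (PowerSeries.coeff _ r)]
    refine hIJ _ (hr d) _ ?_
    rw [mul_comm]
    exact coeff_mul_mem hqJ e

/-- Since `q` has coefficients in `J`, the composite sees `h` only modulo `I`, so `h` may be
replaced by `X ^ N * e`. The coefficient of `X ^ (N * k)` then yields `coeff k q` once the lower
ones vanish. -/
theorem eq_zero_of_subst_eq_zero (hIJ : ∀ i ∈ I, ∀ j ∈ J, i * j = 0) {h q e : PowerSeries S}
    {N : ℕ} (hN : N ≠ 0) (h0 : PowerSeries.constantCoeff h = 0)
    (hh : ∀ n, PowerSeries.coeff n h - PowerSeries.coeff n (PowerSeries.X ^ N * e) ∈ I)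
    (he : IsUnit (PowerSeries.constantCoeff e)) (hqJ : ∀ n, PowerSeries.coeff n q ∈ J)
    (hs : PowerSeries.subst h q = 0) : q = 0 := by
  have hX : PowerSeries.constantCoeff (PowerSeries.X ^ N * e) = 0 := by simp [hN]
  have hs' : PowerSeries.subst (PowerSeries.X ^ N * e) q = 0 := by
    rw [← hs]
    ext k
    rw [PowerSeries.coeff_subst' (PowerSeries.HasSubst.of_constantCoeff_zero' h0),
      PowerSeries.coeff_subst' (PowerSeries.HasSubst.of_constantCoeff_zero' hX)]
    refine finsum_congr fun d => ?_
    have hm : PowerSeries.map (Ideal.Quotient.mk I) h =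
        PowerSeries.map (Ideal.Quotient.mk I) (PowerSeries.X ^ N * e) := by
      ext n
      rw [PowerSeries.coeff_map, PowerSeries.coeff_map]
      exact Ideal.Quotient.eq.2 (hh n)
    have hd := congrArg (fun p => PowerSeries.coeff k (p ^ d)) hm
    simp only [← map_pow, PowerSeries.coeff_map] at hd
    have := hIJ _ (Ideal.Quotient.eq.1 hd) _ (hqJ d)
    rw [smul_eq_mul, smul_eq_mul]
    linear_combination -this
  ext k
  rw [map_zero]
  induction k using Nat.strong_induction_on with
  | _ k ih =>
    have hk := congrArg (PowerSeries.coeff (N * k)) hs'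
    rw [map_zero, PowerSeries.coeff_subst' (PowerSeries.HasSubst.of_constantCoeff_zero' hX),
      finsum_eq_single _ k, mul_pow, ← pow_mul, smul_eq_mul] at hk
    · have hc := PowerSeries.coeff_X_pow_mul (e ^ k) (N * k) 0
      rw [zero_add, PowerSeries.coeff_zero_eq_constantCoeff_apply, map_pow] at hc
      rw [hc] at hk
      exact (he.pow k).mul_left_eq_zero.1 hk
    · intro d hd
      rcases lt_or_gt_of_ne hd with hd | hd
      · rw [ih d hd, zero_smul]
      · rw [mul_pow, ← pow_mul, PowerSeries.coeff_X_pow_mul', if_neg, smul_zero]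
        exact not_le.2 (Nat.mul_lt_mul_of_pos_left hd (Nat.pos_of_ne_zero hN))

theorem coeff_two_subst {p h : PowerSeries S} (h0 : PowerSeries.constantCoeff h = 0) :
    PowerSeries.coeff 2 (PowerSeries.subst h p) =
      PowerSeries.coeff 1 p * PowerSeries.coeff 2 h
        + PowerSeries.coeff 2 p * PowerSeries.coeff 1 h ^ 2 := by
  have h0' : PowerSeries.coeff 0 h = 0 := by rwa [PowerSeries.coeff_zero_eq_constantCoeff_apply]
  rw [PowerSeries.coeff_subst' (PowerSeries.HasSubst.of_constantCoeff_zero' h0),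
    finsum_eq_sum_of_support_subset (s := {1, 2})]
  · rw [Finset.sum_pair (by norm_num), pow_one, smul_eq_mul, smul_eq_mul, pow_two, coeff_two_mul,
      h0']
    ring
  · intro d hd
    simp only [Finset.coe_insert, Finset.coe_singleton, Set.mem_insert_iff, Set.mem_singleton_iff]
    by_contra hne
    refine hd ?_
    obtain ⟨h', rfl⟩ := PowerSeries.X_dvd_iff.2 h0
    match d with
    | 0 => simp [PowerSeries.coeff_one]
    | 1 => exact absurd (Or.inl rfl) hne
    | 2 => exact absurd (Or.inr rfl) hne
    | d + 3 =>
      show _ • PowerSeries.coeff 2 _ = 0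
      rw [mul_pow, PowerSeries.coeff_X_pow_mul', if_neg (by omega), smul_zero]

end

/-! ### The maximal ideal of `E_0` and uniqueness of lifts -/

theorem residue_u₁ : residue u₁ = 0 := by simp [residue]

theorem residue_C (a : W4) : residue (PowerSeries.C a) = WittVector.constantCoeff a := by
  simp [residue]

theorem residue_surjective : Function.Surjective residue := by
  intro x
  refine ⟨PowerSeries.C (WittVector.teichmuller 2 x), ?_⟩
  rw [residue_C]
  exact WittVector.teichmuller_coeff_zero 2 x

theorem isUnit_iff_residue_ne_zero {a : E0} : IsUnit a ↔ residue a ≠ 0 := by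
  refine ⟨fun h => (h.map residue).ne_zero, fun h => ?_⟩
  rw [PowerSeries.isUnit_iff_constantCoeff]
  exact WittVector.isUnit_of_coeff_zero_ne_zero _ h

theorem residue_eq_zero_of_apply (φ : E0 ≃ₐ[W4] E0) {a : E0} (ha : residue a = 0) :
    residue (φ a) = 0 := by
  by_contra h
  rw [← ne_eq, ← isUnit_iff_residue_ne_zero] at h
  have := h.map φ.symm
  rw [φ.symm_apply_apply, isUnit_iff_residue_ne_zero] at this
  exact this ha

theorem residue_apply {φ : E0 →ₐ[W4] E0} (h : residue (φ u₁) = 0) (a : E0) :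
    residue (φ a) = residue a := by
  obtain ⟨b, c, rfl⟩ : ∃ b c, a = u₁ * b + PowerSeries.C c :=
    ⟨_, _, PowerSeries.eq_X_mul_shift_add_const a⟩
  have hC : φ (PowerSeries.C c) = PowerSeries.C c := φ.commutes c
  rw [map_add, map_mul, map_add, map_mul, map_add, map_mul, h, hC, residue_u₁, zero_mul, zero_mul]

theorem iInf_ker_residue_pow : ⨅ i, RingHom.ker residue ^ i = ⊥ :=
  Ideal.iInf_pow_eq_bot_of_isLocalRing _ (RingHom.ker_ne_top _)

theorem eq_of_forall_sub_mem {a b : E0} (h : ∀ n, a - b ∈ RingHom.ker residue ^ n) : a = b := by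
  have : a - b ∈ (⨅ i, RingHom.ker residue ^ i : Ideal E0) := by simpa using h
  rw [iInf_ker_residue_pow, Ideal.mem_bot] at this
  exact sub_eq_zero.1 this

/-- Write `a = u₁ * b + c` with `c` constant: agreement on `b` to order `k` gives agreement on `a`
to order `k + 1`, up to `n`. No continuity of the homomorphisms is needed. -/
theorem apply_sub_apply_mem {φ φ' : E0 →ₐ[W4] E0} (h' : residue (φ' u₁) = 0) {n : ℕ}
    (h : φ u₁ - φ' u₁ ∈ RingHom.ker residue ^ n) (a : E0) :
    φ a - φ' a ∈ RingHom.ker residue ^ n := by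
  suffices ∀ k ≤ n, ∀ a, φ a - φ' a ∈ RingHom.ker residue ^ k from this n le_rfl a
  intro k
  induction k with
  | zero => simp
  | succ k ih =>
    intro hk a
    obtain ⟨b, c, rfl⟩ : ∃ b c, a = u₁ * b + PowerSeries.C c :=
      ⟨_, _, PowerSeries.eq_X_mul_shift_add_const a⟩
    have hC : φ (PowerSeries.C c) = PowerSeries.C c := φ.commutes c
    have hC' : φ' (PowerSeries.C c) = PowerSeries.C c := φ'.commutes c
    have : φ (u₁ * b + PowerSeries.C c) - φ' (u₁ * b + PowerSeries.C c) =
        (φ u₁ - φ' u₁) * φ b + φ' u₁ * (φ b - φ' b) := by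
      rw [map_add, map_add, map_mul, map_mul, hC, hC']
      ring
    rw [this]
    refine Ideal.add_mem _ (Ideal.mul_mem_right _ _ (Ideal.pow_le_pow_right hk h)) ?_
    rw [pow_succ']
    exact Ideal.mul_mem_mul h' (ih (by omega) b)

theorem algHom_ext_of_residue {φ φ' : E0 →ₐ[W4] E0} (h' : residue (φ' u₁) = 0)
    (h : φ u₁ = φ' u₁) : φ = φ' :=
  AlgHom.ext fun a => eq_of_forall_sub_mem fun n =>
    apply_sub_apply_mem h' (by rw [h, sub_self]; exact Ideal.zero_mem _) a

theorem map_residue_curveU : curveU.map residue = curveC := by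
  have h : (2 : F4) = 0 := CharTwo.two_eq_zero
  ext
  · simp only [curveU, curveC, WeierstrassCurve.map_a₁, map_mul, residue_u₁, mul_zero]
  · simp [curveU, curveC]
  · simp only [curveU, curveC, WeierstrassCurve.map_a₃, map_sub, map_pow, map_one, residue_u₁]
    linear_combination -h
  · simp [curveU, curveC]
  · simp [curveU, curveC]

/-- In characteristic two `w = z³ + w²` gives the tangent slope `z²`, so the third point is at `z⁴`.
The denominator `1 - z⁶ - w²` has zero derivative, since `z⁶` and `w²` are squares. The formal group
law thus has height two. -/
theorem exists_doubling_curveC : ∃ e : PowerSeries F4, PowerSeries.constantCoeff e = 1 ∧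
    doubling curveC = PowerSeries.X ^ 4 * e ∧
    PowerSeries.derivative F4 (doubling curveC) = 0 := by
  have h2 : (2 : PowerSeries F4) = 0 := by
    have h : (2 : F4) = 0 := CharTwo.two_eq_zero
    have := congrArg (PowerSeries.C (R := F4)) h
    rwa [map_ofNat, map_zero] at this
  obtain ⟨l, n, z, hl, hn, hz, hs, hd⟩ := exists_doubling_eq curveC
  have hw := onCurve_wSeries curveC
  have hw0 := constantCoeff_wSeries curveC
  simp only [OnCurve, chordLead, chordQuad, curveC, map_zero, zero_mul, add_zero, zero_add,
    map_one, one_mul, mul_one, mul_zero, sub_zero] at hw hs hd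
  change wSeries curveC = PowerSeries.X ^ 3 + wSeries curveC ^ 2 at hw
  change doubling curveC * (1 - (l * z + n)) = -z at hd
  generalize wSeries curveC = w at *
  generalize doubling curveC = d at *
  have hl' : l = PowerSeries.X ^ 2 := by
    have h := congrArg (PowerSeries.derivative F4) hw
    simp only [map_add, Derivation.leibniz_pow, PowerSeries.derivative_X, nsmul_eq_mul, smul_eq_mul,
      mul_one, Nat.add_one_sub_one, pow_one, Nat.cast_ofNat] at h
    rw [hl, h]
    linear_combination (PowerSeries.X ^ 2 + w * PowerSeries.derivative F4 w) * h2
  have hz' : z = PowerSeries.X ^ 4 := by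
    rw [hl'] at hs
    linear_combination hs - (PowerSeries.X + PowerSeries.X ^ 4) * h2
  have hN : 1 - (l * z + n) = 1 - PowerSeries.X ^ 6 - w ^ 2 := by
    rw [hn, hz', hl']
    linear_combination -hw
  rw [hN, hz'] at hd
  have hN1 : PowerSeries.constantCoeff (1 - PowerSeries.X ^ 6 - w ^ 2) = 1 := by simp [hw0]
  refine ⟨PowerSeries.invOfUnit (1 - PowerSeries.X ^ 6 - w ^ 2) 1, by simp, ?_, ?_⟩
  · have := PowerSeries.mul_invOfUnit (1 - PowerSeries.X ^ 6 - w ^ 2) 1 (by rw [hN1]; rfl)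
    linear_combination PowerSeries.invOfUnit (1 - PowerSeries.X ^ 6 - w ^ 2) 1 * hd - d * this -
      PowerSeries.X ^ 4 * PowerSeries.invOfUnit (1 - PowerSeries.X ^ 6 - w ^ 2) 1 * h2
  · have h := congrArg (PowerSeries.derivative F4) hd
    simp only [map_sub, map_neg, Derivation.leibniz, Derivation.leibniz_pow,
      PowerSeries.derivative_X, nsmul_eq_mul, smul_eq_mul, mul_one, Nat.cast_ofNat,
      Derivation.map_one_eq_zero, Nat.add_one_sub_one, pow_one] at h
    have h3 : (1 - PowerSeries.X ^ 6 - w ^ 2) * PowerSeries.derivative F4 d = 0 := by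
      linear_combination h + (d * (3 * PowerSeries.X ^ 5 + w * PowerSeries.derivative F4 w) -
        2 * PowerSeries.X ^ 3) * h2
    refine (mul_eq_zero.1 h3).resolve_left fun h0 => ?_
    rw [h0, map_zero] at hN1
    exact zero_ne_one hN1

/-- `f` is an isomorphism of formal group laws from the conjugate by `φ` of that of `curveU` to
that of `curveU`. -/
structure IsFormalLift (φ : E0 ≃ₐ[W4] E0) (f : PowerSeries E0) : Prop where
  constantCoeff : PowerSeries.constantCoeff f = 0
  hom : PowerSeries.subst
      (MvPowerSeries.map (φ : E0 →+* E0) (formalGroupLaw curveU)) f =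
    MvPowerSeries.subst
      (fun i : Fin 2 => PowerSeries.subst (MvPowerSeries.X i : MvPowerSeries (Fin 2) E0) f)
      (formalGroupLaw curveU)

theorem residue_algEquiv (φ : E0 ≃ₐ[W4] E0) (a : E0) : residue (φ a) = residue a :=
  residue_apply (φ := φ.toAlgHom) (residue_eq_zero_of_apply φ residue_u₁) a

theorem constantCoeff_map_eq {R S : Type*} [CommRing R] [CommRing S] (f : R →+* S)
    (p : PowerSeries R) : PowerSeries.constantCoeff (PowerSeries.map f p) =
      f (PowerSeries.constantCoeff p) := by
  rw [← PowerSeries.coeff_zero_eq_constantCoeff_apply, PowerSeries.coeff_map,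
    PowerSeries.coeff_zero_eq_constantCoeff_apply]

namespace IsFormalLift

variable {φ φ' : E0 ≃ₐ[W4] E0} {f f' : PowerSeries E0}

theorem subst_doubling (h : IsFormalLift φ f) :
    PowerSeries.subst (PowerSeries.map (φ : E0 →+* E0) (doubling curveU)) f =
      PowerSeries.subst f (doubling curveU) := by
  have h1 := h.hom
  rw [map_formalGroupLaw] at h1
  rw [map_doubling]
  exact MoravaE.subst_doubling curveU h.constantCoeff h1

/-- Compare the coefficients of `z²` in the identity between the doubling series. -/
theorem coeff_relation (h : IsFormalLift φ f) :
    3 * (PowerSeries.coeff 1 f * φ u₁) =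
      2 * PowerSeries.coeff 2 f + 3 * (u₁ * PowerSeries.coeff 1 f ^ 2) := by
  obtain ⟨h0, h1, h2⟩ := coeff_doubling curveU
  have h3 := congrArg (PowerSeries.coeff 2) h.subst_doubling
  rw [coeff_two_subst h.constantCoeff, coeff_two_subst (by
    rw [← PowerSeries.coeff_zero_eq_constantCoeff_apply, PowerSeries.coeff_map, h0, map_zero]),
    PowerSeries.coeff_map, PowerSeries.coeff_map, h1, h2] at h3
  simp only [curveU, RingHom.coe_coe, map_neg, map_mul, map_ofNat] at h3
  linear_combination -h3

/-- `coeff_relation` first improves the congruence for the conjugates of `u₁`, hence for `φ` and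
`φ'`. Modulo the next power of the maximal ideal the two doubling series then agree, and height two
forces `f` and `f'` to agree. -/
theorem congr_succ (h : IsFormalLift φ f) (h' : IsFormalLift φ' f') {n : ℕ} (hn : n ≠ 0)
    (hu : IsUnit (PowerSeries.coeff 1 f))
    (hf : ∀ k, PowerSeries.coeff k f - PowerSeries.coeff k f' ∈ RingHom.ker residue ^ n) :
    φ u₁ - φ' u₁ ∈ RingHom.ker residue ^ (n + 1) ∧
    ∀ k, PowerSeries.coeff k f - PowerSeries.coeff k f' ∈ RingHom.ker residue ^ (n + 1) := by
  have h2m : (2 : E0) ∈ RingHom.ker residue := by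
    rw [RingHom.mem_ker, map_ofNat]
    exact CharTwo.two_eq_zero
  have hu1 : φ u₁ - φ' u₁ ∈ RingHom.ker residue ^ (n + 1) := by
    obtain ⟨d, hd⟩ := hu.exists_left_inv
    have h3 : IsUnit (3 : E0) := by
      rw [isUnit_iff_residue_ne_zero, map_ofNat]
      have h : (2 : F4) = 0 := CharTwo.two_eq_zero
      rw [show (3 : F4) = 1 by linear_combination h]
      exact one_ne_zero
    obtain ⟨c, hc⟩ := h3.exists_left_inv
    -- Every difference of coefficients on the right is multiplied by `2`, `u₁` or `φ' u₁`, all in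
    -- the maximal ideal; this gains one order.
    have key : φ u₁ - φ' u₁ = c * d * (2 * (PowerSeries.coeff 2 f - PowerSeries.coeff 2 f')
        + 3 * (PowerSeries.coeff 1 f + PowerSeries.coeff 1 f') * (u₁ *
          (PowerSeries.coeff 1 f - PowerSeries.coeff 1 f'))
        - 3 * (φ' u₁ * (PowerSeries.coeff 1 f - PowerSeries.coeff 1 f'))) := by
      linear_combination c * d * h.coeff_relation - c * d * h'.coeff_relation
        - (φ u₁ - φ' u₁) * hc - 3 * c * (φ u₁ - φ' u₁) * hd
    rw [key, pow_succ']
    refine Ideal.mul_mem_left _ _ (Ideal.sub_mem _ (Ideal.add_mem _ ?_ ?_) ?_)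
    · exact Ideal.mul_mem_mul h2m (hf 2)
    · exact Ideal.mul_mem_left _ _ (Ideal.mul_mem_mul residue_u₁ (hf 1))
    · exact Ideal.mul_mem_left _ _
        (Ideal.mul_mem_mul (residue_eq_zero_of_apply φ' residue_u₁) (hf 1))
  refine ⟨hu1, ?_⟩
  have hφ : ∀ a, φ a - φ' a ∈ RingHom.ker residue ^ (n + 1) :=
    apply_sub_apply_mem (φ := φ.toAlgHom) (φ' := φ'.toAlgHom)
      (residue_eq_zero_of_apply φ' residue_u₁) hu1
  obtain ⟨e, he, hde, hdd⟩ := exists_doubling_curveC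
  obtain ⟨e', rfl⟩ := PowerSeries.map_surjective residue residue_surjective e
  have hres : PowerSeries.map residue (doubling curveU) = doubling curveC := by
    rw [map_doubling, map_residue_curveU]
  obtain ⟨π, hπ⟩ : ∃ π, π = Ideal.Quotient.mk (RingHom.ker residue ^ (n + 1)) := ⟨_, rfl⟩
  have hπs : Function.Surjective π := by rw [hπ]; exact Ideal.Quotient.mk_surjective
  have hπ0 : ∀ a, π a = 0 ↔ a ∈ RingHom.ker residue ^ (n + 1) := by
    intro a; rw [hπ]; exact Ideal.Quotient.eq_zero_iff_mem
  have hIJ : ∀ i ∈ (RingHom.ker residue).map π, ∀ j ∈ (RingHom.ker residue ^ n).map π,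
      i * j = 0 := by
    intro i hi j hj
    obtain ⟨i, hi', rfl⟩ := (Ideal.mem_map_iff_of_surjective π hπs).1 hi
    obtain ⟨j, hj', rfl⟩ := (Ideal.mem_map_iff_of_surjective π hπs).1 hj
    rw [← map_mul, hπ0, pow_succ']
    exact Ideal.mul_mem_mul hi' hj'
  have hJI : (RingHom.ker residue ^ n).map π ≤ (RingHom.ker residue).map π :=
    Ideal.map_mono (Ideal.pow_le_self hn)
  have hH : PowerSeries.map π (PowerSeries.map (φ : E0 →+* E0) (doubling curveU)) =
      PowerSeries.map π (PowerSeries.map (φ' : E0 →+* E0) (doubling curveU)) := by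
    ext k
    simp only [PowerSeries.coeff_map]
    rw [← sub_eq_zero, ← map_sub, hπ0]
    exact hφ _
  have hf0 : PowerSeries.constantCoeff (PowerSeries.map π f) = 0 := by
    rw [constantCoeff_map_eq, h.constantCoeff, map_zero]
  have hf0' : PowerSeries.constantCoeff (PowerSeries.map π f') = 0 := by
    rw [constantCoeff_map_eq, h'.constantCoeff, map_zero]
  have hdbl0 : ∀ φ : E0 ≃ₐ[W4] E0,
      PowerSeries.constantCoeff (PowerSeries.map (φ : E0 →+* E0) (doubling curveU)) = 0 := by
    intro φ
    rw [constantCoeff_map_eq, ← PowerSeries.coeff_zero_eq_constantCoeff_apply,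
      (coeff_doubling curveU).1, map_zero]
  have hε : ∀ k, PowerSeries.coeff k (PowerSeries.map π f - PowerSeries.map π f') ∈
      (RingHom.ker residue ^ n).map π := by
    intro k
    rw [map_sub, PowerSeries.coeff_map, PowerSeries.coeff_map, ← map_sub]
    exact Ideal.mem_map_of_mem π (hf k)
  have hε0 : PowerSeries.constantCoeff (PowerSeries.map π f - PowerSeries.map π f') = 0 := by
    rw [map_sub, hf0, hf0', sub_zero]
  have r1 := congrArg (PowerSeries.map π) h.subst_doubling
  have r2 := congrArg (PowerSeries.map π) h'.subst_doubling
  have hsub : ∀ {a b : PowerSeries E0}, PowerSeries.constantCoeff a = 0 →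
      PowerSeries.map π (PowerSeries.subst a b) =
        PowerSeries.subst (PowerSeries.map π a) (PowerSeries.map π b) := fun ha =>
    PowerSeries.map_subst (PowerSeries.HasSubst.of_constantCoeff_zero' ha) _
  rw [hsub (hdbl0 φ), hsub h.constantCoeff] at r1
  rw [hsub (hdbl0 φ'), hsub h'.constantCoeff, ← hH] at r2
  -- The derivative of `[2]` vanishes on the special fibre, so `[2]` does not see a change of its
  -- argument in the `n`th power of the maximal ideal.
  have r3 : PowerSeries.subst (PowerSeries.map π f) (PowerSeries.map π (doubling curveU)) =
      PowerSeries.subst (PowerSeries.map π f') (PowerSeries.map π (doubling curveU)) := by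
    rw [← subst_add_eq hIJ hJI hf0' hε0 hε, add_sub_cancel]
    intro k
    rw [PowerSeries.coeff_map, ← map_natCast π, ← map_mul]
    refine Ideal.mem_map_of_mem π ?_
    rw [RingHom.mem_ker, map_mul, ← PowerSeries.coeff_map, hres, map_natCast]
    have := congrArg (PowerSeries.coeff k) hdd
    rw [PowerSeries.coeff_derivative, map_zero] at this
    rw [← this]
    push_cast
    ring
  have hHs : PowerSeries.HasSubst
      (PowerSeries.map π (PowerSeries.map (φ : E0 →+* E0) (doubling curveU))) :=
    PowerSeries.HasSubst.of_constantCoeff_zero' (by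
      rw [constantCoeff_map_eq, hdbl0, map_zero])
  have hfin := eq_zero_of_subst_eq_zero hIJ (q := PowerSeries.map π f - PowerSeries.map π f')
    (h := PowerSeries.map π (PowerSeries.map (φ : E0 →+* E0) (doubling curveU)))
    (e := PowerSeries.map π e') (N := 4) (by norm_num)
    (by rw [constantCoeff_map_eq, hdbl0, map_zero]) ?_ ?_ hε
    (by rw [PowerSeries.subst_sub hHs, r1, r2, r3, sub_self])
  · intro k
    have := congrArg (PowerSeries.coeff k) hfin
    rw [map_sub, PowerSeries.coeff_map, PowerSeries.coeff_map, ← map_sub, map_zero, hπ0] at this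
    exact this
  · intro k
    have hX : PowerSeries.X ^ 4 * PowerSeries.map π e' =
        PowerSeries.map π (PowerSeries.X ^ 4 * e') := by
      rw [map_mul, map_pow, PowerSeries.map_X]
    rw [hX, PowerSeries.coeff_map, PowerSeries.coeff_map, PowerSeries.coeff_map π, ← map_sub]
    refine Ideal.mem_map_of_mem π ?_
    rw [RingHom.mem_ker, map_sub, ← PowerSeries.coeff_map residue _ (PowerSeries.X ^ 4 * e'),
      map_mul, map_pow, PowerSeries.map_X, ← hde]
    rw [sub_eq_zero]
    exact (residue_algEquiv φ _).trans (by rw [← hres, PowerSeries.coeff_map])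
  · rw [constantCoeff_map_eq]
    refine IsUnit.map π (isUnit_iff_residue_ne_zero.2 ?_)
    rw [← constantCoeff_map_eq, he]
    exact one_ne_zero

theorem unique (h : IsFormalLift φ f) (h' : IsFormalLift φ' f')
    (hu : IsUnit (PowerSeries.coeff 1 f))
    (hf : PowerSeries.map residue f = PowerSeries.map residue f') : φ = φ' ∧ f = f' := by
  have key : ∀ n, ∀ k, PowerSeries.coeff k f - PowerSeries.coeff k f' ∈
      RingHom.ker residue ^ (n + 1) := by
    intro n
    induction n with
    | zero =>
      intro k
      have := congrArg (PowerSeries.coeff k) hf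
      rw [PowerSeries.coeff_map, PowerSeries.coeff_map, ← sub_eq_zero, ← map_sub] at this
      rw [zero_add, pow_one]
      exact this
    | succ n ih => exact (h.congr_succ h' n.succ_ne_zero hu ih).2
  have hle : ∀ n, RingHom.ker residue ^ (n + 1) ≤ RingHom.ker residue ^ n := fun n =>
    Ideal.pow_le_pow_right n.le_succ
  constructor
  · have h1 : φ u₁ = φ' u₁ := eq_of_forall_sub_mem fun n =>
      hle _ (hle _ (h.congr_succ h' n.succ_ne_zero hu (key n)).1)
    have h2 := algHom_ext_of_residue (φ := φ.toAlgHom) (φ' := φ'.toAlgHom)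
      (residue_eq_zero_of_apply φ' residue_u₁) h1
    exact AlgEquiv.ext fun a => DFunLike.congr_fun h2 a
  · ext1 k
    exact eq_of_forall_sub_mem fun n => hle _ (key n k)

end IsFormalLift

/-! ### Endomorphisms of `E_0` -/

-- Substitution of `b` converges for the 2-adic topology on `W4`, because the constant coefficient
-- of `b` is divisible by 2 and hence topologically nilpotent.
open PowerSeries.WithPiTopology MvPowerSeries.WithPiTopology in
theorem exists_algHom_apply_u₁ (b : E0) (hb : residue b = 0) :
    ∃ φ : E0 →ₐ[W4] E0, φ u₁ = b := by
  let _ : WithIdeal W4 := ⟨Ideal.span {((2 : ℕ) : W4)}⟩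
  have hadic : IsAdic (WithIdeal.i : Ideal W4) := rfl
  have hc : CompleteSpace W4 ∧ T2Space W4 :=
    hadic.isAdicComplete_iff.1 (inferInstanceAs
      (IsAdicComplete (Ideal.span {((2 : ℕ) : W4)}) W4))
  have := hc.1
  have := hc.2
  have hn : IsTopologicallyNilpotent (PowerSeries.constantCoeff b) := by
    rw [IsTopologicallyNilpotent, hadic.hasBasis_nhds_zero.tendsto_right_iff]
    intro k _
    rw [Filter.eventually_atTop]
    refine ⟨k, fun n hnk => Ideal.pow_le_pow_right hnk (Ideal.pow_mem_pow ?_ n)⟩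
    exact (WittVector.mem_span_p_iff_coeff_zero_eq_zero _).2 hb
  have hb' : PowerSeries.HasEval b :=
    MvPowerSeries.LinearTopology.isTopologicallyNilpotent_of_constantCoeff hn
  have : IsLinearTopology E0 E0 :=
    inferInstanceAs (IsLinearTopology (MvPowerSeries Unit W4) (MvPowerSeries Unit W4))
  have : ContinuousSMul W4 E0 := inferInstanceAs (ContinuousSMul W4 (MvPowerSeries Unit W4))
  refine ⟨PowerSeries.aeval hb', ?_⟩
  have := PowerSeries.aeval_coe hb' (Polynomial.X : Polynomial W4)
  rw [Polynomial.coe_X, Polynomial.aeval_X] at this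
  exact this

theorem exists_algEquiv_apply_u₁ {b b' : E0} (hb : residue b = 0) (hb' : residue b' = 0)
    (h : ∀ φ : E0 →ₐ[W4] E0, φ u₁ = b' → φ b = u₁)
    (h' : ∀ φ : E0 →ₐ[W4] E0, φ u₁ = b → φ b' = u₁) : ∃ φ : E0 ≃ₐ[W4] E0, φ u₁ = b := by
  obtain ⟨φ, hφ⟩ := exists_algHom_apply_u₁ b hb
  obtain ⟨φ', hφ'⟩ := exists_algHom_apply_u₁ b' hb'
  refine ⟨AlgEquiv.ofAlgHom φ φ' ?_ ?_, hφ⟩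
  · exact algHom_ext_of_residue residue_u₁
      (by rw [AlgHom.comp_apply, hφ', h' φ hφ, AlgHom.id_apply])
  · exact algHom_ext_of_residue residue_u₁
      (by rw [AlgHom.comp_apply, hφ, h φ' hφ', AlgHom.id_apply])

theorem isUnit_three : IsUnit (3 : E0) := by
  rw [isUnit_iff_residue_ne_zero, map_ofNat]
  have h : (2 : F4) = 0 := CharTwo.two_eq_zero
  rw [show (3 : F4) = 1 by linear_combination h]
  exact one_ne_zero

theorem exists_algEquiv_scale {κ : W4} (hκ : κ ^ 3 = 1) :
    ∃ φ : E0 ≃ₐ[W4] E0, φ u₁ = PowerSeries.C (κ ^ 2) * u₁ := by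
  have hC : ∀ (φ : E0 →ₐ[W4] E0) (c : W4), φ (PowerSeries.C c) = PowerSeries.C c :=
    fun φ c => φ.commutes c
  have hκ' : PowerSeries.C κ ^ 3 = (1 : E0) := by rw [← map_pow, hκ, map_one]
  refine exists_algEquiv_apply_u₁ (b' := PowerSeries.C κ * u₁)
    (by rw [map_mul, residue_u₁, mul_zero]) (by rw [map_mul, residue_u₁, mul_zero]) ?_ ?_
  · intro φ hφ
    rw [map_mul, hC, hφ, map_pow]
    linear_combination u₁ * hκ'
  · intro φ hφ
    rw [map_mul, hC, hφ, map_pow]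
    linear_combination u₁ * hκ'

/-- This is `u₁ ↦ μ (ω²u₁ + 2) / (ω²u₁ - 1)`. The denominator is a unit, and the image is in the
maximal ideal because 2 is. The inverse has the same form with `ω` and `μ` exchanged, as is checked
after multiplication by the unit 3. -/
theorem exists_algEquiv_moebius {ω μ : W4} (hω : ω ^ 3 = 1) (hμ : μ ^ 3 = 1) :
    ∃ φ : E0 ≃ₐ[W4] E0, (PowerSeries.C ω ^ 2 * u₁ - 1) * φ u₁ =
      PowerSeries.C μ * (PowerSeries.C ω ^ 2 * u₁ + 2) := by
  have hC : ∀ (φ : E0 →ₐ[W4] E0) (c : W4), φ (PowerSeries.C c) = PowerSeries.C c :=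
    fun φ c => φ.commutes c
  have h2 : residue (2 : E0) = 0 := by rw [map_ofNat]; exact CharTwo.two_eq_zero
  have hd : ∀ ω : W4, ∃ d, (PowerSeries.C ω ^ 2 * u₁ - 1) * d = 1 := fun ω => by
    refine IsUnit.exists_right_inv (isUnit_iff_residue_ne_zero.2 ?_)
    rw [map_sub, map_mul, residue_u₁, mul_zero, map_one, zero_sub]
    exact neg_ne_zero.2 one_ne_zero
  have hres : ∀ ω μ : W4, ∀ d : E0,
      residue (PowerSeries.C μ * (PowerSeries.C ω ^ 2 * u₁ + 2) * d) = 0 := fun ω μ d => by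
    rw [map_mul, map_mul, map_add, map_mul, residue_u₁, h2, mul_zero, add_zero, mul_zero, zero_mul]
  have key : ∀ ω μ : W4, ω ^ 3 = 1 → μ ^ 3 = 1 → ∀ d d' : E0,
      (PowerSeries.C ω ^ 2 * u₁ - 1) * d = 1 → (PowerSeries.C μ ^ 2 * u₁ - 1) * d' = 1 →
      ∀ φ : E0 →ₐ[W4] E0, φ u₁ = PowerSeries.C ω * (PowerSeries.C μ ^ 2 * u₁ + 2) * d' →
      φ (PowerSeries.C μ * (PowerSeries.C ω ^ 2 * u₁ + 2) * d) = u₁ := by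
    intro ω μ hω hμ d d' hd hd' φ hφ
    have hω' : PowerSeries.C ω ^ 3 = (1 : E0) := by rw [← map_pow, hω, map_one]
    have hμ' : PowerSeries.C μ ^ 3 = (1 : E0) := by rw [← map_pow, hμ, map_one]
    have h1 := congrArg φ hd
    simp only [map_mul, map_sub, map_add, map_pow, hC, map_ofNat, map_one] at h1 ⊢
    generalize φ u₁ = y at *
    generalize φ d = e at *
    generalize PowerSeries.C ω = Ω at *
    generalize PowerSeries.C μ = M at *
    have hy : (M ^ 2 * u₁ - 1) * y = Ω * (M ^ 2 * u₁ + 2) := by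
      rw [hφ]; linear_combination Ω * (M ^ 2 * u₁ + 2) * hd'
    refine isUnit_three.mul_left_cancel ?_
    have h3 : (Ω ^ 2 * y - 1) * (M ^ 2 * u₁ - 1) = 3 := by
      linear_combination Ω ^ 2 * hy + (M ^ 2 * u₁ + 2) * hω'
    have h4 : M * (Ω ^ 2 * y + 2) * (M ^ 2 * u₁ - 1) = 3 * u₁ := by
      linear_combination M * Ω ^ 2 * hy + M * (M ^ 2 * u₁ + 2) * hω' + 3 * u₁ * hμ'
    linear_combination -M * (Ω ^ 2 * y + 2) * e * h3 + (Ω ^ 2 * y - 1) * e * h4 + 3 * u₁ * h1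
  obtain ⟨d, hd₁⟩ := hd ω
  obtain ⟨d', hd₂⟩ := hd μ
  obtain ⟨φ, hφ⟩ := exists_algEquiv_apply_u₁ (hres ω μ d) (hres μ ω d')
    (key ω μ hω hμ d d' hd₁ hd₂) (key μ ω hμ hω d' d hd₂ hd₁)
  exact ⟨φ, by rw [hφ]; linear_combination PowerSeries.C μ * (PowerSeries.C ω ^ 2 * u₁ + 2) * hd₁⟩

/-! ### Lifts of the automorphisms of `curveC` -/

/-- `c` is an isomorphism from the conjugate of `curveU` by `φ` to `curveU` that lifts `h`. -/
structure IsCurveLift (φ : E0 ≃ₐ[W4] E0) (c : WeierstrassCurve.VariableChange E0)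
    (h : WeierstrassCurve.VariableChange F4) : Prop where
  smul : c • curveU = curveU.map (φ : E0 →+* E0)
  map : c.map residue = h

theorem smul_curveU_eq {φ : E0 ≃ₐ[W4] E0} {c : WeierstrassCurve.VariableChange E0} {u : E0}
    (hu : u = c.u) (h1 : u * (3 * φ u₁) = 3 * u₁ + 2 * c.s)
    (h2 : - c.s * (3 * u₁) + 3 * c.r - c.s ^ 2 = 0)
    (h3 : u ^ 3 * (φ u₁ ^ 3 - 1) = u₁ ^ 3 - 1 + c.r * (3 * u₁) + 2 * c.t)
    (h4 : - c.s * (u₁ ^ 3 - 1) - (c.t + c.r * c.s) * (3 * u₁) + 3 * c.r ^ 2 - 2 * c.s * c.t = 0)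
    (h6 : c.r ^ 3 - c.t * (u₁ ^ 3 - 1) - c.t ^ 2 - c.r * c.t * (3 * u₁) = 0) :
    c • curveU = curveU.map (φ : E0 →+* E0) := by
  have hi : (↑c.u⁻¹ : E0) * u = 1 := by rw [hu]; exact c.u.inv_mul
  ext1
  · rw [WeierstrassCurve.variableChange_a₁]
    simp only [curveU, WeierstrassCurve.map_a₁, map_mul, map_ofNat, RingHom.coe_coe]
    linear_combination -(↑c.u⁻¹ : E0) * h1 + 3 * φ u₁ * hi
  · rw [WeierstrassCurve.variableChange_a₂]
    simp only [curveU, WeierstrassCurve.map_a₂, map_zero]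
    linear_combination (↑c.u⁻¹ : E0) ^ 2 * h2
  · rw [WeierstrassCurve.variableChange_a₃]
    simp only [curveU, WeierstrassCurve.map_a₃, map_sub, map_pow, map_one, RingHom.coe_coe]
    linear_combination -(↑c.u⁻¹ : E0) ^ 3 * h3 + (φ u₁ ^ 3 - 1) *
      ((↑c.u⁻¹ : E0) ^ 2 * u ^ 2 + (↑c.u⁻¹ : E0) * u + 1) * hi
  · rw [WeierstrassCurve.variableChange_a₄]
    simp only [curveU, WeierstrassCurve.map_a₄, map_zero]
    linear_combination (↑c.u⁻¹ : E0) ^ 4 * h4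
  · rw [WeierstrassCurve.variableChange_a₆]
    simp only [curveU, WeierstrassCurve.map_a₆, map_zero]
    linear_combination (↑c.u⁻¹ : E0) ^ 6 * h6

theorem F4_pow_three {x : F4} (hx : x ≠ 0) : x ^ 3 = 1 := by
  have := Fintype.ofFinite F4
  have h : Fintype.card F4 = 4 := by
    rw [← Nat.card_eq_fintype_card, GaloisField.card 2 2 (by norm_num)]; norm_num
  have := FiniteField.pow_card_sub_one_eq_one x hx
  rwa [h] at this

/-- The Teichmüller representative. -/
def teich (x : F4) : W4 := WittVector.teichmuller 2 x

theorem teich_pow_three {x : F4} (hx : x ≠ 0) : teich x ^ 3 = 1 := by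
  rw [teich, ← map_pow, F4_pow_three hx, map_one]

@[simp]
theorem residue_C_teich (x : F4) : residue (PowerSeries.C (teich x)) = x := by
  rw [residue_C]
  exact WittVector.teichmuller_coeff_zero 2 x

theorem mem_stabilizer_curveC {h : WeierstrassCurve.VariableChange F4}
    (hh : h • curveC = curveC) : h.r = h.s ^ 2 ∧ h.t ^ 2 + h.t = h.s ^ 6 := by
  have h2' : (2 : F4) = 0 := CharTwo.two_eq_zero
  have hu : (↑h.u⁻¹ : F4) ≠ 0 := Units.ne_zero _
  have h2 := congrArg WeierstrassCurve.a₂ hh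
  have h6 := congrArg WeierstrassCurve.a₆ hh
  rw [WeierstrassCurve.variableChange_a₂] at h2
  rw [WeierstrassCurve.variableChange_a₆] at h6
  simp only [curveC, mul_zero, add_zero, sub_zero, zero_add, mul_one,
    mul_eq_zero, pow_eq_zero_iff, hu, ne_eq, OfNat.ofNat_ne_zero, not_false_eq_true,
    false_or] at h2 h6
  have hr : h.r = h.s ^ 2 := by linear_combination h2 - h.r * h2'
  refine ⟨hr, ?_⟩
  rw [hr] at h6
  linear_combination -h6

theorem exists_isCurveLift_of {h : WeierstrassCurve.VariableChange F4} {φ : E0 ≃ₐ[W4] E0}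
    {u r s t : E0} (hu : residue u = h.u) (hr : residue r = h.r) (hs : residue s = h.s)
    (ht : residue t = h.t) (h1 : u * (3 * φ u₁) = 3 * u₁ + 2 * s)
    (h2 : - s * (3 * u₁) + 3 * r - s ^ 2 = 0)
    (h3 : u ^ 3 * (φ u₁ ^ 3 - 1) = u₁ ^ 3 - 1 + r * (3 * u₁) + 2 * t)
    (h4 : - s * (u₁ ^ 3 - 1) - (t + r * s) * (3 * u₁) + 3 * r ^ 2 - 2 * s * t = 0)
    (h6 : r ^ 3 - t * (u₁ ^ 3 - 1) - t ^ 2 - r * t * (3 * u₁) = 0) :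
    ∃ c, IsCurveLift φ c h ∧ (c.u : E0) = u := by
  have hu' : IsUnit u := isUnit_iff_residue_ne_zero.2 (by rw [hu]; exact h.u.ne_zero)
  refine ⟨⟨hu'.unit, r, s, t⟩, ⟨smul_curveU_eq (u := u) hu'.unit_spec.symm h1 h2 h3 h4 h6, ?_⟩,
    hu'.unit_spec⟩
  ext
  · exact hu
  · exact hr
  · exact hs
  · exact ht

theorem two_eq_zero_F4 : (2 : F4) = 0 := CharTwo.two_eq_zero

theorem residue_two : residue 2 = 0 := (map_ofNat residue 2).trans two_eq_zero_F4

theorem C_pow_three {x : W4} (hx : x ^ 3 = 1) : PowerSeries.C x ^ 3 = (1 : E0) := by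
  rw [← map_pow, hx, map_one]

/-- The lifts of the automorphisms in `C6`. -/
theorem exists_isCurveLift_of_s_eq_zero {h : WeierstrassCurve.VariableChange F4}
    (hh : h • curveC = curveC) (hs : h.s = 0) : ∃ φ c, IsCurveLift φ c h ∧
      φ u₁ = PowerSeries.C (teich h.u ^ 2) * u₁ ∧
      (h.t = 0 ∧ (c.u : E0) = PowerSeries.C (teich h.u) ∨
        h.t = 1 ∧ (c.u : E0) = -PowerSeries.C (teich h.u)) := by
  obtain ⟨hr, ht⟩ := mem_stabilizer_curveC hh
  have hκ : teich h.u ^ 3 = 1 := teich_pow_three h.u.ne_zero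
  have hK := C_pow_three hκ
  have hr0 : h.r = 0 := by rw [hr, hs]; ring
  have ht0 : h.t * (h.t - 1) = 0 := by
    rw [hs] at ht
    linear_combination ht - h.t * two_eq_zero_F4
  obtain ⟨φ, hφ'⟩ := exists_algEquiv_scale hκ
  have hφ := hφ'
  rw [map_pow] at hφ
  rcases mul_eq_zero.1 ht0 with ht0 | ht0
  · obtain ⟨c, hc, hcu⟩ := exists_isCurveLift_of (h := h) (φ := φ)
      (u := PowerSeries.C (teich h.u)) (r := 0) (s := 0) (t := 0) (residue_C_teich _)
      (by rw [map_zero, hr0]) (by rw [map_zero, hs]) (by rw [map_zero, ht0])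
      (by rw [hφ]; linear_combination 3 * u₁ * hK) (by ring)
      (by
        rw [hφ]
        linear_combination (u₁ ^ 3 * (PowerSeries.C (teich h.u) ^ 6
          + PowerSeries.C (teich h.u) ^ 3 + 1) - 1) * hK)
      (by ring) (by ring)
    exact ⟨φ, c, hc, hφ', Or.inl ⟨ht0, hcu⟩⟩
  · rw [sub_eq_zero] at ht0
    -- The negation `(x, y) ↦ (x, -y - a₁x - a₃)` of `curveU`, combined with the scaling by the cube
    -- root of unity.
    obtain ⟨c, hc, hcu⟩ := exists_isCurveLift_of (h := h) (φ := φ)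
      (u := -PowerSeries.C (teich h.u)) (r := 0) (s := -(3 * u₁)) (t := -(u₁ ^ 3 - 1))
      (by
        rw [map_neg, residue_C_teich]
        linear_combination -(h.u : F4) * two_eq_zero_F4)
      (by rw [map_zero, hr0]) (by rw [map_neg, map_mul, residue_u₁, hs]; ring)
      (by rw [map_neg, map_sub, map_pow, map_one, residue_u₁, ht0]; ring)
      (by rw [hφ]; linear_combination -3 * u₁ * hK) (by ring)
      (by
        rw [hφ]
        linear_combination -(u₁ ^ 3 * (PowerSeries.C (teich h.u) ^ 6
          + PowerSeries.C (teich h.u) ^ 3 + 1) - 1) * hK)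
      (by ring) (by ring)
    exact ⟨φ, c, hc, hφ', Or.inr ⟨ht0, hcu⟩⟩

/-- The shape of `curveU` says that the origin is a flex with tangent `y = 0`. An automorphism with
`s ≠ 0` moves this flex to another one. So the lift is built from another flex of `curveU`, and the
new `a₁` and `a₃` are matched by a Möbius transformation of `u₁`. -/
theorem exists_isCurveLift {h : WeierstrassCurve.VariableChange F4} (hh : h • curveC = curveC) :
    ∃ φ c, IsCurveLift φ c h := by
  by_cases hs : h.s = 0
  · obtain ⟨φ, c, hc, -⟩ := exists_isCurveLift_of_s_eq_zero hh hs
    exact ⟨φ, c, hc⟩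
  obtain ⟨hr, ht⟩ := mem_stabilizer_curveC hh
  have hs3 := F4_pow_three hs
  have ht1 : h.t ^ 2 + h.t = 1 := by rw [ht]; linear_combination (h.s ^ 3 + 1) * hs3
  have ht0 : h.t ≠ 0 := by
    intro h0
    rw [h0] at ht1
    simp at ht1
  -- Here `t` is a primitive cube root of unity. So is its Teichmüller representative, and this
  -- provides a square root `2 * Z + 1` of `-3`.
  have hζ : teich h.t ^ 2 + teich h.t + 1 = 0 := by
    have h1 : (teich h.t - 1) * (teich h.t ^ 2 + teich h.t + 1) = 0 := by
      linear_combination teich_pow_three ht0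
    refine (mul_eq_zero.1 h1).resolve_left fun h0 => ?_
    have h3 := congrArg (fun a => residue (PowerSeries.C a)) (sub_eq_zero.1 h0)
    simp only [residue_C_teich, map_one] at h3
    rw [h3] at ht1
    have : (1 : F4) = 0 := by linear_combination -ht1 + two_eq_zero_F4
    exact one_ne_zero this
  have hZ : PowerSeries.C (teich h.t) ^ 2 + PowerSeries.C (teich h.t) + 1 = (0 : E0) := by
    rw [← map_pow, ← map_add, ← map_one (PowerSeries.C (R := W4)), ← map_add, hζ, map_zero]
  have hω : teich h.s ^ 3 = 1 := teich_pow_three hs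
  have hκ : teich h.u ^ 3 = 1 := teich_pow_three h.u.ne_zero
  have hΩ := C_pow_three hω
  have hK := C_pow_three hκ
  obtain ⟨φ, hφ⟩ := exists_algEquiv_moebius (μ := teich h.s * teich h.u ^ 2) hω
    (by rw [mul_pow, hω, ← pow_mul, mul_comm 2 3, pow_mul, hκ]; ring)
  rw [map_mul, map_pow] at hφ
  obtain ⟨i, hi⟩ := isUnit_three.exists_right_inv
  have hi' : residue i = 1 := by
    have := congrArg residue hi
    rw [map_mul, map_ofNat, map_one] at this
    linear_combination this - residue i * two_eq_zero_F4
  have hΩr := residue_C_teich h.s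
  have hZr := residue_C_teich h.t
  have hKr := residue_C_teich h.u
  refine ⟨φ, ?_⟩
  generalize PowerSeries.C (teich h.s) = Ω at *
  generalize PowerSeries.C (teich h.t) = Z at *
  generalize PowerSeries.C (teich (h.u : F4)) = K at *
  have hx := residue_u₁
  -- The point `(r, t)` is a flex of `curveU` with tangent of slope `s`, and `i` is the inverse of
  -- 3. Vanishing of the new `a₂`, `a₄`, `a₆` expresses exactly this.
  refine (exists_isCurveLift_of (h := h) (φ := φ)
    (u := K * (Ω ^ 2 * u₁ - 1) * (2 * Z + 1) * i) (r := -(u₁ ^ 2 + Ω * u₁ + Ω ^ 2))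
    (s := Ω * (2 * Z + 1) - (1 - Z) * u₁) (t := -(u₁ ^ 2 + Ω * u₁ + Ω ^ 2) * (Ω * Z - u₁))
    ?_ ?_ ?_ ?_ ?_ ?_ ?_ ?_ ?_).imp fun c hc => hc.1
  · simp only [map_mul, map_sub, map_add, map_pow, map_one, residue_two, hx, hΩr, hKr, hi']
    linear_combination -(h.u : F4) * two_eq_zero_F4
  · simp only [map_neg, map_mul, map_add, map_pow, hx, hΩr, hr]
    linear_combination -h.s ^ 2 * two_eq_zero_F4
  · simp only [map_mul, map_sub, map_add, map_one, residue_two, hx, hΩr]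
    ring
  · simp only [map_neg, map_mul, map_sub, map_add, map_pow, hx, hΩr, hZr]
    linear_combination -h.t * hs3 - h.t * two_eq_zero_F4
  · linear_combination 3 * i * (2 * Z + 1) * K * hφ + (2 * Z + 1) * K ^ 3 * Ω * (Ω ^ 2 * u₁ + 2) * hi
      + (2 * Z + 1) * Ω * (Ω ^ 2 * u₁ + 2) * hK + (2 * Z + 1) * u₁ * hΩ
  · linear_combination -(4 * Ω ^ 2 + 4 * Ω * u₁ + u₁ ^ 2) * hZ
  · have e1 : ((Ω ^ 2 * u₁ - 1) * φ u₁) ^ 3 = (Ω ^ 2 * u₁ + 2) ^ 3 := by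
      rw [hφ]
      linear_combination (Ω ^ 2 * u₁ + 2) ^ 3 * (K ^ 6 * hΩ + (K ^ 3 + 1) * hK)
    have e2 : (2 * Z + 1) ^ 2 = -3 := by linear_combination 4 * hZ
    have e3 : (2 * Z + 1) ^ 3 * 9 * i ^ 3 = -(2 * Z + 1) := by
      linear_combination (2 * Z + 1) * 9 * i ^ 3 * e2
        - (2 * Z + 1) * (9 * i ^ 2 + 3 * i + 1) * hi
    linear_combination K ^ 3 * (2 * Z + 1) ^ 3 * i ^ 3 * e1
      + (2 * Z + 1) ^ 3 * i ^ 3 * 9 * ((Ω ^ 2 * u₁) ^ 2 + Ω ^ 2 * u₁ + 1) * hK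
      + ((Ω ^ 2 * u₁) ^ 2 + Ω ^ 2 * u₁ + 1) * e3
      - ((2 * Z + 1) * (Ω * u₁ ^ 2 - 1) + 1) * hΩ
  · linear_combination -(Ω * (2 * Z + 1) - (1 - Z) * u₁) * hΩ
      + (u₁ ^ 2 + Ω * u₁ + Ω ^ 2) * Ω * (4 * Ω + 2 * u₁) * hZ
  · linear_combination -(u₁ ^ 2 + Ω * u₁ + Ω ^ 2) ^ 2 * Ω ^ 2 * hZ
      + (u₁ ^ 2 + Ω * u₁ + Ω ^ 2) * (Ω * Z - u₁) * hΩ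

theorem IsCurveLift.isFormalLift {φ : E0 ≃ₐ[W4] E0} {c : WeierstrassCurve.VariableChange E0}
    {h : WeierstrassCurve.VariableChange F4} (H : IsCurveLift φ c h) :
    IsFormalLift φ (formalIso c curveU) where
  constantCoeff := constantCoeff_formalIso c curveU
  hom := by
    rw [map_formalGroupLaw, ← H.smul]
    exact subst_formalIso_formalGroupLaw c curveU

theorem IsCurveLift.map_formalIso {φ : E0 ≃ₐ[W4] E0} {c : WeierstrassCurve.VariableChange E0}
    {h : WeierstrassCurve.VariableChange F4} (H : IsCurveLift φ c h) :
    PowerSeries.map residue (formalIso c curveU) = formalIso h curveC := by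
  rw [MoravaE.map_formalIso, H.map, map_residue_curveU]

theorem IsCurveLift.eq_of_isFormalLift {φ φ' : E0 ≃ₐ[W4] E0}
    {c : WeierstrassCurve.VariableChange E0}
    {h : WeierstrassCurve.VariableChange F4} {f : PowerSeries E0} (H : IsCurveLift φ c h)
    (H' : IsFormalLift φ' f) (hf : PowerSeries.map residue f = formalIso h curveC) :
    φ = φ' ∧ (↑c.u⁻¹ : E0) = PowerSeries.coeff 1 f := by
  obtain ⟨h1, h2⟩ := H.isFormalLift.unique H'
    (by rw [coeff_one_formalIso]; exact Units.isUnit _) (by rw [H.map_formalIso, hf])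
  exact ⟨h1, by rw [← h2, coeff_one_formalIso]⟩

theorem IsCurveLift.unique {φ φ' : E0 ≃ₐ[W4] E0} {c c' : WeierstrassCurve.VariableChange E0}
    {h : WeierstrassCurve.VariableChange F4} (H : IsCurveLift φ c h) (H' : IsCurveLift φ' c' h) :
    φ = φ' ∧ c.u = c'.u := by
  obtain ⟨h1, h2⟩ := H.eq_of_isFormalLift H'.isFormalLift H'.map_formalIso
  rw [coeff_one_formalIso] at h2
  exact ⟨h1, inv_injective (Units.ext h2)⟩

/-- Applying `φ` to the coefficients of `c'` gives an isomorphism between conjugates that composes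
with `c`. Changes of variables are substitutions, which reverses the order on the special fibre. -/
theorem IsCurveLift.comp {φ φ' : E0 ≃ₐ[W4] E0} {c c' : WeierstrassCurve.VariableChange E0}
    {h h' : WeierstrassCurve.VariableChange F4} (H : IsCurveLift φ c h)
    (H' : IsCurveLift φ' c' h') :
    IsCurveLift (φ * φ') (c'.map (φ : E0 →+* E0) * c) (h' * h) where
  smul := by
    rw [mul_smul, H.smul, WeierstrassCurve.map_variableChange, H'.smul, WeierstrassCurve.map_map]
    rfl
  map := by
    rw [← H.map, ← H'.map]
    refine (map_mul (WeierstrassCurve.VariableChange.mapHom residue) _ _).trans ?_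
    refine congrArg (· * _) ?_
    have : residue.comp (φ : E0 →+* E0) = residue := RingHom.ext (residue_algEquiv φ)
    conv_rhs => rw [← this]
    exact WeierstrassCurve.VariableChange.map_map _ _ _

/-! ### Automorphisms of `E_*` -/

/-- The unit `u` of `E_*`. -/
def unitU : Eˣ where
  val := LaurentPolynomial.T 1
  inv := LaurentPolynomial.T (-1)
  val_inv := by rw [← LaurentPolynomial.T_add]; exact LaurentPolynomial.T_zero
  inv_val := by rw [← LaurentPolynomial.T_add]; exact LaurentPolynomial.T_zero

theorem T_eq_zpow (n : ℤ) : (LaurentPolynomial.T n : E) = ↑(unitU ^ n) := by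
  induction n with
  | zero => simp
  | succ n ih => rw [zpow_add_one, Units.val_mul, ← ih, LaurentPolynomial.T_add]; rfl
  | pred n ih => rw [zpow_sub_one, Units.val_mul, ← ih, LaurentPolynomial.T_sub]; rfl

/-- Units of `E_0` as units of `E_*`. -/
abbrev unitsC : E0ˣ →* Eˣ := Units.map (LaurentPolynomial.C : E0 →+* E)

theorem apply_T_eq {F : Type*} [FunLike F E E] [MonoidHomClass F E E] {ψ : F} {l : E0ˣ}
    (h : ψ (LaurentPolynomial.T 1) = LaurentPolynomial.C (l : E0) * LaurentPolynomial.T 1) (n : ℤ) :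
    ψ (LaurentPolynomial.T n) = LaurentPolynomial.C (↑(l ^ n) : E0) * LaurentPolynomial.T n := by
  have h1 : Units.map (ψ : E →* E) unitU = unitsC l * unitU := Units.ext h
  have h2 := congrArg Units.val (map_zpow (Units.map (ψ : E →* E)) unitU n)
  have h3 : (unitsC l * unitU) ^ n = unitsC (l ^ n) * unitU ^ n := by
    rw [map_zpow]
    exact mul_zpow (unitsC l) unitU n
  rw [h1, h3, Units.val_mul, ← T_eq_zpow, Units.coe_map, ← T_eq_zpow] at h2
  exact h2

theorem algHom_ext_of_T_one {ψ ψ' : E →ₐ[W4] E} {l : E0ˣ}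
    (hC : ∀ a, ψ (LaurentPolynomial.C a) = ψ' (LaurentPolynomial.C a))
    (h : ψ (LaurentPolynomial.T 1) = LaurentPolynomial.C (l : E0) * LaurentPolynomial.T 1)
    (h' : ψ' (LaurentPolynomial.T 1) = LaurentPolynomial.C (l : E0) * LaurentPolynomial.T 1) :
    ψ = ψ' := by
  refine AlgHom.ext fun x => ?_
  induction x using LaurentPolynomial.induction_on' with
  | add p q hp hq => rw [map_add, map_add, hp, hq]
  | C_mul_T n a => rw [map_mul, map_mul, hC, apply_T_eq h, apply_T_eq h']

/-- The endomorphism of `E_*` that extends `φ` and multiplies `u` by the unit `l`. -/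
def laurentHom (φ : E0 →ₐ[W4] E0) (l : E0ˣ) : E →ₐ[W4] E :=
  { LaurentPolynomial.eval₂ (LaurentPolynomial.C.comp (φ : E0 →+* E0)) (unitsC l * unitU) with
    commutes' := fun a => by
      have h : algebraMap W4 E a = LaurentPolynomial.C (algebraMap W4 E0 a) := rfl
      change LaurentPolynomial.eval₂ _ _ (algebraMap W4 E a) = _
      rw [h, LaurentPolynomial.eval₂_C, RingHom.comp_apply, RingHom.coe_coe, AlgHom.commutes] }

theorem laurentHom_C (φ : E0 →ₐ[W4] E0) (l : E0ˣ) (a : E0) :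
    laurentHom φ l (LaurentPolynomial.C a) = LaurentPolynomial.C (φ a) :=
  LaurentPolynomial.eval₂_C _ _ a

theorem laurentHom_T_one (φ : E0 →ₐ[W4] E0) (l : E0ˣ) :
    laurentHom φ l (LaurentPolynomial.T 1) =
      LaurentPolynomial.C (l : E0) * LaurentPolynomial.T 1 := by
  refine (LaurentPolynomial.eval₂_T _ _ 1).trans ?_
  rw [zpow_one]
  rfl

theorem laurentHom_comp (φ φ' : E0 →ₐ[W4] E0) (l l' : E0ˣ) :
    (laurentHom φ l).comp (laurentHom φ' l') =
      laurentHom (φ.comp φ') (Units.map (φ : E0 →* E0) l' * l) := by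
  refine algHom_ext_of_T_one (l := Units.map (φ : E0 →* E0) l' * l) (fun a => ?_) ?_
    (laurentHom_T_one _ _)
  · simp only [AlgHom.comp_apply, laurentHom_C]
  · rw [AlgHom.comp_apply, laurentHom_T_one, map_mul, laurentHom_C, laurentHom_T_one, ← mul_assoc,
      ← map_mul]
    rfl

theorem laurentHom_id : laurentHom (AlgHom.id W4 E0) 1 = AlgHom.id W4 E := by
  refine algHom_ext_of_T_one (l := 1) (fun a => laurentHom_C _ _ a) (laurentHom_T_one _ _) ?_
  simp

/-- The automorphism of `E_*` that extends `φ` and multiplies `u` by the unit `l`. -/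
def laurentAut (φ : E0 ≃ₐ[W4] E0) (l : E0ˣ) : E ≃ₐ[W4] E :=
  AlgEquiv.ofAlgHom (laurentHom φ l) (laurentHom φ.symm (Units.map (φ.symm : E0 →* E0) l⁻¹))
    (by
      rw [laurentHom_comp, ← laurentHom_id]
      congr 1
      · exact φ.comp_symm
      · ext1
        simp)
    (by
      rw [laurentHom_comp, ← laurentHom_id]
      congr 1
      · exact φ.symm_comp
      · ext1
        simp [← map_mul])

theorem laurentAut_C (φ : E0 ≃ₐ[W4] E0) (l : E0ˣ) (a : E0) :
    laurentAut φ l (LaurentPolynomial.C a) = LaurentPolynomial.C (φ a) :=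
  laurentHom_C _ _ a

theorem laurentAut_T_one (φ : E0 ≃ₐ[W4] E0) (l : E0ˣ) :
    laurentAut φ l (LaurentPolynomial.T 1) =
      LaurentPolynomial.C (l : E0) * LaurentPolynomial.T 1 :=
  laurentHom_T_one _ _

theorem laurentAut_mul (φ φ' : E0 ≃ₐ[W4] E0) (l l' : E0ˣ) :
    laurentAut φ l * laurentAut φ' l' =
      laurentAut (φ * φ') (Units.map (φ : E0 →* E0) l' * l) :=
  AlgEquiv.ext fun x => congrArg (fun f : E →ₐ[W4] E => f x)
    (laurentHom_comp (φ : E0 →ₐ[W4] E0) (φ' : E0 →ₐ[W4] E0) l l')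

/-! ### The action of `G24` -/

theorem exists_isCurveLift_inv (g : G24) : ∃ φ c, IsCurveLift φ c (g⁻¹).1 :=
  exists_isCurveLift (g⁻¹).2

/-- The automorphism by which an element of `G24` acts on `E_0`. -/
def actE0 (g : G24) : E0 ≃ₐ[W4] E0 := (exists_isCurveLift_inv g).choose

/-- The change of variables that lifts the inverse of an element of `G24`. -/
def liftC (g : G24) : WeierstrassCurve.VariableChange E0 :=
  (exists_isCurveLift_inv g).choose_spec.choose

theorem isCurveLift (g : G24) : IsCurveLift (actE0 g) (liftC g) (g⁻¹).1 :=
  (exists_isCurveLift_inv g).choose_spec.choose_spec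

/-- The action of `G24` on `E_*`. -/
def actE : G24 →* (E ≃ₐ[W4] E) :=
  MonoidHom.mk' (fun g => laurentAut (actE0 g) (liftC g).u⁻¹) fun g h => by
    -- Multiplicativity is a consequence of uniqueness: the composite of the chosen lifts lifts the
    -- same automorphism as the lift chosen for the product.
    have h1 := (isCurveLift g).comp (isCurveLift h)
    have h2 : (h⁻¹).1 * (g⁻¹).1 = ((g * h)⁻¹).1 := by rw [mul_inv_rev]; rfl
    rw [h2] at h1
    obtain ⟨h3, h4⟩ := h1.unique (isCurveLift (g * h))
    rw [laurentAut_mul, h3]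
    congr 1
    rw [← h4]
    refine Units.ext ?_
    simp only [WeierstrassCurve.VariableChange.mul_def, mul_inv]
    rfl

theorem isLubinTateAction_actE : IsLubinTateAction actE := fun g =>
  ⟨actE0 g, formalIso (liftC g) curveU, (isCurveLift g).isFormalLift.constantCoeff,
    (isCurveLift g).isFormalLift.hom, (isCurveLift g).map_formalIso, laurentAut_C _ _, by
    rw [coeff_one_formalIso]
    exact laurentAut_T_one _ _⟩

theorem IsLubinTateLift.eq_laurentAut {g : G24} {ψ : E ≃ₐ[W4] E} (H : IsLubinTateLift g ψ)
    {φ : E0 ≃ₐ[W4] E0} {c : WeierstrassCurve.VariableChange E0}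
    (hc : IsCurveLift φ c (g⁻¹).1) : ψ = laurentAut φ c.u⁻¹ := by
  obtain ⟨φ', f, h1, h2, h3, h4, h5⟩ := H
  obtain ⟨rfl, h7⟩ := hc.eq_of_isFormalLift ⟨h1, h2⟩ h3
  rw [← h7] at h5
  refine AlgEquiv.ext fun x => congrArg (fun f : E →ₐ[W4] E => f x) (algHom_ext_of_T_one
    (ψ := (ψ : E →ₐ[W4] E)) (ψ' := (laurentAut φ c.u⁻¹ : E →ₐ[W4] E)) (l := c.u⁻¹)
    (fun a => (h4 a).trans (laurentAut_C _ _ _).symm) h5 (laurentAut_T_one _ _))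

theorem IsLubinTateAction.eq_actE {ρ : G24 →* (E ≃ₐ[W4] E)} (H : IsLubinTateAction ρ) :
    ρ = actE :=
  MonoidHom.ext fun g => (H g).eq_laurentAut (isCurveLift g)

theorem actE_C (g : G24) (a : E0) :
    actE g (LaurentPolynomial.C a) = LaurentPolynomial.C (actE0 g a) :=
  laurentAut_C _ _ a

theorem actE_T (g : G24) (n : ℤ) : actE g (LaurentPolynomial.T n) =
    LaurentPolynomial.C (↑((liftC g).u⁻¹ ^ n) : E0) * LaurentPolynomial.T n :=
  apply_T_eq (laurentAut_T_one _ _) n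

theorem actE_T_neg (g : G24) (n : ℕ) : actE g (LaurentPolynomial.T (-n)) =
    LaurentPolynomial.C (((liftC g).u : E0) ^ n) * LaurentPolynomial.T (-n) := by
  rw [actE_T]
  simp

theorem red_C_mul_eq {a b : E0} (w : E0) (h : a = b + 2 * w) (n : ℤ) :
    red (LaurentPolynomial.C a * LaurentPolynomial.T n) =
      red (LaurentPolynomial.C b * LaurentPolynomial.T n) := by
  rw [← sub_eq_zero, ← map_sub]
  refine (red_eq_zero_iff _).2 ⟨LaurentPolynomial.C w * LaurentPolynomial.T n, ?_⟩
  rw [h, map_add, map_mul, map_ofNat]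
  ring

/-! ### Coefficients of a lift -/

theorem IsCurveLift.a₁ {φ : E0 ≃ₐ[W4] E0} {c : WeierstrassCurve.VariableChange E0}
    {h : WeierstrassCurve.VariableChange F4} (H : IsCurveLift φ c h) :
    (c.u : E0) * (3 * φ u₁) = 3 * u₁ + 2 * c.s := by
  have h1 := congrArg WeierstrassCurve.a₁ H.smul
  rw [WeierstrassCurve.variableChange_a₁] at h1
  simp only [curveU, WeierstrassCurve.map_a₁, map_mul, map_ofNat, RingHom.coe_coe] at h1
  linear_combination -(c.u : E0) * h1 + (3 * u₁ + 2 * c.s) * c.u.mul_inv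

theorem IsCurveLift.a₃ {φ : E0 ≃ₐ[W4] E0} {c : WeierstrassCurve.VariableChange E0}
    {h : WeierstrassCurve.VariableChange F4} (H : IsCurveLift φ c h) :
    (c.u : E0) ^ 3 * (φ u₁ ^ 3 - 1) = u₁ ^ 3 - 1 + c.r * (3 * u₁) + 2 * c.t := by
  have h1 := congrArg WeierstrassCurve.a₃ H.smul
  have h2 : (c.u : E0) ^ 3 * (↑c.u⁻¹ : E0) ^ 3 = 1 := by rw [← mul_pow, c.u.mul_inv, one_pow]
  rw [WeierstrassCurve.variableChange_a₃] at h1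
  simp only [curveU, WeierstrassCurve.map_a₃, map_sub, map_pow, map_one, RingHom.coe_coe] at h1
  linear_combination -(c.u : E0) ^ 3 * h1 + (u₁ ^ 3 - 1 + c.r * (3 * u₁) + 2 * c.t) * h2

theorem IsCurveLift.apply_Δ {φ : E0 ≃ₐ[W4] E0} {c : WeierstrassCurve.VariableChange E0}
    {h : WeierstrassCurve.VariableChange F4} (H : IsCurveLift φ c h) :
    (c.u : E0) ^ 12 * φ curveU.Δ = curveU.Δ := by
  have h1 := congrArg WeierstrassCurve.Δ H.smul
  have h2 : (c.u : E0) ^ 12 * (↑c.u⁻¹ : E0) ^ 12 = 1 := by rw [← mul_pow, c.u.mul_inv, one_pow]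
  rw [WeierstrassCurve.variableChange_Δ, WeierstrassCurve.map_Δ, RingHom.coe_coe] at h1
  linear_combination -(c.u : E0) ^ 12 * h1 + curveU.Δ * h2

theorem j_congr {R : Type*} [CommRing R] {W W' : WeierstrassCurve R} [W.IsElliptic]
    [W'.IsElliptic] (h : W = W') : W.j = W'.j := by
  subst h
  rfl

theorem IsCurveLift.apply_jInv {φ : E0 ≃ₐ[W4] E0} {c : WeierstrassCurve.VariableChange E0}
    {h : WeierstrassCurve.VariableChange F4} (H : IsCurveLift φ c h) : φ jInv = jInv := by
  have h1 := j_congr H.smul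
  rw [WeierstrassCurve.variableChange_j, WeierstrassCurve.map_j] at h1
  exact h1.symm

/-- Since `φ` is not assumed continuous, the identity is proved modulo all powers of the maximal
ideal, peeling off one factor `e` at a time. -/
theorem apply_subst {φ : E0 ≃ₐ[W4] E0} {e : E0} (he : PowerSeries.constantCoeff e = 0)
    (h : φ e = e) (p : PowerSeries W4) :
    φ (PowerSeries.subst e p) = PowerSeries.subst e p := by
  have hs : PowerSeries.HasSubst e := PowerSeries.HasSubst.of_constantCoeff_zero' he
  refine eq_of_forall_sub_mem fun n => ?_
  induction n generalizing p with
  | zero => simp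
  | succ n ih =>
    obtain ⟨b, c, rfl⟩ : ∃ b c, p = PowerSeries.X * b + PowerSeries.C c :=
      ⟨_, _, PowerSeries.eq_X_mul_shift_add_const p⟩
    have h1 : PowerSeries.subst e (PowerSeries.X * b + PowerSeries.C c) =
        e * PowerSeries.subst e b + algebraMap W4 E0 c := by
      rw [PowerSeries.subst_add hs, PowerSeries.subst_mul hs, PowerSeries.subst_X hs]
      congr 1
      exact PowerSeries.subst_C c
    have h2 : e ∈ RingHom.ker residue := by
      rw [RingHom.mem_ker, residue, RingHom.comp_apply, he, map_zero]
    rw [h1, map_add, map_mul, h, AlgEquiv.commutes, add_sub_add_right_eq_sub, ← mul_sub, pow_succ']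
    exact Ideal.mul_mem_mul h2 (ih b)

/-! ### Invariants of the action -/

/-- Modulo 2 the transformation formula of `a₁ = 3u₁` says that the factor acquired by `u⁻¹` cancels
that of `u₁`. -/
theorem modTwo_actE_v₁ (g : G24) : modTwo actE g (red v₁) = red v₁ := by
  change red (actE g v₁) = _
  have h := actE_T_neg g 1
  rw [Nat.cast_one, pow_one] at h
  rw [v₁, map_mul, actE_C, h, ← mul_assoc, ← map_mul]
  refine red_C_mul_eq ((liftC g).s + u₁ - actE0 g u₁ * (liftC g).u) ?_ _
  linear_combination (isCurveLift g).a₁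

theorem actE_Δ (g : G24) : actE g Δ = Δ := by
  have h := actE_T_neg g 12
  rw [show (-((12 : ℕ) : ℤ)) = -12 by norm_num] at h
  rw [Δ, map_mul, actE_C, h, ← mul_assoc, ← map_mul, mul_comm (actE0 g _),
    (isCurveLift g).apply_Δ]

theorem modTwo_actE_evalSeries {e : E0} (he : PowerSeries.constantCoeff e = 0) {g : G24}
    (h : actE0 g e = e) (p : PowerSeries W4) :
    modTwo actE g (evalSeries e p) = evalSeries e p := by
  change red (actE g _) = _
  rw [actE_C, apply_subst he h]
  rfl

theorem constantCoeff_curveU_c₄ : PowerSeries.constantCoeff curveU.c₄ = 0 := by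
  simp [curveU, WeierstrassCurve.c₄, WeierstrassCurve.b₂, WeierstrassCurve.b₄]

theorem Δ_mul_jInv : curveU.Δ * jInv = curveU.c₄ ^ 3 := by
  rw [jInv, WeierstrassCurve.j, ← mul_assoc, ← WeierstrassCurve.coe_Δ', Units.mul_inv, one_mul]

/-- The witness is read off from the cube of `c₄ = u₁⁴ + 2 (4u₁⁴ + 36u₁)`. -/
theorem exists_curveU_c₄_pow : ∃ w, curveU.c₄ ^ 3 = u₁ ^ 12 + 2 * w := by
  refine ⟨3 * u₁ ^ 8 * (4 * u₁ ^ 4 + 36 * u₁) + 6 * u₁ ^ 4 * (4 * u₁ ^ 4 + 36 * u₁) ^ 2 +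
    4 * (4 * u₁ ^ 4 + 36 * u₁) ^ 3, ?_⟩
  simp only [curveU, WeierstrassCurve.c₄, WeierstrassCurve.b₂, WeierstrassCurve.b₄]
  ring

theorem hasRedOrder_jInv : HasRedOrder 12 jInv where
  pos := by norm_num
  order := by
    have h : IsUnit (redSeries (↑(curveU.Δ')⁻¹ : E0)) := (Units.isUnit _).map redSeries
    refine ⟨_, (PowerSeries.isUnit_iff_constantCoeff.1 h).ne_zero, ?_⟩
    obtain ⟨w, hw⟩ := exists_curveU_c₄_pow
    rw [jInv, WeierstrassCurve.j, map_mul, hw, map_add, (redSeries_eq_zero_iff (2 * w)).2 ⟨w, rfl⟩,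
      map_pow, redSeries_u₁]
    ring
  constantCoeff := by
    rw [jInv, WeierstrassCurve.j, map_mul, map_pow, constantCoeff_curveU_c₄]
    ring

theorem hasRedOrder_j₀ : HasRedOrder 3 j₀ where
  pos := by norm_num
  order := ⟨1, by simp, by rw [j₀, map_pow, redSeries_u₁, mul_one]⟩
  constantCoeff := by simp [j₀]

theorem red_Δ_mul : red Δ * redC jInv = red v₁ ^ 12 := by
  obtain ⟨w, hw⟩ := exists_curveU_c₄_pow
  have h1 : Δ * LaurentPolynomial.C jInv =
      LaurentPolynomial.C (curveU.c₄ ^ 3) * LaurentPolynomial.T (-12) := by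
    rw [← Δ_mul_jInv, Δ, map_mul]
    ring
  have h2 : v₁ ^ 12 = LaurentPolynomial.C (u₁ ^ 12) * LaurentPolynomial.T (-12) := by
    rw [v₁, mul_pow, ← map_pow, LaurentPolynomial.T_pow]
    norm_num
  change red Δ * red (LaurentPolynomial.C jInv) = _
  rw [← map_mul, ← map_pow, h1, h2]
  exact red_C_mul_eq w hw _

theorem red_v₂_mul : red v₂ * redC j₀ = red v₁ ^ 3 := by
  change red v₂ * red (LaurentPolynomial.C j₀) = _
  rw [← map_mul, ← map_pow, v₁, mul_pow, ← map_pow, LaurentPolynomial.T_pow, mul_comm, v₂, j₀]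
  norm_num

theorem actE0_eq {g : G24} {φ : E0 ≃ₐ[W4] E0} {c : WeierstrassCurve.VariableChange E0}
    (hc : IsCurveLift φ c (g⁻¹).1) : actE0 g = φ ∧ (liftC g).u = c.u :=
  (isCurveLift g).unique hc

theorem actE0_j₀ {g : G24} (hg : g ∈ C6) : actE0 g j₀ = j₀ := by
  obtain ⟨φ, c, hc, h1, -⟩ := exists_isCurveLift_of_s_eq_zero (g⁻¹).2 (inv_mem hg).2
  have h2 : teich (g⁻¹).1.u ^ 3 = 1 := teich_pow_three (g⁻¹).1.u.ne_zero
  rw [(actE0_eq hc).1, j₀, map_pow, h1, mul_pow, ← map_pow, ← pow_mul, mul_comm 2 3, pow_mul, h2,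
    one_pow, map_one, one_mul]

theorem modTwo_actE_v₂ {g : G24} (hg : g ∈ C6) : modTwo actE g (red v₂) = red v₂ := by
  obtain ⟨φ, c, hc, -, h1⟩ := exists_isCurveLift_of_s_eq_zero (g⁻¹).2 (inv_mem hg).2
  have h2 := C_pow_three (teich_pow_three (g⁻¹).1.u.ne_zero)
  have h3 : ∃ w, (c.u : E0) ^ 3 = 1 + 2 * w := by
    rcases h1 with h1 | h1
    · exact ⟨0, by rw [h1.2, h2]; ring⟩
    · exact ⟨-1, by rw [h1.2]; linear_combination -h2⟩
  obtain ⟨w, hw⟩ := h3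
  change red (actE g v₂) = _
  have h := actE_T_neg g 3
  rw [show (-((3 : ℕ) : ℤ)) = -3 by norm_num, (actE0_eq hc).2] at h
  rw [v₂, h, red_C_mul_eq w hw, map_one, one_mul]

/-- The inversion `(x, y) ↦ (x, y + 1)` of `curveC`. -/
def inversion : G24 :=
  ⟨⟨1, 0, 0, 1⟩, by
    have h2 := two_eq_zero_F4
    rw [MulAction.mem_stabilizer_iff]
    ext
    · simp [WeierstrassCurve.variableChange_a₁, curveC]
    · simp [WeierstrassCurve.variableChange_a₂, curveC]
    · simp [WeierstrassCurve.variableChange_a₃, curveC, h2]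
    · simp [WeierstrassCurve.variableChange_a₄, curveC]
    · simp only [WeierstrassCurve.variableChange_a₆, curveC]
      simp only [inv_one, Units.val_one]
      linear_combination -h2⟩

theorem inversion_mul_self : inversion * inversion = 1 := by
  have h2 := two_eq_zero_F4
  refine Subtype.ext ?_
  change (⟨1, 0, 0, 1⟩ : WeierstrassCurve.VariableChange F4) * ⟨1, 0, 0, 1⟩ = 1
  rw [WeierstrassCurve.VariableChange.mul_def, WeierstrassCurve.VariableChange.one_def]
  ext
  · simp
  · simp
  · simp
  · simp only [Units.val_one]
    linear_combination h2

theorem inversion_inv : inversion⁻¹ = inversion := inv_eq_of_mul_eq_one_right inversion_mul_self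

theorem inversion_ne_one : inversion ≠ 1 := by
  intro h
  have := congrArg (fun g : G24 => g.1.t) h
  exact one_ne_zero this

theorem mul_inversion (g : G24) : g * inversion = inversion * g := by
  have h3 := F4_pow_three g.1.u.ne_zero
  refine Subtype.ext ?_
  change g.1 * (⟨1, 0, 0, 1⟩ : WeierstrassCurve.VariableChange F4) = ⟨1, 0, 0, 1⟩ * g.1
  rw [WeierstrassCurve.VariableChange.mul_def, WeierstrassCurve.VariableChange.mul_def]
  ext
  · simp
  · simp
  · simp
  · simp only [Units.val_one]
    linear_combination -h3

/-- The inversion lifts to the negation of `curveU` itself, so it fixes `E0` and sends `u` to `-u`.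
-/
theorem isCurveLift_inversion :
    IsCurveLift 1 ⟨-1, 0, -(3 * u₁), -(u₁ ^ 3 - 1)⟩ (inversion⁻¹).1 where
  smul := by
    refine smul_curveU_eq (u := -1) (by simp) ?_ ?_ ?_ ?_ ?_ <;>
    simp only [AlgEquiv.one_apply] <;> ring
  map := by
    have h2 := two_eq_zero_F4
    rw [inversion_inv]
    ext
    · change residue (-1) = 1
      rw [map_neg, map_one]
      linear_combination -h2
    · exact map_zero residue
    · change residue (-(3 * u₁)) = 0
      rw [map_neg, map_mul, residue_u₁]
      ring
    · change residue (-(u₁ ^ 3 - 1)) = 1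
      rw [map_neg, map_sub, map_pow, residue_u₁, map_one]
      ring

theorem actE_inversion_T (n : ℤ) : actE inversion (LaurentPolynomial.T n) =
    LaurentPolynomial.C (↑((-1 : E0ˣ) ^ n) : E0) * LaurentPolynomial.T n := by
  rw [actE_T, (actE0_eq isCurveLift_inversion).2]
  simp

theorem actE_inversion_v₁ : actE inversion v₁ = -v₁ := by
  rw [v₁, map_mul, actE_C, actE_inversion_T, (actE0_eq isCurveLift_inversion).1]
  simp only [zpow_neg, zpow_one, inv_neg, inv_one, Units.val_neg, Units.val_one, map_neg, map_one,
    AlgEquiv.one_apply]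
  ring

theorem modTwo_actE_inversion (a : EV0) : modTwo actE inversion a = a := by
  obtain ⟨x, rfl⟩ := red_surjective a
  change red (actE inversion x) = red x
  induction x using LaurentPolynomial.induction_on' with
  | add p q hp hq => rw [map_add, map_add, map_add, hp, hq]
  | C_mul_T n a =>
    rw [map_mul, actE_C, actE_inversion_T, (actE0_eq isCurveLift_inversion).1, AlgEquiv.one_apply,
      ← mul_assoc, ← map_mul]
    rcases Int.even_or_odd n with hn | hn
    · rw [hn.neg_one_zpow]
      simp
    · rw [hn.neg_one_zpow]
      exact red_C_mul_eq (-a) (by simp; ring) n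

/-- An automorphism with `u = 1` and `s = 0` is the identity or the inversion. -/
theorem mem_zpowers_inversion {g : G24} (hu : g.1.u = 1) (hs : g.1.s = 0) :
    g ∈ Subgroup.zpowers inversion := by
  obtain ⟨hr, ht⟩ := mem_stabilizer_curveC g.2
  rw [hs, zero_pow (by norm_num)] at hr ht
  have ht0 : g.1.t * (g.1.t - 1) = 0 := by linear_combination ht - g.1.t * two_eq_zero_F4
  rcases mul_eq_zero.1 ht0 with ht0 | ht0
  · have : g = 1 := Subtype.ext (WeierstrassCurve.VariableChange.ext hu hr hs ht0)
    rw [this]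
    exact one_mem _
  · have : g = inversion :=
      Subtype.ext (WeierstrassCurve.VariableChange.ext hu hr hs (sub_eq_zero.1 ht0))
    rw [this]
    exact Subgroup.mem_zpowers _

/-- If `u₁` is fixed modulo 2, the formula for `a₁` gives `u ≡ 1`, and then the one for `a₃` gives
`r u₁ ≡ 0`, so `r ≡ 0`. On the special fibre `r = s ^ 2`, hence `s = 0`. The lift belongs to `g⁻¹`,
whence the passage to the inverse. -/
theorem mem_zpowers_of_redSeries_actE0 {g : G24} (hg : redSeries (actE0 g u₁) = PowerSeries.X) :
    g ∈ Subgroup.zpowers inversion := by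
  rw [← inv_mem_iff]
  have H := isCurveLift g
  have h2 : redSeries 2 = 0 := (redSeries_eq_zero_iff 2).2 ⟨1, by ring⟩
  have h2' : (2 : PowerSeries F4) = 0 := by rw [← h2, map_ofNat]
  have hres : ∀ a, PowerSeries.constantCoeff (redSeries a) = residue a := fun a =>
    constantCoeff_map_eq _ _
  have h1 := congrArg redSeries H.a₁
  have h3 := congrArg redSeries H.a₃
  simp only [map_mul, map_add, map_sub, map_pow, map_ofNat, map_one, hg, redSeries_u₁, h2'] at h1 h3
  have hu : redSeries (liftC g).u = 1 := by
    refine mul_right_cancel₀ PowerSeries.X_ne_zero ?_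
    linear_combination h1 - (redSeries (liftC g).u - 1) * PowerSeries.X * h2'
  have hr : redSeries (liftC g).r = 0 := by
    refine mul_right_cancel₀ PowerSeries.X_ne_zero ?_
    rw [hu] at h3
    linear_combination -h3 - redSeries (liftC g).r * PowerSeries.X * h2'
  have hm := H.map
  refine mem_zpowers_inversion ?_ ?_
  · refine Units.ext ?_
    rw [← hm]
    change residue (liftC g).u = 1
    rw [← hres, hu, map_one]
  · have h4 : (g⁻¹).1.r = 0 := by
      rw [← hm]
      change residue (liftC g).r = 0
      rw [← hres, hr, map_zero]
    rw [(mem_stabilizer_curveC (g⁻¹).2).1] at h4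
    exact pow_eq_zero_iff (by norm_num) |>.1 h4

/-! ### Orders of the groups -/

theorem card_F4 : Nat.card F4 = 4 := by
  rw [GaloisField.card 2 2 (by norm_num)]
  norm_num

theorem card_units_F4 : Nat.card F4ˣ = 3 := by
  rw [Nat.card_units, card_F4]

/-- For `s ≠ 0` the right side is 1, and a primitive cube root of unity is a solution. -/
theorem exists_sq_add_self (s : F4) : ∃ t : F4, t ^ 2 + t = s ^ 6 := by
  rcases eq_or_ne s 0 with rfl | hs
  · exact ⟨0, by ring⟩
  obtain ⟨z, hz⟩ : ∃ z : F4ˣ, z ≠ 1 := by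
    have : Nontrivial F4ˣ := Finite.one_lt_card_iff_nontrivial.1 (by rw [card_units_F4]; norm_num)
    exact exists_ne 1
  have h1 : ((z : F4) - 1) * ((z : F4) ^ 2 + z + 1) = 0 := by
    linear_combination F4_pow_three z.ne_zero
  have h2 := (mul_eq_zero.1 h1).resolve_left fun h => hz (Units.ext (sub_eq_zero.1 h))
  refine ⟨z, ?_⟩
  linear_combination h2 - (s ^ 3 + 1) * F4_pow_three hs - two_eq_zero_F4

theorem mk_mem_stabilizer (u : F4ˣ) {s t : F4} (ht : t ^ 2 + t = s ^ 6) :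
    (⟨u, s ^ 2, s, t⟩ : WeierstrassCurve.VariableChange F4) ∈
      MulAction.stabilizer (WeierstrassCurve.VariableChange F4) curveC := by
  have h2 := two_eq_zero_F4
  have hs4 : s ^ 4 = s := by
    rcases eq_or_ne s 0 with rfl | hs
    · ring
    · linear_combination s * F4_pow_three hs
  have hu := F4_pow_three (u⁻¹).ne_zero
  rw [MulAction.mem_stabilizer_iff]
  ext
  · simp [WeierstrassCurve.variableChange_a₁, curveC, h2]
  · simp only [WeierstrassCurve.variableChange_a₂, curveC]
    linear_combination (↑u⁻¹ : F4) ^ 2 * s ^ 2 * h2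
  · simp only [WeierstrassCurve.variableChange_a₃, curveC]
    linear_combination hu + (↑u⁻¹ : F4) ^ 3 * t * h2
  · simp only [WeierstrassCurve.variableChange_a₄, curveC]
    linear_combination (↑u⁻¹ : F4) ^ 4 * (3 * hs4 + (s - s * t) * h2)
  · simp only [WeierstrassCurve.variableChange_a₆, curveC]
    linear_combination -(↑u⁻¹ : F4) ^ 6 * ht

/-- In the stabilizer `r` is `s ^ 2`, and `t` is determined by `s` up to adding 1, which is the
effect of the inversion. Cosets are therefore pairs `(u, s)`. -/
theorem inv_mul_mem_zpowers_inversion {a b : G24} :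
    a⁻¹ * b ∈ Subgroup.zpowers inversion ↔ a.1.u = b.1.u ∧ a.1.s = b.1.s := by
  constructor
  · intro h
    obtain ⟨k, hk⟩ := Subgroup.mem_zpowers_iff.1 h
    have hx : (a⁻¹ * b).1.u = 1 ∧ (a⁻¹ * b).1.s = 0 := by
      have h2 : inversion ^ (2 : ℤ) = 1 := (zpow_two _).trans inversion_mul_self
      rw [← hk]
      obtain ⟨m, rfl | rfl⟩ := Int.even_or_odd' k
      · rw [zpow_mul, h2, one_zpow]
        exact ⟨rfl, rfl⟩
      · rw [zpow_add, zpow_mul, h2, one_zpow, one_mul, zpow_one]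
        exact ⟨rfl, rfl⟩
    have hb : b.1 = a.1 * (a⁻¹ * b).1 := by
      rw [← Subgroup.coe_mul, mul_inv_cancel_left]
    generalize a⁻¹ * b = x at hx hb
    rw [hb, WeierstrassCurve.VariableChange.mul_def]
    simp [hx]
  · rintro ⟨hu, hs⟩
    refine mem_zpowers_inversion ?_ ?_
    · change a.1.u⁻¹ * b.1.u = 1
      rw [hu, inv_mul_cancel]
    · change (b.1.u : F4) * (-a.1.s * (↑a.1.u⁻¹ : F4)) + b.1.s = 0
      rw [hu, hs]
      linear_combination -b.1.s * b.1.u.mul_inv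

theorem card_quotient_G24 : Nat.card (G24 ⧸ Subgroup.zpowers inversion) = 12 := by
  have h : Function.Bijective fun p : F4ˣ × F4 =>
      (QuotientGroup.mk (⟨_, mk_mem_stabilizer p.1 (exists_sq_add_self p.2).choose_spec⟩ : G24) :
        G24 ⧸ Subgroup.zpowers inversion) := by
    constructor
    · intro p q hpq
      obtain ⟨h1, h2⟩ := inv_mul_mem_zpowers_inversion.1 (QuotientGroup.eq.1 hpq)
      exact Prod.ext h1 h2
    · intro q
      obtain ⟨g, rfl⟩ := QuotientGroup.mk_surjective q
      exact ⟨(g.1.u, g.1.s), QuotientGroup.eq.2 (inv_mul_mem_zpowers_inversion.2 ⟨rfl, rfl⟩)⟩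
  rw [← Nat.card_congr (Equiv.ofBijective _ h), Nat.card_prod, card_units_F4, card_F4]

/-- The inversion as an element of `C6`. -/
def inversionC6 : C6 := ⟨inversion, rfl, rfl⟩

theorem mem_zpowers_inversionC6 {g : C6} :
    g ∈ Subgroup.zpowers inversionC6 ↔ (g : G24) ∈ Subgroup.zpowers inversion := by
  have h : (Subgroup.zpowers inversionC6).map C6.subtype = Subgroup.zpowers inversion :=
    MonoidHom.map_zpowers _ _
  rw [← h]
  exact (Subgroup.mem_map_iff_mem C6.subtype_injective).symm

theorem card_quotient_C6 : Nat.card (C6 ⧸ Subgroup.zpowers inversionC6) = 3 := by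
  have h0 (u : F4ˣ) : (⟨u, 0, 0, 0⟩ : WeierstrassCurve.VariableChange F4) ∈
      MulAction.stabilizer (WeierstrassCurve.VariableChange F4) curveC := by
    have := mk_mem_stabilizer u (s := 0) (t := 0) (by ring)
    rwa [zero_pow (by norm_num)] at this
  have h : Function.Bijective fun u : F4ˣ =>
      (QuotientGroup.mk (⟨⟨_, h0 u⟩, rfl, rfl⟩ : C6) : C6 ⧸ Subgroup.zpowers inversionC6) := by
    constructor
    · intro p q hpq
      exact (inv_mul_mem_zpowers_inversion.1
        (mem_zpowers_inversionC6.1 (QuotientGroup.eq.1 hpq))).1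
    · intro q
      obtain ⟨g, rfl⟩ := QuotientGroup.mk_surjective q
      exact ⟨g.1.1.u, QuotientGroup.eq.2 (mem_zpowers_inversionC6.2
        (inv_mul_mem_zpowers_inversion.2 ⟨rfl, g.2.2.symm⟩))⟩
  rw [← Nat.card_congr (Equiv.ofBijective _ h), card_units_F4]

/-! ### The two cohomology rings -/

/-- The number 12 enters twice, as the order of vanishing of `j` modulo 2 and as the order of the
group modulo the inversion. Their equality makes all invariants series in `j`. -/
theorem isGoodAction_G24 : IsGoodAction actE inversion actE0 12 jInv Δ where
  order := hasRedOrder_jInv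
  apply_C := actE_C
  apply_T g n := ⟨_, actE_T g n⟩
  inv_v := modTwo_actE_v₁
  inv_y g := congrArg red (actE_Δ g)
  inv_e p g := modTwo_actE_evalSeries hasRedOrder_jInv.constantCoeff (isCurveLift g).apply_jInv p
  rel := red_Δ_mul
  mul_self := inversion_mul_self
  ne_one := inversion_ne_one
  central := mul_inversion
  trivial := modTwo_actE_inversion
  apply_v := actE_inversion_v₁
  faithful _ := mem_zpowers_of_redSeries_actE0
  card := card_quotient_G24

theorem isGoodAction_C6 : IsGoodAction (actE.comp C6.subtype) inversionC6
    (fun g => actE0 g) 3 j₀ v₂ where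
  order := hasRedOrder_j₀
  apply_C g := actE_C g
  apply_T g n := ⟨_, actE_T g n⟩
  inv_v g := modTwo_actE_v₁ g
  inv_y g := modTwo_actE_v₂ g.2
  inv_e p g := modTwo_actE_evalSeries hasRedOrder_j₀.constantCoeff (actE0_j₀ g.2) p
  rel := red_v₂_mul
  mul_self := Subtype.ext inversion_mul_self
  ne_one h := inversion_ne_one (congrArg Subtype.val h)
  central g := Subtype.ext (mul_inversion g)
  trivial := modTwo_actE_inversion
  apply_v := actE_inversion_v₁
  faithful _ h := mem_zpowers_inversionC6.2 (mem_zpowers_of_redSeries_actE0 h)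
  card := card_quotient_C6

end

end MoravaE

theorem mainTheorem8 :
    (∃! ρ : MoravaE.G24 →* (MoravaE.E ≃ₐ[MoravaE.W4] MoravaE.E), MoravaE.IsLubinTateAction ρ) ∧
    ∀ ρ : MoravaE.G24 →* (MoravaE.E ≃ₐ[MoravaE.W4] MoravaE.E), MoravaE.IsLubinTateAction ρ →
      MoravaE.LocalizedCohomologyIso ρ MoravaE.Δ 24 MoravaE.jInv MoravaE.relG24 ∧
      MoravaE.LocalizedCohomologyIso (ρ.comp MoravaE.C6.subtype) MoravaE.v₂ 6 MoravaE.j₀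
        MoravaE.relC6 := by
  refine ⟨⟨MoravaE.actE, MoravaE.isLubinTateAction_actE, fun ρ h => h.eq_actE⟩, fun ρ h => ?_⟩
  rw [h.eq_actE]
  exact ⟨MoravaE.isGoodAction_G24.localizedCohomologyIso
      (MoravaE.isGoodRelation_relG24 MoravaE.hasRedOrder_jInv),
    MoravaE.isGoodAction_C6.localizedCohomologyIso
      (MoravaE.isGoodRelation_relC6 MoravaE.hasRedOrder_j₀)⟩
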